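/- Let $A$ be a Weil algebra, that is, a commutative, local, finite dimensional $\mathbb R$-algebra with residue field $\mathbb R$ and maximal ideal $\mathfrak m_A$. Let $\ell$ be its order (the first integer with $\mathfrak m_A^{\ell+1}=0$) and $\dim_{\mathbb R}\mathfrak m_A/\mathfrak m_A^2$ its width. Let $M$ be a smooth manifold (Hausdorff, second countable) of dimension $n\ge$ width of $A$. For a Weil algebra $B$, a $B$-point of $M$ is an $\mathbb R$-algebra morphism $p\colon C^\infty(M)\to B$; it is regular if it is surjective, and it is near $x\in M$ if its composition with $B\to B/\mathfrak m_B=\mathbb R$ is the evaluation at $x$. Let $M^B$ be the set of $B$-points and $\check M^B$ the set of regular ones. A jet of type $A$ is an ideal $\mathfrak p\subset C^\infty(M)$ with $C^\infty(M)/\mathfrak p\cong A$; it is near $x$ if all its functions vanish at $x$. Let $J^A(M)$ be the set of jets of type $A$. For $U\subseteq M$ open, let $\check U^B$ and $J^A(U)$ be the sets of regular $B$-points and of jets of type $A$ of $M$ that are near points of $U$. The set $M^B$ has the smooth structure for which the real components of $p\mapsto p(f)\in B$, $f\in C^\infty(M)$, are smooth and, if $x^1,\dots,x^n\in C^\infty(M)$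 are coordinates on an open set $U$, the real components of $p\mapsto (p(x^1),\dots,p(x^n))\in B^n$ are coordinates on the (open) set of $B$-points near points of $U$, which is thereby identified with the set of those $n$-tuples of $B^n$ whose classes mod $\mathfrak m_B$ are the coordinates of a point of $U$. $\check M^B$ is an open submanifold. The automorphism groups of $B$, and their subgroups below, are Lie groups as embedded submanifolds of the space of matrices. 1. $\check M^A$ (with the structure above) and $J^A(M)$ have smooth manifold structures. The map $\operatorname{Ker}\colon\check M^A\to J^A(M)$ is a smooth submersion, and this property determines the structure of $J^A(M)$ from that of $\check M^A$. It makes $\check M^A$ a smooth principal bundle with base $J^A(M)$ and structural group $\operatorname{Aut}A$, acting by $g\cdot p=g\circ p$. 2. Let $\mathbb R_n^\ell=\mathbb R[X_1,\dots,X_n]/(X_1,\dots,X_n)^{\ell+1}$ and $G=\operatorname{Aut}\mathbb R_n^\ell$. Surjective morphisms $\alpha\colon\mathbb R_n^\ell\to A$ exist. For each of them put $I=\operatorname{Ker}\alpha$, $G_\alpha=\{g\in G: \alpha\circ g=\alpha\}$ and $G_I=\{g\in G: g(I)=I\}$. Then $G_\alpha$ is contained in $G_I$ and is normal in it, and $G_I/G_\alpha\cong\operatorname{Aut}A$,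 where the class of $g$ corresponds to the automorphism $\tilde g$ with $\tilde g\circ\alpha=\alpha\circ g$; the morphism $G_I\to\operatorname{Aut}A$ is a smooth submersion of Lie groups. The sets $G/G_\alpha$ and $G/G_I$ of right cosets $G_\alpha g$, $G_Ig$ have smooth structures for which the projections of $G$ onto them are submersions. Let $U$ be any open set of $M$ with coordinates $x^1,\dots,x^n$. There is a unique family $\xi$ of regular $\mathbb R_n^\ell$-points $\xi(y)$ near $y$, $y\in U$, that send $x^i$ to $x^i(y)+X_i$ (that is, $\xi(y)f=x^i(y)+X_i$ for each $f\in C^\infty(M)$ that coincides with $x^i$ near $y$). The maps $\xi$, $\alpha\circ\xi$ and $\operatorname{Ker}(\alpha\circ\xi)$ are smooth sections over $U$ of $\check U_n^\ell:=\check U^{\mathbb R_n^\ell}$, $\check U^A$ and $J^A(U)$, and the maps $(y,g)\mapsto g\circ\xi(y)$, $(y,G_\alpha g)\mapsto\alpha\circ g\circ\xi(y)$, $(y,G_Ig)\mapsto\operatorname{Ker}(\alpha\circ g\circ\xi(y))$ are (well defined) diffeomorphisms over $U$ $$U\times G\simeq\check U_n^\ell,\qquad U\times G/G_\alpha\simeq\check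 U^A,\qquad U\times G/G_I\simeq J^A(U).$$ -/

import Mathlib

open scoped Manifold ContDiff

universe u v w

/-! ### Weil algebras -/

/-- A Weil algebra: a commutative, local, finite dimensional real algebra which is rational, that is,
whose residue field is `ℝ`. -/
class IsWeilAlgebra (A : Type u) [CommRing A] [Algebra ℝ A] : Prop extends IsLocalRing A where
  finite : Module.Finite ℝ A
  rational : Function.Bijective (algebraMap ℝ (IsLocalRing.ResidueField A))

attribute [instance] IsWeilAlgebra.finite

/-- The order of a Weil algebra: the first `ℓ` with `𝔪 ^ (ℓ + 1) = 0`. -/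
noncomputable def weilOrder (A : Type u) [CommRing A] [Algebra ℝ A] [IsWeilAlgebra A] : ℕ :=
  sInf {l : ℕ | IsLocalRing.maximalIdeal A ^ (l + 1) = ⊥}

/-- The width of a Weil algebra: the real dimension of `𝔪 / 𝔪 ^ 2`. -/
noncomputable def weilWidth (A : Type u) [CommRing A] [Algebra ℝ A] [IsWeilAlgebra A] : ℕ :=
  Module.finrank ℝ (IsLocalRing.maximalIdeal A).Cotangent

/-- The real components of the elements of `A` with respect to a basis of `A` over `ℝ`. -/
noncomputable def realComponents (A : Type u) [CommRing A] [Algebra ℝ A] [IsWeilAlgebra A] :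
    A ≃ₗ[ℝ] (Fin (Module.finrank ℝ A) → ℝ) :=
  (Module.finBasis ℝ A).equivFun

/-- The algebra `ℝ[x₁, …, xₙ] / (x₁, …, xₙ) ^ (l + 1)` of truncated polynomials. -/
abbrev TruncPoly (n l : ℕ) : Type :=
  MvPolynomial (Fin n) ℝ ⧸ (MvPolynomial.idealOfVars (Fin n) ℝ) ^ (l + 1)

/-- The class of the `i`-th variable. -/
noncomputable def TruncPoly.var (n l : ℕ) (i : Fin n) : TruncPoly n l :=
  Ideal.Quotient.mk _ (MvPolynomial.X i)

theorem TruncPoly.isNilpotent_sub {n l : ℕ} (p : MvPolynomial (Fin n) ℝ) :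
    IsNilpotent (Ideal.Quotient.mk ((MvPolynomial.idealOfVars (Fin n) ℝ) ^ (l + 1)) p -
      algebraMap ℝ (TruncPoly n l) (MvPolynomial.constantCoeff p)) := by
  have h : p - MvPolynomial.C (MvPolynomial.constantCoeff p) ∈
      MvPolynomial.idealOfVars (Fin n) ℝ := by
    have := (MvPolynomial.mem_pow_idealOfVars_iff' 1
      (p - MvPolynomial.C (MvPolynomial.constantCoeff p))).mpr (by
        intro x hx
        have hx0 : x = 0 := by
          rw [← Finsupp.degree_eq_zero_iff]
          omega
        subst hx0
        simp [MvPolynomial.constantCoeff_eq])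
    simpa using this
  refine ⟨l + 1, ?_⟩
  have h2 : algebraMap ℝ (TruncPoly n l) (MvPolynomial.constantCoeff p) =
      Ideal.Quotient.mk _ (MvPolynomial.C (MvPolynomial.constantCoeff p)) := rfl
  rw [h2, ← map_sub, ← map_pow, Ideal.Quotient.eq_zero_iff_mem]
  exact Ideal.pow_mem_pow h _

theorem TruncPoly.isUnit_mk {n l : ℕ} (p : MvPolynomial (Fin n) ℝ)
    (h : MvPolynomial.constantCoeff p ≠ 0) :
    IsUnit (Ideal.Quotient.mk ((MvPolynomial.idealOfVars (Fin n) ℝ) ^ (l + 1)) p) := by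
  have h1 : IsUnit (algebraMap ℝ (TruncPoly n l) (MvPolynomial.constantCoeff p)) :=
    (IsUnit.mk0 _ h).map _
  have h2 := (TruncPoly.isNilpotent_sub (l := l) p).isUnit_add_left_of_commute h1
    (Commute.all _ _)
  simpa using h2

instance TruncPoly.instNontrivial (n l : ℕ) : Nontrivial (TruncPoly n l) := by
  apply Ideal.Quotient.nontrivial_iff.mpr
  intro h
  have h1 : (1 : MvPolynomial (Fin n) ℝ) ∈ (MvPolynomial.idealOfVars (Fin n) ℝ) ^ (l + 1) := by
    rw [h]; trivial
  have := (MvPolynomial.mem_pow_idealOfVars_iff' _ _).mp h1 0 (by simp)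
  simp at this

instance TruncPoly.instIsLocalRing (n l : ℕ) : IsLocalRing (TruncPoly n l) := by
  apply IsLocalRing.of_isUnit_or_isUnit_one_sub_self
  intro a
  obtain ⟨p, rfl⟩ := Ideal.Quotient.mk_surjective a
  by_cases h : MvPolynomial.constantCoeff p = 0
  · right
    have := TruncPoly.isUnit_mk (l := l) (1 - p) (by simp [h])
    simpa using this
  · exact Or.inl (TruncPoly.isUnit_mk p h)

/-- The truncated polynomials form a Weil algebra. -/
instance TruncPoly.instIsWeilAlgebra (n l : ℕ) : IsWeilAlgebra (TruncPoly n l) where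
  finite := by
    have hfin : {x : Fin n →₀ ℕ | x.degree ≤ l}.Finite := Finsupp.finite_of_degree_le l
    refine ⟨Submodule.fg_def.mpr ⟨(fun x : Fin n →₀ ℕ =>
      (Ideal.Quotient.mk _ (MvPolynomial.monomial x 1) : TruncPoly n l)) '' _, hfin.image _, ?_⟩⟩
    refine Submodule.eq_top_iff'.mpr fun a => ?_
    obtain ⟨p, rfl⟩ := Ideal.Quotient.mk_surjective a
    rw [p.as_sum, map_sum]
    refine Submodule.sum_mem _ fun x _ => ?_
    have hx : (Ideal.Quotient.mk _ (MvPolynomial.monomial x (p.coeff x)) : TruncPoly n l) =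
        p.coeff x • Ideal.Quotient.mk _ (MvPolynomial.monomial x 1) := by
      rw [← mul_one (p.coeff x), ← smul_eq_mul, ← MvPolynomial.smul_monomial, smul_eq_mul, mul_one]
      rfl
    rw [hx]
    by_cases h : x.degree ≤ l
    · exact Submodule.smul_mem _ _ (Submodule.subset_span ⟨x, h, rfl⟩)
    · have h0 : (Ideal.Quotient.mk _ (MvPolynomial.monomial x 1) : TruncPoly n l) = 0 := by
        rw [Ideal.Quotient.eq_zero_iff_mem, MvPolynomial.mem_pow_idealOfVars_iff']
        intro z hz
        rw [MvPolynomial.coeff_monomial, if_neg]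
        rintro rfl
        omega
      rw [h0, smul_zero]
      exact Submodule.zero_mem _
  rational := by
    refine ⟨(algebraMap ℝ _).injective, fun a => ?_⟩
    obtain ⟨r, rfl⟩ := IsLocalRing.residue_surjective a
    obtain ⟨p, rfl⟩ := Ideal.Quotient.mk_surjective r
    refine ⟨MvPolynomial.constantCoeff p, ?_⟩
    have h := TruncPoly.isNilpotent_sub (l := l) p
    have h1 := (h.map (IsLocalRing.residue (TruncPoly n l))).eq_zero
    rw [map_sub, sub_eq_zero] at h1
    exact h1.symm

/-! ### Smooth structures on a set -/

/-- A structure of smooth manifold (Hausdorff, second countable, without boundary, of some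
dimension) on a set `X`. -/
structure SmoothStructure (X : Type u) where
  dim : ℕ
  top : TopologicalSpace X
  charted : ChartedSpace (EuclideanSpace ℝ (Fin dim)) X
  isManifold : IsManifold (𝓡 dim) ∞ X
  t2 : T2Space X
  secondCountable : SecondCountableTopology X

namespace SmoothStructure

/-- The set `X`, seen as a manifold by means of the structure `S`. -/
def Carrier {X : Type u} (_S : SmoothStructure X) : Type u := X

instance {X : Type u} : CoeSort (SmoothStructure X) (Type u) := ⟨Carrier⟩

section

variable {X : Type u} (S : SmoothStructure X)

instance : TopologicalSpace S := S.top
instance : ChartedSpace (EuclideanSpace ℝ (Fin S.dim)) S := S.charted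
instance : IsManifold (𝓡 S.dim) ∞ S := S.isManifold
instance : T2Space S := S.t2
instance : SecondCountableTopology S := S.secondCountable
instance [Group X] : Group S := inferInstanceAs (Group X)

/-- A point of the set `X`, as a point of the manifold. -/
def of (x : X) : S := x

/-- A point of the manifold, as a point of the set `X`. -/
def get (x : S) : X := x

end

section

variable {X : Type u} {Y : Type v} (S : SmoothStructure X) (T : SmoothStructure Y)

/-- `f` is smooth for the smooth structures `S` and `T`. -/
def IsSmooth (f : X → Y) : Prop :=
  ContMDiff (𝓡 S.dim) (𝓡 T.dim) ∞ (fun x : S => T.of (f (S.get x)))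

/-- `f` is a smooth submersion for the smooth structures `S` and `T`. -/
def IsSubmersion (f : X → Y) : Prop :=
  Manifold.IsSubmersion (𝓡 S.dim) (𝓡 T.dim) ∞ (fun x : S => T.of (f (S.get x)))

end

/-- Two smooth structures on `X` are the same when the identity is a diffeomorphism. -/
def Same {X : Type u} (S T : SmoothStructure X) : Prop :=
  S.IsSmooth T id ∧ T.IsSmooth S id

end SmoothStructure

/-- `f` is a diffeomorphism of the whole manifold `N` onto the open subset `V` of `N'`. -/
def IsDiffeoOnto {E E' H H' N N' : Type*} [NormedAddCommGroup E] [NormedSpace ℝ E]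
    [NormedAddCommGroup E'] [NormedSpace ℝ E'] [TopologicalSpace H] [TopologicalSpace H']
    (I : ModelWithCorners ℝ E H) (I' : ModelWithCorners ℝ E' H')
    [TopologicalSpace N] [ChartedSpace H N] [TopologicalSpace N'] [ChartedSpace H' N']
    (f : N → N') (V : Set N') : Prop :=
  IsLocalDiffeomorph I I' ∞ f ∧ Function.Injective f ∧ Set.range f = V

/-- A smooth principal bundle `π : P → B` with structural group the Lie group `G`, which acts on the
left on `P`: around each point of `B` there is a trivialization `W × G ≃ π⁻¹(W)` over `W` which
is `G`-equivariant. -/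
structure IsPrincipalBundle {G : Type u} {P : Type v} {B : Type w} [Group G] [MulAction G P]
    (SG : SmoothStructure G) (SP : SmoothStructure P) (SB : SmoothStructure B)
    (π : P → B) : Prop where
  lieGroup : LieGroup (𝓡 SG.dim) ∞ SG
  smooth_action : ContMDiff ((𝓡 SG.dim).prod (𝓡 SP.dim)) (𝓡 SP.dim) ∞
    (fun q : SG × SP => SP.of (SG.get q.1 • SP.get q.2))
  smooth_proj : SP.IsSmooth SB π
  proj_smul : ∀ (g : G) (p : P), π (g • p) = π p
  locally_trivial : ∀ b : B, ∃ (W : TopologicalSpace.Opens SB) (Ψ : W × SG → SP), SB.of b ∈ W ∧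
    IsDiffeoOnto ((𝓡 SB.dim).prod (𝓡 SG.dim)) (𝓡 SP.dim) Ψ {p | SB.of (π (SP.get p)) ∈ W} ∧
    (∀ (x : W) (g : G), π (SP.get (Ψ (x, SG.of g))) = SB.get x) ∧
    (∀ (x : W) (h g : G), SP.get (Ψ (x, SG.of (h * g))) = h • SP.get (Ψ (x, SG.of g)))

/-! ### Points and jets of type `A` -/

section PointsAndJets

variable (n : ℕ) (M : Type v) [TopologicalSpace M] [ChartedSpace (EuclideanSpace ℝ (Fin n)) M]

/-- The ring of real valued smooth functions on the `n`-dimensional manifold `M`. -/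
abbrev SmoothRing : Type v := C^∞⟮𝓡 n, M; 𝓘(ℝ, ℝ), ℝ⟯

variable (A : Type u) [CommRing A] [Algebra ℝ A]

/-- `A`-points of `M`. -/
abbrev APoint : Type (max u v) := SmoothRing n M →ₐ[ℝ] A

/-- Regular `A`-points of `M`: the surjective ones. -/
abbrev RegularPoint : Type (max u v) := {p : APoint n M A // Function.Surjective p}

/-- Jets of type `A` of `M`: the ideals `𝔭` of the ring of smooth functions whose quotient is
isomorphic to `A`. -/
abbrev Jet : Type v := {I : Ideal (SmoothRing n M) // Nonempty ((SmoothRing n M ⧸ I) ≃ₐ[ℝ] A)}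

variable {n M A}

/-- The `A`-point `p` is near `x`: followed by `A → A / 𝔪 = ℝ` it is the evaluation at `x`. -/
def APoint.IsNear [IsLocalRing A] (p : APoint n M A) (x : M) : Prop :=
  ∀ f : SmoothRing n M,
    IsLocalRing.residue A (p f) = algebraMap ℝ (IsLocalRing.ResidueField A) (f x)

/-- A regular `A`-point is near `x` when it is so as an `A`-point. -/
def RegularPoint.IsNear [IsLocalRing A] (p : RegularPoint n M A) (x : M) : Prop :=
  p.1.IsNear x

/-- The jet `𝔭` is near `x`: it is contained in the ideal of the functions vanishing at `x`. -/
def Jet.IsNear (j : Jet n M A) (x : M) : Prop :=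
  ∀ f ∈ j.1, f x = 0

/-- The jet of a regular point: its kernel. -/
noncomputable def RegularPoint.ker (p : RegularPoint n M A) : Jet n M A :=
  ⟨RingHom.ker p.1, ⟨Ideal.quotientKerAlgEquivOfSurjective p.2⟩⟩

/-- The group of automorphisms of `A` acts on the regular `A`-points: `g • p = g ∘ p`. -/
noncomputable instance RegularPoint.instMulAction : MulAction (A ≃ₐ[ℝ] A) (RegularPoint n M A) where
  smul g p := ⟨(g : A →ₐ[ℝ] A).comp p.1, g.surjective.comp p.2⟩
  one_smul _ := rfl
  mul_smul _ _ _ := rfl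

/-- The image `α ∘ p` of a regular point by a surjective morphism `α`. -/
noncomputable def RegularPoint.map {B : Type w} [CommRing B] [Algebra ℝ B] (α : A →ₐ[ℝ] B)
    (hα : Function.Surjective α) (p : RegularPoint n M A) : RegularPoint n M B :=
  ⟨α.comp p.1, hα.comp p.2⟩

variable [IsWeilAlgebra A]

/-- The smooth structure of the set of all `A`-points of `M`: the real components of each smooth
function are smooth and, over each open set `U` of `M` coordinated by `x¹, …, xⁿ`, the real
components of `x¹, …, xⁿ` are coordinates, which identify the `A`-points near points of `U` with the
`n`-tuples of elements of `A` whose real parts are the coordinates of a point of `U`. -/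
structure IsWeilStructure (S : SmoothStructure (APoint n M A)) : Prop where
  smooth_components : ∀ f : SmoothRing n M,
    ContMDiff (𝓡 S.dim) 𝓘(ℝ, Fin (Module.finrank ℝ A) → ℝ) ∞
      (fun p : S => realComponents A ((S.get p) f))
  coordinates : ∀ φ ∈ IsManifold.maximalAtlas (𝓡 n) ∞ M, ∀ x : Fin n → SmoothRing n M,
    (∀ y ∈ φ.source, ∀ i, x i y = φ y i) →
    IsOpen {p : S | ∃ y ∈ φ.source, (S.get p).IsNear y} ∧
    Set.BijOn (fun (p : APoint n M A) (i : Fin n) => p (x i))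
      {p | ∃ y ∈ φ.source, p.IsNear y}
      {a | ∃ y ∈ φ.source, ∀ i, IsLocalRing.residue A (a i) =
        algebraMap ℝ (IsLocalRing.ResidueField A) (φ y i)} ∧
    IsLocalDiffeomorphOn (𝓡 S.dim) 𝓘(ℝ, Fin n → Fin (Module.finrank ℝ A) → ℝ) ∞
      (fun (p : S) (i : Fin n) => realComponents A ((S.get p) (x i)))
      {p : S | ∃ y ∈ φ.source, (S.get p).IsNear y}

/-- The smooth structure of the set of regular `A`-points: that of an open submanifold of the
manifold of all `A`-points. -/
def IsRegularWeilStructure (S : SmoothStructure (RegularPoint n M A)) : Prop :=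
  ∃ T : SmoothStructure (APoint n M A), IsWeilStructure T ∧
    IsDiffeoOnto (𝓡 S.dim) (𝓡 T.dim)
      (fun p : S => T.of (S.get p).1)
      {p : T | Function.Surjective (T.get p)}

end PointsAndJets

/-! ### Automorphism groups -/

section Automorphisms

variable {A : Type u} [CommRing A] [Algebra ℝ A]

/-- The matrix of an automorphism of `A` in a basis of `A` over `ℝ`. -/
noncomputable def autMatrix [IsWeilAlgebra A] (g : A ≃ₐ[ℝ] A) :
    Fin (Module.finrank ℝ A) → Fin (Module.finrank ℝ A) → ℝ :=
  fun i => realComponents A (g (Module.finBasis ℝ A i))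

/-- The Lie group structure of a group `H` of automorphisms of `A` (given by the inclusion `i`): that
of an embedded submanifold of the space of matrices. -/
structure IsMatrixLieGroup [IsWeilAlgebra A] {H : Type v} [Group H] (i : H →* (A ≃ₐ[ℝ] A))
    (S : SmoothStructure H) : Prop where
  lieGroup : LieGroup (𝓡 S.dim) ∞ S
  embedding : Manifold.IsSmoothEmbedding (𝓡 S.dim)
    𝓘(ℝ, Fin (Module.finrank ℝ A) → Fin (Module.finrank ℝ A) → ℝ) ∞
    (fun h : S => autMatrix (i (S.get h)))

/-- `G_α`: the automorphisms `g` of `R` with `α ∘ g = α`. -/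
def autOver {R : Type v} [CommRing R] [Algebra ℝ R] (α : R →ₐ[ℝ] A) : Subgroup (R ≃ₐ[ℝ] R) where
  carrier := {g | ∀ r, α (g r) = α r}
  one_mem' _ := rfl
  mul_mem' {g h} hg hh r := by
    rw [AlgEquiv.mul_apply, hg, hh]
  inv_mem' {g} hg r := by
    rw [← hg (g⁻¹ r), ← AlgEquiv.mul_apply, mul_inv_cancel, AlgEquiv.one_apply]

/-- `G_I`: the automorphisms `g` of `R` with `g(I) = I`. -/
def autStab {R : Type v} [CommRing R] [Algebra ℝ R] (I : Ideal R) : Subgroup (R ≃ₐ[ℝ] R) where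
  carrier := {g | g '' (I : Set R) = I}
  one_mem' := Set.image_id _
  mul_mem' {g h} hg hh := by
    change (fun r => g (h r)) '' (I : Set R) = I
    change h '' (I : Set R) = I at hh
    rw [← Set.image_image, hh]
    exact hg
  inv_mem' {g} hg := by
    change (g.symm : R → R) '' (I : Set R) = I
    change g '' (I : Set R) = I at hg
    conv_lhs => rw [← hg]
    simp [Set.image_image]

/-- The set of the right cosets `H g` of a subgroup `H` of `G`. -/
abbrev RightCosets {G : Type v} [Group G] (H : Subgroup G) : Type v :=
  Quotient (QuotientGroup.rightRel H)

end Automorphisms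

/-! ### Coordinate open sets -/

section Coordinates

variable {n l : ℕ} {M : Type v} [TopologicalSpace M] [ChartedSpace (EuclideanSpace ℝ (Fin n)) M]

/-- The open set of `M` coordinated by the chart `φ`. -/
abbrev chartDomain (φ : OpenPartialHomeomorph M (EuclideanSpace ℝ (Fin n))) :
    TopologicalSpace.Opens M :=
  ⟨φ.source, φ.open_source⟩

/-- The section `ξ` over the open set coordinated by `φ = (x¹, …, xⁿ)`: `ξ(y)` is the regular point
near `y` that sends each coordinate `xⁱ`, seen as a germ at `y`, to `xⁱ(y) + Xⁱ`. In other words,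
`ξ(y)` is the passage to the quotient modulo the `(l + 1)`-th power of the ideal of `y`, followed by
the isomorphism with the truncated polynomials that the generators `xⁱ - xⁱ(y)` establish. -/
structure IsCoordinateSection (φ : OpenPartialHomeomorph M (EuclideanSpace ℝ (Fin n)))
    (ξ : chartDomain φ → RegularPoint n M (TruncPoly n l)) : Prop where
  near : ∀ y : chartDomain φ, (ξ y).IsNear (y : M)
  coordinate : ∀ (y : chartDomain φ) (i : Fin n) (f : SmoothRing n M),
    (∀ᶠ z in nhds (y : M), f z = φ z i) →
    (ξ y).1 f = algebraMap ℝ (TruncPoly n l) (φ y i) + TruncPoly.var n l i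

variable (n) in
/-- `Ψ` is an isomorphism over `U` of the trivial bundle `U × C` with the part over `U` of a space
`Y` whose elements are near points of `M`. -/
def IsIsoOver {C : Type u} {Y : Type w} (U : TopologicalSpace.Opens M) (SC : SmoothStructure C)
    (SY : SmoothStructure Y) (near : Y → M → Prop) (Ψ : U → C → Y) : Prop :=
  IsDiffeoOnto ((𝓡 n).prod (𝓡 SC.dim)) (𝓡 SY.dim)
    (fun z : U × SC => SY.of (Ψ z.1 (SC.get z.2))) {p | ∃ y ∈ U, near (SY.get p) y} ∧
  ∀ (y : U) (c : C), near (Ψ y c) y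

end Coordinates

/-!
The sets of points, of jets and of morphisms that occur here are sets of algebra morphisms `Q → A`
or quotients of them, and their smooth structures are those for which the evaluations
`p ↦ p f ∈ A` are smooth and locally determine the morphism smoothly (`IsEvalStructure`). A map to
such a manifold is smooth as soon as its composites with the evaluations are.

*Points.* A morphism from the smooth functions to `ℝ` is an evaluation
(`SmoothRing.exists_eq_eval`), so that each `A`-point is near some `x ∈ M`, and by Hadamard's lemma
it is determined by its values at the coordinates (`APoint.eq_of_coordinates`). Conversely, the
exponential of the nilpotent derivation `∑ νᵢ ∂ᵢ`, with `νᵢ ∈ 𝔪_A`, is the Taylor expansion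
`f ↦ f (x + ν)` (`exists_taylor`), and provides a point with given coordinates. This gives the
charts of `M^A` (`exists_pointChart`, `exists_isWeilStructure`). The regular points are an open subset, since a linear section `s` of `p`
makes `q ∘ s` invertible for `q` near `p`.

*Groups.* The automorphisms of `A` whose logarithm is small are the exponentials of the small
derivations, so that `Aut A`, and the stabilizers of ideals, are embedded Lie groups with the
translates of the logarithm as charts (`exists_lieGroup_structure`).

*Quotients.* Let `Aut A` act on a manifold of surjective morphisms `Q → A`. An automorphism `g` is
recovered from `p` and `q = g ∘ p` by the formula `g = (q ∘ s) ∘ (p ∘ s)⁻¹`, where `s` is a linear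
section of a morphism near `p`. Hence the relation has closed graph, the slices transversal to the
orbits meet them once, and the quotient is a manifold onto which the projection is a submersion
(`exists_quotient_by_aut`). Two surjective morphisms are related by `Aut A` exactly when they have
the same kernel, so that for `Q = C^∞(M)` the quotient is the manifold of jets. The same formula
shows that the regular points are a principal bundle (`isPrincipalBundle_ker`). As smoothness on
the base of a surjective submersion can be checked upstairs, the structure of the base is unique.

*Homogeneous spaces.* Put `R = TruncPoly n l`, where `l` is the order of `A`. Linear algebra in
`𝔪 / 𝔪 ^ 2` shows that surjective morphisms `R → A` exist, and that `G = Aut R` acts transitively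
on them (`TruncPoly.exists_aut_comp_eq`). Therefore `G / G_α` is the manifold of the surjective
morphisms `R → A`, `G / G_I` is its quotient by `Aut A`, and lifting the images of the variables
yields the local sections that make the projections submersions (`TruncPoly.hasLocalSections_comp`).

*Trivializations.* Over a chart with coordinate section `ξ`, the map `(y, β) ↦ β ∘ ξ y` is a
diffeomorphism from the product of the chart by the surjective morphisms `R → A` to the regular
points: the real parts of the coordinates of a point give `y`, and the nilpotent parts give `β`
(`IsCoordinateSection.isIsoOver`). The three trivializations follow by taking `A = R`, by
identifying the surjective morphisms with `G / G_α`, and by passing to the quotients by `Aut A`.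
-/

section

open scoped Topology
open Set

/-! ### Local diffeomorphisms, submersions and smooth structures -/

/-- The inverse function theorem in the smooth category, with an inverse that is smooth on the whole
of its domain. -/
theorem exists_openPartialHomeomorph_contDiffOn {E F : Type*} [NormedAddCommGroup E]
    [NormedSpace ℝ E] [CompleteSpace E] [NormedAddCommGroup F] [NormedSpace ℝ F] {f : E → F}
    {s : Set E} (hs : IsOpen s) (hf : ContDiffOn ℝ ∞ f s) {a : E} (ha : a ∈ s) (f' : E ≃L[ℝ] F)
    (hf' : HasFDerivAt f (f' : E →L[ℝ] F) a) :
    ∃ e : OpenPartialHomeomorph E F, a ∈ e.source ∧ e.source ⊆ s ∧ ⇑e = f ∧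
      ContDiffOn ℝ ∞ e.symm e.target := by
  have hfa : ContDiffAt ℝ ∞ f a := hf.contDiffAt (hs.mem_nhds ha)
  let e₀ := hfa.toOpenPartialHomeomorph f hf' (by simp)
  -- the inverse is smooth where the derivative of `f` is invertible, an open condition
  let t : Set E := s ∩ (fderiv ℝ f) ⁻¹' (range ((↑) : (E ≃L[ℝ] F) → (E →L[ℝ] F)))
  have ht : IsOpen t :=
    (hf.continuousOn_fderiv_of_isOpen hs (by simp)).isOpen_inter_preimage hs
      ContinuousLinearEquiv.isOpen
  have hat : a ∈ t := ⟨ha, ⟨f', hf'.fderiv.symm⟩⟩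
  refine ⟨e₀.restrOpen t ht, ?_, ?_, ?_, ?_⟩
  · exact ⟨hfa.mem_toOpenPartialHomeomorph_source hf' (by simp), hat⟩
  · intro x hx
    exact hx.2.1
  · exact hfa.toOpenPartialHomeomorph_coe hf' (by simp)
  · intro y hy
    have hx := (e₀.restrOpen t ht).map_target hy
    obtain ⟨e', he'⟩ := hx.2.2
    have hxs : (e₀.restrOpen t ht).symm y ∈ s := hx.2.1
    have hd : HasFDerivAt f (e' : E →L[ℝ] F) ((e₀.restrOpen t ht).symm y) := by
      rw [he']
      exact ((hf.contDiffAt (hs.mem_nhds hxs)).differentiableAt (by simp)).hasFDerivAt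
    exact ((e₀.restrOpen t ht).contDiffAt_symm hy hd
      (hf.contDiffAt (hs.mem_nhds hxs))).contDiffWithinAt

/-- A map has smooth local sections when through each point of the source there passes a smooth
section over a neighbourhood of its image. -/
def HasLocalSections {E E' H H' N N' : Type*} [NormedAddCommGroup E] [NormedSpace ℝ E]
    [NormedAddCommGroup E'] [NormedSpace ℝ E'] [TopologicalSpace H] [TopologicalSpace H']
    (I : ModelWithCorners ℝ E H) (I' : ModelWithCorners ℝ E' H')
    [TopologicalSpace N] [ChartedSpace H N] [TopologicalSpace N'] [ChartedSpace H' N']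
    (f : N → N') : Prop :=
  ∀ x, ∃ (W : Set N') (s : N' → N), IsOpen W ∧ f x ∈ W ∧ ContMDiffOn I' I ∞ s W ∧ s (f x) = x ∧
    ∀ y ∈ W, f (s y) = y

section Submersions

variable {p q : ℕ} {X : Type u} {Y : Type v} [TopologicalSpace X] [TopologicalSpace Y]
  [ChartedSpace (EuclideanSpace ℝ (Fin p)) X] [ChartedSpace (EuclideanSpace ℝ (Fin q)) Y]

theorem hasLocalSections_of_isSubmersion {f : X → Y}
    (hf : Manifold.IsSubmersion (𝓡 p) (𝓡 q) ∞ f) : HasLocalSections (𝓡 p) (𝓡 q) f := by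
  intro x
  have h := hf.isSubmersionAt x
  have hx := h.mem_domChart_source
  have hfx := h.mem_codChart_source
  have hw := h.writtenInCharts
  simp only [OpenPartialHomeomorph.extend, modelWithCornersSelf_partialEquiv,
    PartialEquiv.trans_refl] at hw
  set φ := h.domChart
  set ψ := h.codChart
  set ℓ := h.equiv
  let a := φ x
  -- the section is `(u, v) ↦ (u, v₀)` in the charts in which `f` is a projection
  let j : EuclideanSpace ℝ (Fin q) → EuclideanSpace ℝ (Fin p) := fun u => ℓ.symm (u, (ℓ a).2)
  have hj : ContDiff ℝ ∞ j :=
    ℓ.symm.contDiff.comp (contDiff_id.prodMk contDiff_const)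
  have ha : a ∈ φ.target := φ.map_source hx
  have hψa : ψ (f x) = (ℓ a).1 := by
    have := hw ha
    simpa [a, φ.left_inv hx] using this
  have hja : j (ψ (f x)) = a := by simp [j, hψa]
  refine ⟨ψ.source ∩ ψ ⁻¹' (j ⁻¹' φ.target), fun y => φ.symm (j (ψ y)), ?_, ⟨hfx, ?_⟩, ?_, ?_, ?_⟩
  · exact ψ.isOpen_inter_preimage (φ.open_target.preimage hj.continuous)
  · change j (ψ (f x)) ∈ φ.target
    rw [hja]; exact ha
  · refine (contMDiffOn_symm_of_mem_maximalAtlas h.domChart_mem_maximalAtlas).comp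
      (hj.contMDiff.comp_contMDiffOn
        ((contMDiffOn_of_mem_maximalAtlas h.codChart_mem_maximalAtlas).mono inter_subset_left)) ?_
    intro y hy
    exact hy.2
  · change φ.symm (j (ψ (f x))) = x
    rw [hja]; exact φ.left_inv hx
  · rintro y ⟨hy, hy'⟩
    have h1 := hw hy'
    simp only [Function.comp_apply] at h1
    have h2 : f (φ.symm (j (ψ y))) ∈ ψ.source := by
      exact h.source_subset_preimage_source (φ.map_target hy')
    have h3 : ψ (f (φ.symm (j (ψ y)))) = ψ y := by
      refine h1.trans ?_
      simp [j]
    exact ψ.injOn h2 hy h3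

/-- The derivative of `f` is onto because `f` has sections. Completing `f`, in charts, by a linear
projection onto the kernel of its derivative yields a chart of the source in which `f` is a
projection. -/
theorem isSubmersion_of_hasLocalSections [IsManifold (𝓡 p) ∞ X] [IsManifold (𝓡 q) ∞ Y]
    {f : X → Y} (hf : ContMDiff (𝓡 p) (𝓡 q) ∞ f)
    (hs : HasLocalSections (𝓡 p) (𝓡 q) f) : Manifold.IsSubmersion (𝓡 p) (𝓡 q) ∞ f := by
  refine Manifold.IsSubmersionOfComplement.isSubmersion (F := EuclideanSpace ℝ (Fin (p - q))) ?_
  intro x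
  obtain ⟨W, s, hW, hxW, hsW, hsx, hfs⟩ := hs x
  let φ := chartAt (EuclideanSpace ℝ (Fin p)) x
  let ψ := chartAt (EuclideanSpace ℝ (Fin q)) (f x)
  have hφ : φ ∈ IsManifold.maximalAtlas (𝓡 p) ∞ X := IsManifold.chart_mem_maximalAtlas x
  have hψ : ψ ∈ IsManifold.maximalAtlas (𝓡 q) ∞ Y := IsManifold.chart_mem_maximalAtlas (f x)
  have hx : x ∈ φ.source := mem_chart_source _ x
  have hfx : f x ∈ ψ.source := mem_chart_source _ (f x)
  let D : Set (EuclideanSpace ℝ (Fin p)) := φ.target ∩ φ.symm ⁻¹' (f ⁻¹' ψ.source)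
  have hD : IsOpen D :=
    φ.isOpen_inter_preimage_symm (ψ.open_source.preimage hf.continuous)
  let g : EuclideanSpace ℝ (Fin p) → EuclideanSpace ℝ (Fin q) := fun z => ψ (f (φ.symm z))
  have hg : ContDiffOn ℝ ∞ g D := by
    rw [← contMDiffOn_iff_contDiffOn]
    refine (contMDiffOn_of_mem_maximalAtlas hψ).comp (hf.comp_contMDiffOn
      ((contMDiffOn_symm_of_mem_maximalAtlas hφ).mono inter_subset_left)) ?_
    intro z hz
    exact hz.2
  let a := φ x
  have haD : a ∈ D := ⟨φ.map_source hx, by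
    change f (φ.symm (φ x)) ∈ ψ.source
    rw [φ.left_inv hx]; exact hfx⟩
  have hga : HasFDerivAt g (fderiv ℝ g a) a :=
    ((hg.contDiffAt (hD.mem_nhds haD)).differentiableAt (by simp)).hasFDerivAt
  -- the section shows that the derivative of `g` at `a` is onto
  have hsurj : (fderiv ℝ g a).range = ⊤ := by
    let σ : EuclideanSpace ℝ (Fin q) → EuclideanSpace ℝ (Fin p) := fun z => φ (s (ψ.symm z))
    let b := ψ (f x)
    have hb : ψ.symm b = f x := ψ.left_inv hfx
    let V : Set Y := W ∩ s ⁻¹' φ.source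
    have hV : IsOpen V := hsW.continuousOn.isOpen_inter_preimage hW φ.open_source
    have hfV : f x ∈ V := ⟨hxW, by change s (f x) ∈ φ.source; rw [hsx]; exact hx⟩
    let D' : Set (EuclideanSpace ℝ (Fin q)) := ψ.target ∩ ψ.symm ⁻¹' V
    have hD' : IsOpen D' := ψ.isOpen_inter_preimage_symm hV
    have hbD' : b ∈ D' := ⟨ψ.map_source hfx, by change ψ.symm b ∈ V; rw [hb]; exact hfV⟩
    have hσ : ContDiffOn ℝ ∞ σ D' := by
      rw [← contMDiffOn_iff_contDiffOn]
      refine (contMDiffOn_of_mem_maximalAtlas hφ).comp ((hsW.mono (inter_subset_left : V ⊆ W)).comp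
        ((contMDiffOn_symm_of_mem_maximalAtlas hψ).mono inter_subset_left) ?_) ?_
      · intro z hz; exact hz.2
      · intro z hz; exact hz.2.2
    have hσb : σ b = a := by
      change φ (s (ψ.symm b)) = φ x
      rw [hb, hsx]
    have hσd : HasFDerivAt σ (fderiv ℝ σ b) b :=
      ((hσ.contDiffAt (hD'.mem_nhds hbD')).differentiableAt (by simp)).hasFDerivAt
    have hcomp : HasFDerivAt (fun z => g (σ z)) ((fderiv ℝ g a).comp (fderiv ℝ σ b)) b := by
      rw [← hσb] at hga ⊢
      exact hga.comp b hσd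
    have hid : (fun z => g (σ z)) =ᶠ[𝓝 b] id := by
      filter_upwards [hD'.mem_nhds hbD'] with z hz
      change ψ (f (φ.symm (φ (s (ψ.symm z))))) = z
      rw [φ.left_inv hz.2.2, hfs _ hz.2.1, ψ.right_inv hz.1]
    have hone : (fderiv ℝ g a).comp (fderiv ℝ σ b) = ContinuousLinearMap.id ℝ _ :=
      hcomp.unique ((hasFDerivAt_id b).congr_of_eventuallyEq hid)
    refine LinearMap.range_eq_top.mpr fun w => ⟨fderiv ℝ σ b w, ?_⟩
    exact congrArg (fun (T : _ →L[ℝ] _) => T w) hone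
  let g' := fderiv ℝ g a
  let K : Submodule ℝ (EuclideanSpace ℝ (Fin p)) := g'.ker
  have hKc : K.ClosedComplemented := Submodule.ClosedComplemented.of_finiteDimensional K
  obtain ⟨pr, hpr⟩ := hKc
  have hrank : Module.finrank ℝ K = Module.finrank ℝ (EuclideanSpace ℝ (Fin (p - q))) := by
    have h1 := g'.toLinearMap.finrank_range_add_finrank_ker
    have h2 : Module.finrank ℝ g'.toLinearMap.range = q := by
      have : g'.toLinearMap.range = ⊤ := hsurj
      rw [this, finrank_top, finrank_euclideanSpace_fin]
    rw [h2, finrank_euclideanSpace_fin] at h1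
    rw [finrank_euclideanSpace_fin]
    change Module.finrank ℝ g'.toLinearMap.ker = _
    omega
  let κ : K ≃L[ℝ] EuclideanSpace ℝ (Fin (p - q)) := ContinuousLinearEquiv.ofFinrankEq hrank
  let pr' : EuclideanSpace ℝ (Fin p) →L[ℝ] EuclideanSpace ℝ (Fin (p - q)) :=
    (κ : K →L[ℝ] _).comp pr
  have hbij : Function.Bijective (g'.prod pr') := by
    constructor
    · rw [injective_iff_map_eq_zero]
      intro v hv
      have hv1 : g' v = 0 := congrArg Prod.fst hv
      have hv2 : pr' v = 0 := congrArg Prod.snd hv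
      have hv3 : pr v = 0 := κ.injective (by simpa [pr'] using hv2)
      have := hpr ⟨v, hv1⟩
      rw [hv3] at this
      simpa using (congrArg Subtype.val this).symm
    · rintro ⟨u, w⟩
      obtain ⟨v, hv⟩ := LinearMap.range_eq_top.mp hsurj u
      refine ⟨v + ((κ.symm w - pr v : K) : EuclideanSpace ℝ (Fin p)), ?_⟩
      have hk : g' ((κ.symm w - pr v : K) : EuclideanSpace ℝ (Fin p)) = 0 :=
        (κ.symm w - pr v : K).2
      have hv' : g' v = u := hv
      refine Prod.ext ?_ ?_
      · change g' (v + _) = u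
        rw [map_add, hk, hv', add_zero]
      · change κ (pr (v + _)) = w
        rw [map_add, hpr]
        simp
  let ℓ : EuclideanSpace ℝ (Fin p) ≃L[ℝ]
      (EuclideanSpace ℝ (Fin q) × EuclideanSpace ℝ (Fin (p - q))) :=
    (LinearEquiv.ofBijective (g'.prod pr').toLinearMap hbij).toContinuousLinearEquiv
  have hℓ : (ℓ : EuclideanSpace ℝ (Fin p) →L[ℝ] _) = g'.prod pr' := by ext1 v; rfl
  have hΘ : ContDiffOn ℝ ∞ (fun z => (g z, pr' z)) D :=
    hg.prodMk pr'.contDiff.contDiffOn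
  -- `e'` straightens `g`: in the chart `φ.trans e'`, the map `f` is the first component of `ℓ`
  obtain ⟨e, hae, heD, hecoe, hesymm⟩ := exists_openPartialHomeomorph_contDiffOn hD hΘ haD ℓ
    (by rw [hℓ]; exact hga.prodMk pr'.hasFDerivAt)
  let e' : OpenPartialHomeomorph (EuclideanSpace ℝ (Fin p)) (EuclideanSpace ℝ (Fin p)) :=
    e.trans ℓ.symm.toHomeomorph.toOpenPartialHomeomorph
  have hφe : φ.trans e' ∈ IsManifold.maximalAtlas (𝓡 p) ∞ X := by
    refine OpenPartialHomeomorph.mem_maximalAtlas_of_contMDiffOn (I := 𝓡 p) (n := ∞)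
      (φ := φ.trans e') ?_ ?_
    · refine ContMDiffOn.comp (I' := 𝓡 p) (t := e.source) (g := e') (f := φ) ?_
        ((contMDiffOn_of_mem_maximalAtlas (I := 𝓡 p) (n := ∞) hφ).mono ?_) ?_
      · rw [contMDiffOn_iff_contDiffOn]
        have h : ContDiffOn ℝ ∞ e e.source := by
          rw [hecoe]
          exact hΘ.mono heD
        exact ℓ.symm.contDiff.comp_contDiffOn h
      · intro z hz; exact hz.1
      · intro z hz
        have := hz.2
        simpa [e'] using this
    · refine ContMDiffOn.comp (I' := 𝓡 p) (t := φ.target) (g := φ.symm) (f := e'.symm)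
        (contMDiffOn_symm_of_mem_maximalAtlas hφ) ?_ ?_
      · rw [contMDiffOn_iff_contDiffOn]
        refine (hesymm.comp ℓ.contDiff.contDiffOn (t := e.target) ?_).mono
          (s := ℓ ⁻¹' e.target) ?_
        · intro z hz; exact hz
        · intro z hz
          have := hz.1
          simpa [e'] using this
      · intro z hz
        exact hz.2
  refine Manifold.IsSubmersionAtOfComplement.mk_of_continuousAt hf.continuous.continuousAt ℓ
    (φ.trans e') ψ ⟨hx, by simpa [e'] using hae⟩ hfx hφe hψ ?_
  intro z hz
  simp only [OpenPartialHomeomorph.extend, modelWithCornersSelf_partialEquiv,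
    PartialEquiv.trans_refl] at hz ⊢
  have hz1 : ℓ z ∈ e.target := by
    have := hz.1
    simpa [e'] using this
  have h1 : e (e.symm (ℓ z)) = ℓ z := e.right_inv hz1
  rw [hecoe] at h1
  exact congrArg Prod.fst h1

/-- Smoothness of a map defined on the base of a surjective submersion can be checked on the total
space. -/
theorem contMDiff_of_comp_surjective {E H Z : Type*} [NormedAddCommGroup E] [NormedSpace ℝ E]
    [TopologicalSpace H] {J : ModelWithCorners ℝ E H} [TopologicalSpace Z] [ChartedSpace H Z]
    {f : X → Y} (hs : HasLocalSections (𝓡 p) (𝓡 q) f) (hsurj : Function.Surjective f)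
    {g : Y → Z} (hg : ContMDiff (𝓡 p) J ∞ (g ∘ f)) : ContMDiff (𝓡 q) J ∞ g := by
  intro y
  obtain ⟨x, rfl⟩ := hsurj y
  obtain ⟨W, s, hW, hxW, hsW, -, hfs⟩ := hs x
  have h : ContMDiffOn (𝓡 q) J ∞ (fun y => (g ∘ f) (s y)) W := hg.comp_contMDiffOn hsW
  refine (h.contMDiffAt (hW.mem_nhds hxW)).congr_of_eventuallyEq ?_
  filter_upwards [hW.mem_nhds hxW] with y hy
  simp [hfs y hy]

end Submersions

section Diffeomorphisms

variable {E E' H H' N N' : Type*} [NormedAddCommGroup E] [NormedSpace ℝ E]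
  [NormedAddCommGroup E'] [NormedSpace ℝ E'] [TopologicalSpace H] [TopologicalSpace H']
  {I : ModelWithCorners ℝ E H} {I' : ModelWithCorners ℝ E' H'}
  [TopologicalSpace N] [ChartedSpace H N] [TopologicalSpace N'] [ChartedSpace H' N']

/-- An injective smooth map that has smooth local sections is a diffeomorphism onto its image. -/
theorem isDiffeoOnto_of_hasLocalSections {f : N → N'} {V : Set N'} (hf : ContMDiff I I' ∞ f)
    (hinj : Function.Injective f) (hV : range f = V) (hs : HasLocalSections I I' f) :
    IsDiffeoOnto I I' f V := by
  refine ⟨fun x => ?_, hinj, hV⟩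
  obtain ⟨W, s, hW, hxW, hsW, -, hfs⟩ := hs x
  let Φ : PartialDiffeomorph I I' N N' ∞ :=
    { toFun := f
      invFun := s
      source := f ⁻¹' W
      target := W
      map_source' := fun z hz => hz
      map_target' := fun y hy => by
        change f (s y) ∈ W
        rw [hfs y hy]; exact hy
      left_inv' := fun z hz => hinj (hfs _ hz)
      right_inv' := fun y hy => hfs y hy
      open_source := hW.preimage hf.continuous
      open_target := hW
      contMDiffOn_toFun := hf.contMDiffOn
      contMDiffOn_invFun := hsW }
  exact ⟨Φ, hxW, fun z _ => rfl⟩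

theorem IsDiffeoOnto.contMDiff {f : N → N'} {V : Set N'} (h : IsDiffeoOnto I I' f V) :
    ContMDiff I I' ∞ f :=
  h.1.contMDiff

theorem IsDiffeoOnto.hasLocalSections {f : N → N'} {V : Set N'} (h : IsDiffeoOnto I I' f V) :
    HasLocalSections I I' f := by
  intro x
  obtain ⟨Φ, hx, hΦ⟩ := h.1 x
  refine ⟨Φ.target, Φ.symm.toFun, Φ.open_target, ?_, Φ.contMDiffOn_invFun, ?_, ?_⟩
  · rw [hΦ hx]; exact Φ.map_source hx
  · rw [hΦ hx]; exact Φ.left_inv hx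
  · intro y hy
    have : Φ.symm.toFun y ∈ Φ.source := Φ.map_target hy
    rw [hΦ this]
    exact Φ.right_inv hy

/-- Maps into a manifold are smooth when they are so in a chart. -/
theorem PartialDiffeomorph.contMDiffOn_of_comp {E'' H'' Z : Type*} [NormedAddCommGroup E'']
    [NormedSpace ℝ E''] [TopologicalSpace H''] {J : ModelWithCorners ℝ E'' H''}
    [TopologicalSpace Z] [ChartedSpace H'' Z] (Φ : PartialDiffeomorph I I' N N' ∞) {f : Z → N}
    {s : Set Z} (hmaps : MapsTo f s Φ.source) (h : ContMDiffOn J I' ∞ (fun z => Φ (f z)) s) :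
    ContMDiffOn J I ∞ f s := by
  have h1 : ContMDiffOn J I ∞ (fun z => Φ.symm (Φ (f z))) s :=
    Φ.contMDiffOn_invFun.comp h fun z hz => Φ.map_source (hmaps hz)
  exact h1.congr fun z hz => (Φ.left_inv (hmaps hz)).symm

end Diffeomorphisms

/-- A set with compatible charts in a finite dimensional normed space has a smooth structure for
which these charts are diffeomorphisms onto open sets. -/
theorem exists_smoothStructure {X : Type u} [t : TopologicalSpace X] [T2Space X]
    [SecondCountableTopology X] {F : Type*} [NormedAddCommGroup F] [NormedSpace ℝ F]
    [FiniteDimensional ℝ F] {ι : Type*} (e : ι → OpenPartialHomeomorph X F)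
    (hcover : ∀ x, ∃ i, x ∈ (e i).source)
    (hcompat : ∀ i j, ContDiffOn ℝ ∞ (fun z => e j ((e i).symm z))
      ((e i).target ∩ (e i).symm ⁻¹' (e j).source)) :
    ∃ S : SmoothStructure X, S.top = t ∧ S.dim = Module.finrank ℝ F ∧
      ∀ i, ∃ Φ : PartialDiffeomorph (𝓡 S.dim) 𝓘(ℝ, F) S F ∞,
        Φ.toPartialEquiv = (e i).toPartialEquiv := by
  let k := Module.finrank ℝ F
  let κ : F ≃L[ℝ] EuclideanSpace ℝ (Fin k) :=
    ContinuousLinearEquiv.ofFinrankEq (by rw [finrank_euclideanSpace_fin])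
  let c : ι → OpenPartialHomeomorph X (EuclideanSpace ℝ (Fin k)) := fun i =>
    (e i).trans κ.toHomeomorph.toOpenPartialHomeomorph
  choose idx hidx using hcover
  let C : ChartedSpace (EuclideanSpace ℝ (Fin k)) X :=
    { atlas := range c
      chartAt := fun x => c (idx x)
      mem_chart_source := fun x => by simpa [c] using hidx x
      chart_mem_atlas := fun x => ⟨_, rfl⟩ }
  have hc : ∀ i j, ContDiffOn ℝ ∞ (c j ∘ (c i).symm) ((c i).symm.trans (c j)).source := by
    intro i j
    have h1 : ContDiffOn ℝ ∞ (fun z => κ (e j ((e i).symm (κ.symm z))))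
        (κ.symm ⁻¹' ((e i).target ∩ (e i).symm ⁻¹' (e j).source)) :=
      κ.contDiff.comp_contDiffOn ((hcompat i j).comp κ.symm.contDiff.contDiffOn fun z hz => hz)
    refine h1.mono fun z hz => ?_
    simp only [OpenPartialHomeomorph.trans_source, OpenPartialHomeomorph.symm_source, c] at hz
    simpa using hz
  have hM : IsManifold (𝓡 k) ∞ X := by
    refine isManifold_of_contDiffOn _ _ _ ?_
    rintro _ _ ⟨i, rfl⟩ ⟨j, rfl⟩
    simpa using hc i j
  have key : ∀ i, ∃ Φ : PartialDiffeomorph (𝓡 k) 𝓘(ℝ, F) X F ∞,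
      Φ.toPartialEquiv = (e i).toPartialEquiv := by
    intro i
    have hci : c i ∈ IsManifold.maximalAtlas (𝓡 k) ∞ X :=
      IsManifold.subset_maximalAtlas ⟨i, rfl⟩
    refine ⟨{ toPartialEquiv := (e i).toPartialEquiv
              open_source := (e i).open_source
              open_target := (e i).open_target
              contMDiffOn_toFun := ?_
              contMDiffOn_invFun := ?_ }, rfl⟩
    · have h := κ.symm.contDiff (n := ∞).contMDiff.comp_contMDiffOn
        (contMDiffOn_of_mem_maximalAtlas hci)
      refine (h.congr ?_).mono (s := (c i).source) ?_
      · intro x hx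
        simp [c]
      · intro x hx
        simpa [c] using hx
    · have h := (contMDiffOn_symm_of_mem_maximalAtlas hci).comp
        (κ.contDiff (n := ∞).contMDiff.contMDiffOn (s := (e i).target)) (by
          intro x hx
          simpa [c] using hx)
      refine h.congr ?_
      intro x hx
      simp [c]
  exact ⟨⟨k, t, C, hM, inferInstance, inferInstance⟩, rfl, rfl, key⟩

/-! ### The exponential map and invariant subspaces -/

section Exponential

open NormedSpace

section

variable {Z Z' : Type*} [NormedAddCommGroup Z] [NormedSpace ℝ Z] [CompleteSpace Z]
  [NormedAddCommGroup Z'] [NormedSpace ℝ Z'] [CompleteSpace Z']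

theorem hasSum_exp_apply (T : Z →L[ℝ] Z) (z : Z) :
    HasSum (fun n : ℕ => (n.factorial⁻¹ : ℝ) • (T ^ n) z) (exp T z) := by
  have h := exp_series_hasSum_exp' (𝕂 := ℝ) T
  simpa using h.mapL (ContinuousLinearMap.apply ℝ Z z)

theorem exp_apply_mem {W : Submodule ℝ Z} (hW : IsClosed (W : Set Z)) {T : Z →L[ℝ] Z}
    (hT : ∀ w ∈ W, T w ∈ W) {w : Z} (hw : w ∈ W) : exp T w ∈ W := by
  have hpow : ∀ n : ℕ, (T ^ n) w ∈ W := by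
    intro n
    induction n with
    | zero => simpa using hw
    | succ n ih => rw [pow_succ']; exact hT _ ih
  refine hW.mem_of_tendsto (hasSum_exp_apply T w) (Filter.Eventually.of_forall fun s => ?_)
  exact W.sum_mem fun n _ => W.smul_mem _ (hpow n)

/-- If `f` intertwines two operators, it intertwines their exponentials. -/
theorem exp_apply_intertwine {T : Z →L[ℝ] Z} {T' : Z' →L[ℝ] Z'} (f : Z →L[ℝ] Z')
    (h : ∀ z, f (T z) = T' (f z)) (z : Z) : f (exp T z) = exp T' (f z) := by
  have hpow : ∀ n : ℕ, ∀ z, f ((T ^ n) z) = (T' ^ n) (f z) := by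
    intro n
    induction n with
    | zero => simp
    | succ n ih => intro z; rw [pow_succ', pow_succ', mul_apply_eq_comp, mul_apply_eq_comp, h, ih]
  have h1 := (hasSum_exp_apply T z).mapL f
  simp only [map_smul, hpow] at h1
  exact h1.unique (hasSum_exp_apply T' (f z))

end

section

variable {𝓔 : Type*} [NormedRing 𝓔] [NormedAlgebra ℝ 𝓔] [CompleteSpace 𝓔]

theorem real_exp_mul_exp_neg (D : 𝓔) : exp D * exp (-D) = 1 := by
  let _ : NormedAlgebra ℚ 𝓔 := NormedAlgebra.restrictScalars ℚ ℝ 𝓔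
  rw [← exp_add_of_commute (Commute.refl D).neg_right, add_neg_cancel, exp_zero]

theorem real_exp_neg_mul_exp (D : 𝓔) : exp (-D) * exp D = 1 := by
  simpa using real_exp_mul_exp_neg (-D)

theorem contDiff_exp_algebra : ContDiff ℝ ∞ (exp : 𝓔 → 𝓔) :=
  contDiff_iff_contDiffAt.mpr fun x => (exp_analytic (𝕂 := ℝ) x).contDiffAt

/-- The exponential is a diffeomorphism from an arbitrarily small neighbourhood of `0` onto an open
set. -/
theorem exists_local_log {U : Set 𝓔} (hU : U ∈ 𝓝 (0 : 𝓔)) :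
    ∃ e : OpenPartialHomeomorph 𝓔 𝓔, (0 : 𝓔) ∈ e.source ∧ e.source ⊆ U ∧ ⇑e = exp ∧
      ContDiffOn ℝ ∞ e.symm e.target := by
  obtain ⟨V, hVU, hV, h0⟩ := mem_nhds_iff.mp hU
  obtain ⟨e, h1, h2, h3, h4⟩ := exists_openPartialHomeomorph_contDiffOn hV
    contDiff_exp_algebra.contDiffOn h0 (ContinuousLinearEquiv.refl ℝ 𝓔)
    (by simpa using! (hasFDerivAt_exp_zero (𝕂 := ℝ) (𝔸 := 𝓔)))
  exact ⟨e, h1, h2.trans hVU, h3, h4⟩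

end

section

variable {𝓔 : Type*} [NormedRing 𝓔] [NormedAlgebra ℝ 𝓔]

/-- The commutator with `D`, as an operator. -/
noncomputable def commutatorMap (D : 𝓔) : 𝓔 →L[ℝ] 𝓔 :=
  ContinuousLinearMap.mul ℝ 𝓔 D - (ContinuousLinearMap.mul ℝ 𝓔).flip D

@[simp]
theorem commutatorMap_apply (D X : 𝓔) : commutatorMap D X = D * X - X * D := rfl

theorem continuous_commutatorMap : Continuous (commutatorMap : 𝓔 → 𝓔 →L[ℝ] 𝓔) :=
  (ContinuousLinearMap.mul ℝ 𝓔).continuous.sub (ContinuousLinearMap.mul ℝ 𝓔).flip.continuous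

variable [CompleteSpace 𝓔]

theorem exp_mul_left_apply (D X : 𝓔) :
    exp (ContinuousLinearMap.mul ℝ 𝓔 D) X = exp D * X := by
  have h1 : exp (ContinuousLinearMap.mul ℝ 𝓔 D) 1 = exp D := by
    have h := hasSum_exp_apply (ContinuousLinearMap.mul ℝ 𝓔 D) 1
    have hp : ∀ n : ℕ, ((ContinuousLinearMap.mul ℝ 𝓔 D) ^ n) 1 = D ^ n := by
      intro n
      induction n with
      | zero => simp
      | succ n ih => rw [pow_succ', pow_succ', mul_apply_eq_comp, ih]; rfl
    simp only [hp] at h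
    exact h.unique (exp_series_hasSum_exp' (𝕂 := ℝ) D)
  have h2 := exp_apply_intertwine (T := ContinuousLinearMap.mul ℝ 𝓔 D)
    (T' := ContinuousLinearMap.mul ℝ 𝓔 D) ((ContinuousLinearMap.mul ℝ 𝓔).flip X)
    (fun z => by simp [mul_assoc]) 1
  rw [h1] at h2
  simpa using h2.symm

theorem exp_mul_right_apply (D X : 𝓔) :
    exp ((ContinuousLinearMap.mul ℝ 𝓔).flip D) X = X * exp D := by
  have h1 : exp ((ContinuousLinearMap.mul ℝ 𝓔).flip D) 1 = exp D := by
    have h := hasSum_exp_apply ((ContinuousLinearMap.mul ℝ 𝓔).flip D) 1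
    have hp : ∀ n : ℕ, (((ContinuousLinearMap.mul ℝ 𝓔).flip D) ^ n) 1 = D ^ n := by
      intro n
      induction n with
      | zero => simp
      | succ n ih => rw [pow_succ', pow_succ, mul_apply_eq_comp, ih]; rfl
    simp only [hp] at h
    exact h.unique (exp_series_hasSum_exp' (𝕂 := ℝ) D)
  have h2 := exp_apply_intertwine (T := (ContinuousLinearMap.mul ℝ 𝓔).flip D)
    (T' := (ContinuousLinearMap.mul ℝ 𝓔).flip D) (ContinuousLinearMap.mul ℝ 𝓔 X)
    (fun z => by simp [mul_assoc]) 1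
  rw [h1] at h2
  simpa using h2.symm

/-- The exponential of the commutator with `D` is the conjugation by `exp D`. -/
theorem exp_commutatorMap (D X : 𝓔) : exp (commutatorMap D) X = exp D * X * exp (-D) := by
  let _ : NormedAlgebra ℚ (𝓔 →L[ℝ] 𝓔) := NormedAlgebra.restrictScalars ℚ ℝ _
  have hc : Commute (ContinuousLinearMap.mul ℝ 𝓔 D) ((ContinuousLinearMap.mul ℝ 𝓔).flip (-D)) := by
    ext X
    simp [mul_assoc]
  have h : commutatorMap D =
      ContinuousLinearMap.mul ℝ 𝓔 D + (ContinuousLinearMap.mul ℝ 𝓔).flip (-D) := by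
    rw [map_neg, ← sub_eq_add_neg]; rfl
  rw [h, exp_add_of_commute hc, mul_apply_eq_comp, exp_mul_right_apply,
    exp_mul_left_apply, mul_assoc]

end

/-- The operators that leave a subspace invariant. -/
def invariantSubalgebra {Z : Type*} [NormedAddCommGroup Z] [NormedSpace ℝ Z]
    (W : Submodule ℝ Z) : Subalgebra ℝ (Z →L[ℝ] Z) where
  carrier := {T | ∀ w ∈ W, T w ∈ W}
  mul_mem' {S T} hS hT w hw := hS _ (hT w hw)
  add_mem' {S T} hS hT w hw := W.add_mem (hS w hw) (hT w hw)
  algebraMap_mem' r w hw := by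
    simpa [Algebra.algebraMap_eq_smul_one] using W.smul_mem r hw

/-- If the exponential of a small operator leaves a subspace invariant, so does the operator: the
exponential of the algebra of the operators that leave the subspace invariant is locally onto, and
the one of the algebra of all operators is locally injective. -/
theorem eventually_mapsTo_of_exp {Z : Type*} [NormedAddCommGroup Z] [NormedSpace ℝ Z]
    [FiniteDimensional ℝ Z] (W : Submodule ℝ Z) :
    ∀ᶠ T in 𝓝 (0 : Z →L[ℝ] Z), (∀ w ∈ W, (exp T : Z →L[ℝ] Z) w ∈ W) → ∀ w ∈ W, T w ∈ W := by
  have : CompleteSpace Z := FiniteDimensional.complete ℝ Z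
  obtain ⟨e, he0, -, hecoe, -⟩ := exists_local_log (𝓔 := Z →L[ℝ] Z) Filter.univ_mem
  let 𝓑 := invariantSubalgebra W
  have : FiniteDimensional ℝ 𝓑 := inferInstanceAs (FiniteDimensional ℝ (Subalgebra.toSubmodule 𝓑))
  have : CompleteSpace 𝓑 := FiniteDimensional.complete ℝ 𝓑
  -- the exponential of the finite dimensional algebra `𝓑` is the restriction of the ambient one
  have hcoe : ∀ B : 𝓑, ((exp B : 𝓑) : Z →L[ℝ] Z) = exp (B : Z →L[ℝ] Z) := by
    intro B
    have h := (exp_series_hasSum_exp' (𝕂 := ℝ) B).map 𝓑.val continuous_subtype_val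
    refine h.unique ?_
    simpa [Function.comp_def] using exp_series_hasSum_exp' (𝕂 := ℝ) (B : Z →L[ℝ] Z)
  have hV : {B : 𝓑 | (B : Z →L[ℝ] Z) ∈ e.source} ∈ 𝓝 (0 : 𝓑) :=
    continuous_subtype_val.continuousAt.preimage_mem_nhds
      (e.open_source.mem_nhds (by simpa using he0))
  -- every element of `𝓑` near `1` is the exponential of a small element of `𝓑`
  have hmap : Filter.map (exp : 𝓑 → 𝓑) (𝓝 0) = 𝓝 1 := by
    have h := (hasStrictFDerivAt_exp_zero (𝕂 := ℝ) (𝔸 := 𝓑)).map_nhds_eq_of_surj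
      (by ext x; simp)
    rwa [exp_zero] at h
  have h1 : exp '' {B : 𝓑 | (B : Z →L[ℝ] Z) ∈ e.source} ∈ 𝓝 (1 : 𝓑) := by
    rw [← hmap]; exact Filter.image_mem_map hV
  rw [nhds_subtype_eq_comap] at h1
  obtain ⟨O, hO, hOsub⟩ := h1
  have hexp : Filter.Tendsto (exp : (Z →L[ℝ] Z) → _) (𝓝 0) (𝓝 1) := by
    have := (contDiff_exp_algebra (𝓔 := Z →L[ℝ] Z)).continuous.tendsto 0
    rwa [exp_zero] at this
  filter_upwards [e.open_source.mem_nhds he0, hexp hO] with T hTe hTO hTW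
  obtain ⟨B, hB, hBT⟩ := hOsub (show (⟨exp T, hTW⟩ : 𝓑) ∈ Subtype.val ⁻¹' O from hTO)
  have h2 : exp (B : Z →L[ℝ] Z) = exp T := by
    rw [← hcoe, hBT]
  have h3 : (B : Z →L[ℝ] Z) = T := by
    refine e.injOn hB hTe ?_
    rw [hecoe]; exact h2
  rw [← h3]
  exact B.2

end Exponential

/-! ### Lie groups of elements of an algebra -/

section SmoothEmbeddings

variable {E H N : Type*} [NormedAddCommGroup E] [NormedSpace ℝ E] [TopologicalSpace H]
  {I : ModelWithCorners ℝ E H} [TopologicalSpace N] [ChartedSpace H N]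
  {E' H' N' : Type*} [NormedAddCommGroup E'] [NormedSpace ℝ E'] [TopologicalSpace H']
  {I' : ModelWithCorners ℝ E' H'} [TopologicalSpace N'] [ChartedSpace H' N']

/-- A map into an embedded submanifold is smooth when it is so into the ambient manifold. -/
theorem contMDiffOn_of_comp_isSmoothEmbedding {E'' H'' Z : Type*} [NormedAddCommGroup E'']
    [NormedSpace ℝ E''] [TopologicalSpace H''] {J : ModelWithCorners ℝ E'' H''}
    [TopologicalSpace Z] [ChartedSpace H'' Z] [IsManifold I ∞ N] [IsManifold I' ∞ N']
    {j : N → N'} (hj : Manifold.IsSmoothEmbedding I I' ∞ j) {f : Z → N} {s : Set Z}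
    (hs : IsOpen s) (h : ContMDiffOn J I' ∞ (fun z => j (f z)) s) : ContMDiffOn J I ∞ f s := by
  intro z hz
  have hz' := h.contMDiffAt (hs.mem_nhds hz)
  refine ContMDiffAt.contMDiffWithinAt ?_
  exact (ContMDiffAt.iff_comp_isImmersionAt (hj.isImmersion.isImmersionAt _)).mpr
    ⟨hj.isEmbedding.isInducing.continuousAt_iff.mpr hz'.continuousAt, hz'⟩

end SmoothEmbeddings

open NormedSpace in
/-- Let `i` be an injective representation of a group `H` in a finite dimensional algebra and let
`𝔥` be a linear subspace whose exponentials lie in the group and which contains the small elements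
whose exponential lies in the group. Then `H` is a Lie group, embedded in the algebra. The charts
are the translates of the logarithm. -/
theorem exists_lieGroup_structure {𝓔 : Type*} [NormedRing 𝓔] [NormedAlgebra ℝ 𝓔]
    [FiniteDimensional ℝ 𝓔] {F : Type*} [NormedAddCommGroup F] [NormedSpace ℝ F]
    (Λ : 𝓔 ≃L[ℝ] F) {H : Type u} [Group H] (i : H →* 𝓔) (hi : Function.Injective i)
    (𝔥 : Submodule ℝ 𝓔) (h1 : ∀ D ∈ 𝔥, ∃ h, i h = exp D)
    (h2 : ∀ᶠ D in 𝓝 (0 : 𝓔), (∃ h, i h = exp D) → D ∈ 𝔥) :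
    ∃ S : SmoothStructure H, S.dim = Module.finrank ℝ 𝔥 ∧ LieGroup (𝓡 S.dim) ∞ S ∧
      Manifold.IsSmoothEmbedding (𝓡 S.dim) 𝓘(ℝ, F) ∞ (fun h : S => Λ (i (S.get h))) := by
  have : CompleteSpace 𝓔 := FiniteDimensional.complete ℝ 𝓔
  have : ProperSpace 𝓔 := FiniteDimensional.proper ℝ 𝓔
  obtain ⟨e, he0, heU, hecoe, hesymm⟩ := exists_local_log h2
  have hii : ∀ g h : H, i g * i (g⁻¹ * h) = i h := fun g h => by rw [← map_mul]; simp
  have hlog : ∀ h : H, i h ∈ e.target → e.symm (i h) ∈ 𝔥 := by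
    intro h hh
    refine heU (e.map_target hh) ⟨h, ?_⟩
    rw [← hecoe, e.right_inv hh]
  choose! ex hex using h1
  obtain ⟨pr, hpr⟩ := Submodule.ClosedComplemented.of_finiteDimensional 𝔥
  let t : TopologicalSpace H := TopologicalSpace.induced i inferInstance
  have hind : Topology.IsInducing i := ⟨rfl⟩
  have hemb : Topology.IsEmbedding i := ⟨hind, hi⟩
  have : T2Space H := hemb.t2Space
  have : SecondCountableTopology H := hemb.secondCountableTopology
  have hmulc : ∀ g : H, Continuous fun h => i (g⁻¹ * h) := by
    intro g
    simp only [map_mul]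
    exact continuous_const.mul hind.continuous
  -- the chart at `g` is `h ↦ log (g⁻¹ h)`, which lies in `𝔥` near `g`; `pr` only serves to make it
  -- take its values in `𝔥` everywhere
  let c : H → OpenPartialHomeomorph H 𝔥 := fun g =>
    { toFun := fun h => pr (e.symm (i (g⁻¹ * h)))
      invFun := fun D => g * ex D
      source := {h | i (g⁻¹ * h) ∈ e.target}
      target := {D | (D : 𝓔) ∈ e.source}
      map_source' := by
        intro h hh
        have := hpr ⟨_, hlog _ hh⟩
        simp only [mem_ofPred_eq] at hh this ⊢
        rw [this]
        exact e.map_target hh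
      map_target' := by
        intro D hD
        simp only [mem_ofPred_eq, inv_mul_cancel_left] at hD ⊢
        rw [hex _ D.2, ← hecoe]
        exact e.map_source hD
      left_inv' := by
        intro h hh
        have := hpr ⟨_, hlog _ hh⟩
        simp only at this ⊢
        rw [this]
        refine hi ?_
        rw [map_mul, hex _ (hlog _ hh), ← hecoe, e.right_inv hh, hii]
      right_inv' := by
        intro D hD
        simp only [inv_mul_cancel_left]
        rw [hex _ D.2, ← hecoe, e.left_inv hD, hpr]
      open_source := e.open_target.preimage (hmulc g)
      open_target := e.open_source.preimage continuous_subtype_val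
      continuousOn_toFun := pr.continuous.comp_continuousOn
        (hesymm.continuousOn.comp (hmulc g).continuousOn fun h hh => hh)
      continuousOn_invFun := by
        refine Continuous.continuousOn (hind.continuous_iff.mpr ?_)
        have : (fun D : 𝔥 => i (g * ex D)) = fun D : 𝔥 => i g * exp (D : 𝓔) := by
          ext D; rw [map_mul, hex _ D.2]
        change Continuous fun D : 𝔥 => i (g * ex D)
        rw [this]
        exact continuous_const.mul
          (contDiff_exp_algebra.continuous.comp continuous_subtype_val) }
  have hcc : ∀ g g' : H, ∀ D : 𝔥, i (g'⁻¹ * (g * ex D)) = i (g'⁻¹ * g) * exp (D : 𝓔) := by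
    intro g g' D
    rw [← mul_assoc, map_mul, hex _ D.2]
  have hsmooth : ∀ g : H, ContDiff ℝ ∞ fun D : 𝔥 => i g * exp (D : 𝓔) := fun g =>
    contDiff_const.mul (contDiff_exp_algebra.comp 𝔥.subtypeL.contDiff)
  obtain ⟨S, hStop, hSdim, hS⟩ := exists_smoothStructure c
    (fun g => ⟨g, by
      change i (g⁻¹ * g) ∈ e.target
      rw [inv_mul_cancel, map_one, ← exp_zero, ← hecoe]
      exact e.map_source he0⟩) (by
      intro g g'
      have h : ContDiffOn ℝ ∞ (fun D : 𝔥 => pr (e.symm (i (g'⁻¹ * g) * exp (D : 𝓔))))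
          {D | i (g'⁻¹ * g) * exp (D : 𝓔) ∈ e.target} :=
        pr.contDiff.comp_contDiffOn (hesymm.comp (hsmooth _).contDiffOn fun D hD => hD)
      refine (h.congr ?_).mono ?_
      · intro D _
        change pr (e.symm (i (g'⁻¹ * (g * ex D)))) = _
        rw [hcc]
      · intro D hD
        have := hD.2
        change i (g'⁻¹ * (g * ex D)) ∈ e.target at this
        rw [hcc] at this
        exact this)
  choose Φ hΦ using hS
  -- the charts of the group, with values in the model space
  let κ : 𝔥 ≃L[ℝ] EuclideanSpace ℝ (Fin S.dim) :=
    ContinuousLinearEquiv.ofFinrankEq (by rw [finrank_euclideanSpace_fin, hSdim])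
  obtain ⟨C, hC⟩ := Submodule.exists_isCompl 𝔥
  let q : (EuclideanSpace ℝ (Fin S.dim) × C) ≃L[ℝ] F :=
    ((κ.symm.prodCongr (ContinuousLinearEquiv.refl ℝ C)).trans
      (Submodule.prodEquivOfIsCompl 𝔥 C hC).toContinuousLinearEquiv).trans Λ
  have hembS : Topology.IsEmbedding fun h : S => Λ (i (S.get h)) := by
    have : Topology.IsEmbedding fun h : H => Λ (i h) := Λ.toHomeomorph.isEmbedding.comp hemb
    have h' := @this
    rw [← hStop] at h'
    exact h'
  -- in the chart `x ↦ log (g⁻¹ x)` of the algebra, the inclusion of `H` is the one of `𝔥`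
  have himm : Manifold.IsSmoothEmbedding (𝓡 S.dim) 𝓘(ℝ, F) ∞
      (fun h : S => Λ (i (S.get h))) := by
    refine ⟨Manifold.IsImmersionOfComplement.isImmersion (F := C) ?_, hembS⟩
    intro g
    let g' : H := S.get g
    let dc : OpenPartialHomeomorph S (EuclideanSpace ℝ (Fin S.dim)) :=
      (Φ g').toOpenPartialHomeomorph.trans κ.toHomeomorph.toOpenPartialHomeomorph
    have hdcs : dc.source = (Φ g').source := by simp [dc]
    let lg : 𝓔 ≃L[ℝ] 𝓔 := ContinuousLinearEquiv.equivOfInverse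
      (ContinuousLinearMap.mul ℝ 𝓔 (i g'⁻¹)) (ContinuousLinearMap.mul ℝ 𝓔 (i g'))
      (fun x => by simp [← mul_assoc, ← map_mul]) (fun x => by simp [← mul_assoc, ← map_mul])
    let A : F ≃L[ℝ] 𝓔 := Λ.symm.trans lg
    let cc : OpenPartialHomeomorph F F :=
      (A.toHomeomorph.toOpenPartialHomeomorph.trans e.symm).trans
        Λ.toHomeomorph.toOpenPartialHomeomorph
    have hccs : cc.source = A ⁻¹' e.target := by simp [cc]
    have hcct : cc.target = Λ.symm ⁻¹' e.source := by
      ext x; simp [cc]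
    have hg1 : i (g'⁻¹ * g') ∈ e.target := by
      rw [inv_mul_cancel, map_one, ← exp_zero, ← hecoe]
      exact e.map_source he0
    refine Manifold.IsImmersionAtOfComplement.mk_of_continuousAt hembS.continuous.continuousAt q
      dc cc ?_ ?_ ?_ ?_ ?_
    · rw [hdcs]
      change g' ∈ (Φ g').toPartialEquiv.source
      rw [hΦ]
      exact hg1
    · rw [hccs]
      change i g'⁻¹ * (Λ.symm (Λ (i g'))) ∈ e.target
      rw [Λ.symm_apply_apply, ← map_mul]
      exact hg1
    · refine OpenPartialHomeomorph.mem_maximalAtlas_of_contMDiffOn (I := 𝓡 S.dim) (n := ∞)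
        (φ := dc) ?_ ?_
      · rw [hdcs]
        exact κ.contDiff.contMDiff.comp_contMDiffOn (Φ g').contMDiffOn_toFun
      · have h := (Φ g').contMDiffOn_invFun.comp
          (κ.symm.contDiff (n := ∞).contMDiff.contMDiffOn (s := κ.symm ⁻¹' (Φ g').target))
          (fun x hx => hx)
        refine h.mono (s := κ.symm ⁻¹' (Φ g').target) fun x hx => ?_
        simpa [dc] using hx
    · refine OpenPartialHomeomorph.mem_maximalAtlas_of_contMDiffOn (I := 𝓘(ℝ, F)) (n := ∞)
        (φ := cc) ?_ ?_
      · rw [contMDiffOn_iff_contDiffOn, hccs]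
        exact Λ.contDiff.comp_contDiffOn (hesymm.comp A.contDiff.contDiffOn fun x hx => hx)
      · rw [contMDiffOn_iff_contDiffOn]
        have h : ContDiff ℝ ∞ fun x : F => A.symm (exp (Λ.symm x)) :=
          A.symm.contDiff.comp (contDiff_exp_algebra.comp Λ.symm.contDiff)
        rw [← hecoe] at h
        exact h.contDiffOn
    · intro x hx
      simp only [OpenPartialHomeomorph.extend, modelWithCornersSelf_partialEquiv,
        PartialEquiv.trans_refl] at hx ⊢
      have hx' : κ.symm x ∈ (Φ g').toPartialEquiv.target := by
        have := hx.2
        exact this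
      have hsymm : S.get (dc.symm x) = g' * ex (κ.symm x : 𝔥) := by
        change (Φ g').toPartialEquiv.symm (κ.symm x) = _
        rw [hΦ]
        rfl
      rw [hΦ] at hx'
      have hx'' : ((κ.symm x : 𝔥) : 𝓔) ∈ e.source := hx'
      change Λ (e.symm (i g'⁻¹ * (Λ.symm (Λ (i (S.get (dc.symm x))))))) = q (x, 0)
      rw [Λ.symm_apply_apply, hsymm, ← map_mul, inv_mul_cancel_left, hex _ (κ.symm x).2, ← hecoe,
        e.left_inv hx'']
      change _ = Λ (Submodule.prodEquivOfIsCompl 𝔥 C hC (κ.symm x, 0))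
      simp
  have hsm : ContMDiff (𝓡 S.dim) 𝓘(ℝ, 𝓔) ∞ fun h : S => i (S.get h) := by
    have h := Λ.symm.contDiff (n := ∞).contMDiff.comp himm.contMDiff
    refine h.congr fun x => ?_
    simp
  -- the product and the inverse are smooth in the algebra, hence in the embedded group
  have hmul : ContMDiff ((𝓡 S.dim).prod (𝓡 S.dim)) (𝓡 S.dim) ∞ fun p : S × S => p.1 * p.2 := by
    rw [← contMDiffOn_univ]
    refine contMDiffOn_of_comp_isSmoothEmbedding himm isOpen_univ ?_
    rw [contMDiffOn_univ]
    have h : ContMDiff ((𝓡 S.dim).prod (𝓡 S.dim)) 𝓘(ℝ, F) ∞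
        fun p : S × S => Λ (i (S.get p.1) * i (S.get p.2)) :=
      Λ.contDiff.contMDiff.comp ((contDiff_mul (n := ∞)).contMDiff.comp
        ((hsm.comp contMDiff_fst).prodMk_space (hsm.comp contMDiff_snd)))
    refine h.congr fun p => ?_
    rw [← map_mul]; rfl
  have hinv : ContMDiff (𝓡 S.dim) (𝓡 S.dim) ∞ fun p : S => p⁻¹ := by
    rw [← contMDiffOn_univ]
    refine contMDiffOn_of_comp_isSmoothEmbedding himm isOpen_univ ?_
    rw [contMDiffOn_univ]
    have hu : ∀ p : H, i p⁻¹ = Ring.inverse (i p) := by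
      intro p
      let up : 𝓔ˣ := ⟨i p, i p⁻¹, by rw [← map_mul]; simp, by rw [← map_mul]; simp⟩
      exact (Ring.inverse_unit up).symm
    have h : ContMDiff (𝓡 S.dim) 𝓘(ℝ, F) ∞ fun p : S => Λ (Ring.inverse (i (S.get p))) := by
      refine Λ.contDiff.contMDiff.comp fun p => ?_
      let up : 𝓔ˣ := ⟨i (S.get p), i (S.get p)⁻¹, by rw [← map_mul]; simp, by rw [← map_mul]; simp⟩
      have := contDiffAt_ringInverse ℝ (n := ∞) up
      exact this.contMDiffAt.comp p (hsm p)
    refine h.congr fun p => ?_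
    rw [← hu]; rfl
  exact ⟨S, hSdim, { contMDiff_mul := hmul, contMDiff_inv := hinv }, himm⟩

/-! ### Automorphism groups of Weil algebras as Lie groups -/

section Automorphisms

variable {A : Type u} [NormedCommRing A] [NormedAlgebra ℝ A]

variable (A) in
/-- The derivations of `A`, as a space of operators. -/
def derivationSubmodule : Submodule ℝ (A →L[ℝ] A) where
  carrier := {D | ∀ a b, D (a * b) = a * D b + D a * b}
  add_mem' {D D'} h h' a b := by
    rw [add_apply, h, h', add_apply,
      add_apply]
    ring
  zero_mem' a b := by simp
  smul_mem' r D h a b := by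
    simp only [smul_apply, h a b, smul_add, mul_smul_comm, smul_mul_assoc]

theorem derivationSubmodule_one {D : A →L[ℝ] A} (hD : D ∈ derivationSubmodule A) : D 1 = 0 := by
  have h := hD 1 1
  simpa using h

/-- The Leibniz rule says that the commutator with `D` corresponds to `D` under the embedding of `A`
in its operators by multiplication. -/
theorem commutatorMap_mul {D : A →L[ℝ] A} (hD : D ∈ derivationSubmodule A) (a : A) :
    commutatorMap D (ContinuousLinearMap.mul ℝ A a) = ContinuousLinearMap.mul ℝ A (D a) := by
  ext b
  simp [hD a b]

variable [IsWeilAlgebra A]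

variable (A) in
/-- The automorphisms of `A` as continuous linear operators. -/
noncomputable def autCLM : (A ≃ₐ[ℝ] A) →* (A →L[ℝ] A) where
  toFun g := LinearMap.toContinuousLinearMap g.toLinearMap
  map_one' := by ext; simp
  map_mul' g h := by ext; simp

@[simp]
theorem autCLM_apply (g : A ≃ₐ[ℝ] A) (a : A) : autCLM A g a = g a := rfl

theorem autCLM_injective : Function.Injective (autCLM A) := fun g h hgh =>
  AlgEquiv.ext fun a => by rw [← autCLM_apply, hgh, autCLM_apply]

variable (A) in
/-- The identification of the operators with the matrices. -/
noncomputable def operatorMatrix :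
    (A →L[ℝ] A) ≃L[ℝ] (Fin (Module.finrank ℝ A) → Fin (Module.finrank ℝ A) → ℝ) :=
  ((LinearMap.toContinuousLinearMap.symm.trans ((Module.finBasis ℝ A).constr ℝ).symm).trans
    (LinearEquiv.piCongrRight fun _ => realComponents A)).toContinuousLinearEquiv

theorem operatorMatrix_autCLM (g : A ≃ₐ[ℝ] A) : operatorMatrix A (autCLM A g) = autMatrix g := by
  funext i
  change realComponents A _ = realComponents A _
  congr 1

open NormedSpace

/-- The exponential of a derivation is an automorphism. -/
theorem exists_autCLM_eq_exp {D : A →L[ℝ] A} (hD : D ∈ derivationSubmodule A) :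
    ∃ g : A ≃ₐ[ℝ] A, autCLM A g = exp D := by
  have : CompleteSpace A := FiniteDimensional.complete ℝ A
  -- `exp D` conjugates the multiplication by `a` into the multiplication by `exp D a`
  have hmul : ∀ a b, exp D (a * b) = exp D a * exp D b := by
    intro a b
    have h := exp_apply_intertwine (T := D) (T' := commutatorMap D) (ContinuousLinearMap.mul ℝ A)
      (fun z => (commutatorMap_mul hD z).symm) a
    rw [exp_commutatorMap] at h
    have h' := congrArg (fun T : A →L[ℝ] A => T (exp D b)) h
    simp only [ContinuousLinearMap.mul_apply', mul_apply_eq_comp] at h'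
    rw [h']
    have h2 : exp (-D) (exp D b) = b := by
      rw [← mul_apply_eq_comp, real_exp_neg_mul_exp]; rfl
    rw [h2]
  have hone : exp D 1 = 1 := by
    have h := exp_apply_intertwine (T := (0 : ℝ →L[ℝ] ℝ)) (T' := D)
      (ContinuousLinearMap.toSpanSingleton ℝ (1 : A))
      (fun z => by simp [derivationSubmodule_one hD]) 1
    simpa using h.symm
  refine ⟨AlgEquiv.ofLinearEquiv (LinearEquiv.ofLinearMap (exp D : A →L[ℝ] A).toLinearMap
    (exp (-D) : A →L[ℝ] A).toLinearMap ?_ ?_) hone hmul, ?_⟩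
  · ext a
    change (exp D : A →L[ℝ] A) ((exp (-D) : A →L[ℝ] A) a) = a
    rw [← mul_apply_eq_comp, real_exp_mul_exp_neg]; rfl
  · ext a
    change (exp (-D) : A →L[ℝ] A) ((exp D : A →L[ℝ] A) a) = a
    rw [← mul_apply_eq_comp, real_exp_neg_mul_exp]; rfl
  · ext a; rfl

/-- A small operator whose exponential is an automorphism is a derivation: it leaves `ℝ` invariant,
and the commutator with it leaves invariant the space of the multiplications. -/
theorem eventually_mem_derivationSubmodule :
    ∀ᶠ D in 𝓝 (0 : A →L[ℝ] A), (∃ g : A ≃ₐ[ℝ] A, autCLM A g = exp D) →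
      D ∈ derivationSubmodule A := by
  have : CompleteSpace A := FiniteDimensional.complete ℝ A
  have h1 := eventually_mapsTo_of_exp (Submodule.span ℝ {(1 : A)})
  have h2 := eventually_mapsTo_of_exp (ContinuousLinearMap.mul ℝ A).range
  have hc : Filter.Tendsto (commutatorMap : (A →L[ℝ] A) → _) (𝓝 0) (𝓝 0) := by
    have := (continuous_commutatorMap (𝓔 := A →L[ℝ] A)).tendsto 0
    have h0 : commutatorMap (0 : A →L[ℝ] A) = 0 := by ext; simp
    rwa [h0] at this
  filter_upwards [h1, hc.eventually h2] with D hD1 hD2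
  rintro ⟨g, hg⟩
  -- `D 1 = r` with `exp r = 1`, hence `r = 0`
  have hone : D 1 = 0 := by
    have hspan : D 1 ∈ Submodule.span ℝ {(1 : A)} := by
      refine hD1 (fun w hw => ?_) 1 (Submodule.mem_span_singleton_self _)
      obtain ⟨r, rfl⟩ := Submodule.mem_span_singleton.mp hw
      rw [map_smul, ← hg, autCLM_apply, map_one]
      exact Submodule.smul_mem _ _ (Submodule.mem_span_singleton_self _)
    obtain ⟨r, hr⟩ := Submodule.mem_span_singleton.mp hspan
    have h := exp_apply_intertwine (T := r • (1 : ℝ →L[ℝ] ℝ)) (T' := D)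
      (ContinuousLinearMap.toSpanSingleton ℝ (1 : A))
      (fun z => by
        change (r * z) • (1 : A) = D (z • (1 : A))
        rw [map_smul, ← hr, smul_smul, mul_comm]) 1
    have hr' : exp (r • (1 : ℝ →L[ℝ] ℝ)) 1 = Real.exp r := by
      have hs := hasSum_exp_apply (r • (1 : ℝ →L[ℝ] ℝ)) 1
      have hs' := exp_series_hasSum_exp' (𝕂 := ℝ) r
      rw [← Real.exp_eq_exp_ℝ] at hs'
      refine hs.unique ?_
      simpa [smul_pow] using hs'
    rw [hr', ContinuousLinearMap.toSpanSingleton_apply, ContinuousLinearMap.toSpanSingleton_apply,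
      one_smul, ← hg, autCLM_apply, map_one, ← Algebra.algebraMap_eq_smul_one,
      ← map_one (algebraMap ℝ A)] at h
    have h0 := (algebraMap ℝ A).injective h
    rw [Real.exp_eq_one_iff] at h0
    rw [← hr, h0, zero_smul]
  have hinv : exp (-D) = autCLM A g⁻¹ := by
    have h3 : exp D * exp (-D) = 1 := real_exp_mul_exp_neg D
    rw [← hg] at h3
    calc exp (-D) = autCLM A g⁻¹ * (autCLM A g * exp (-D)) := by
            rw [← mul_assoc, ← map_mul, inv_mul_cancel, map_one, one_mul]
      _ = _ := by rw [h3, mul_one]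
  -- the conjugation by the automorphism `g` sends the multiplication by `a` to the one by `g a`
  have hmaps := hD2 (by
    rintro _ ⟨a, rfl⟩
    refine ⟨g a, ?_⟩
    rw [exp_commutatorMap, ← hg, hinv]
    ext b
    change g a * b = g (a * g⁻¹ b)
    rw [map_mul, ← AlgEquiv.mul_apply, mul_inv_cancel, AlgEquiv.one_apply])
  intro a b
  obtain ⟨c, hc⟩ := hmaps _ ⟨a, rfl⟩
  have happ : ∀ x, c * x = D (a * x) - a * D x := fun x => by
    have := congrArg (fun T : A →L[ℝ] A => T x) hc
    simpa using! this
  have hca : c = D a := by simpa [hone] using happ 1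
  have := happ b
  rw [hca] at this
  rw [this]; ring

/-- A group of automorphisms that is an embedded Lie group has smooth matrix entries. -/
theorem IsMatrixLieGroup.contMDiff_autCLM {H : Type v} [Group H] {i : H →* (A ≃ₐ[ℝ] A)}
    {S : SmoothStructure H} (hS : IsMatrixLieGroup i S) :
    ContMDiff (𝓡 S.dim) 𝓘(ℝ, A →L[ℝ] A) ∞ (fun h : S => autCLM A (i (S.get h))) := by
  have h := (operatorMatrix A).symm.contDiff (n := ∞).contMDiff.comp hS.embedding.contMDiff
  refine h.congr fun x => ?_
  simp [← operatorMatrix_autCLM]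

/-- Smoothness of maps into an embedded group of automorphisms can be checked on the operators. -/
theorem IsMatrixLieGroup.contMDiffOn_of_autCLM {H : Type v} [Group H] {i : H →* (A ≃ₐ[ℝ] A)}
    {S : SmoothStructure H} (hS : IsMatrixLieGroup i S) {E'' H'' Z : Type*}
    [NormedAddCommGroup E''] [NormedSpace ℝ E''] [TopologicalSpace H'']
    {J : ModelWithCorners ℝ E'' H''} [TopologicalSpace Z] [ChartedSpace H'' Z] {f : Z → S}
    {s : Set Z} (hs : IsOpen s)
    (h : ContMDiffOn J 𝓘(ℝ, A →L[ℝ] A) ∞ (fun z => autCLM A (i (S.get (f z)))) s) :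
    ContMDiffOn J (𝓡 S.dim) ∞ f s := by
  refine contMDiffOn_of_comp_isSmoothEmbedding hS.embedding hs ?_
  have h' := (operatorMatrix A).contDiff (n := ∞).contMDiff.comp_contMDiffOn h
  refine h'.congr fun x _ => ?_
  simp [← operatorMatrix_autCLM]

/-- The subgroup of the automorphisms that leave a given ideal invariant is an embedded Lie group,
whose Lie algebra consists of the derivations that leave the ideal invariant. -/
theorem exists_isMatrixLieGroup_autStab (I : Ideal A) :
    ∃ S : SmoothStructure (autStab I), IsMatrixLieGroup (autStab I).subtype S := by
  let W : Submodule ℝ A := I.restrictScalars ℝ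
  have : CompleteSpace A := FiniteDimensional.complete ℝ A
  let 𝔥 : Submodule ℝ (A →L[ℝ] A) :=
    derivationSubmodule A ⊓ Subalgebra.toSubmodule (invariantSubalgebra W)
  obtain ⟨S, -, h1, h2⟩ := exists_lieGroup_structure (operatorMatrix A)
    ((autCLM A).comp (autStab I).subtype)
    (autCLM_injective.comp Subtype.val_injective) 𝔥 (by
      rintro D ⟨hD, hDI⟩
      obtain ⟨g, hg⟩ := exists_autCLM_eq_exp hD
      have hmaps : ∀ a ∈ I, g a ∈ I := by
        intro a ha
        rw [← autCLM_apply, hg]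
        exact exp_apply_mem (W := W) W.closed_of_finiteDimensional hDI ha
      have hmaps' : ∀ a ∈ I, g⁻¹ a ∈ I := by
        intro a ha
        have h3 : autCLM A g⁻¹ = exp (-D) := by
          have h3 : exp D * exp (-D) = 1 := real_exp_mul_exp_neg D
          rw [← hg] at h3
          calc autCLM A g⁻¹ = autCLM A g⁻¹ * (autCLM A g * exp (-D)) := by rw [h3, mul_one]
            _ = _ := by rw [← mul_assoc, ← map_mul, inv_mul_cancel, map_one, one_mul]
        rw [← autCLM_apply, h3]
        exact exp_apply_mem (W := W) W.closed_of_finiteDimensional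
          (fun w hw => W.neg_mem (hDI w hw)) ha
      refine ⟨⟨g, ?_⟩, hg⟩
      refine Subset.antisymm ?_ ?_
      · rintro _ ⟨a, ha, rfl⟩
        exact hmaps a ha
      · intro a ha
        refine ⟨g⁻¹ a, hmaps' a ha, ?_⟩
        rw [← AlgEquiv.mul_apply, mul_inv_cancel, AlgEquiv.one_apply]) (by
      filter_upwards [eventually_mem_derivationSubmodule, eventually_mapsTo_of_exp W] with D hD hDW
      rintro ⟨g, hg⟩
      refine ⟨hD ⟨g.1, hg⟩, hDW fun w hw => ?_⟩
      rw [← hg]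
      change g.1 w ∈ I
      have : g.1 w ∈ g.1 '' (I : Set A) := ⟨w, hw, rfl⟩
      rwa [show g.1 '' (I : Set A) = I from g.2] at this)
  refine ⟨S, h1, ?_⟩
  simpa [operatorMatrix_autCLM] using h2

/-- The group of all the automorphisms is an embedded Lie group. -/
theorem exists_isMatrixLieGroup_aut :
    ∃ S : SmoothStructure (A ≃ₐ[ℝ] A), IsMatrixLieGroup (MonoidHom.id (A ≃ₐ[ℝ] A)) S := by
  obtain ⟨S, -, h1, h2⟩ := exists_lieGroup_structure (operatorMatrix A) (autCLM A)
    autCLM_injective (derivationSubmodule A) (fun D hD => exists_autCLM_eq_exp hD)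
    eventually_mem_derivationSubmodule
  refine ⟨S, h1, ?_⟩
  simpa [operatorMatrix_autCLM] using h2

end Automorphisms

/-! ### Quotients of manifolds -/

/-- A quotient of a manifold `X` is a manifold when the equivalence relation has closed graph, the
equivalent points are related by smooth maps that preserve the classes, and through each point there
is a slice `z`: a manifold that meets each class at most once, together with a smooth map `r` that
moves the points near the given one along their classes to the slice. -/
theorem exists_quotient_of_slices {m : ℕ} {X : Type u} [TopologicalSpace X]
    [ChartedSpace (EuclideanSpace ℝ (Fin m)) X] [SecondCountableTopology X]
    {B : Type v} {π : X → B} (hπ : Function.Surjective π)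
    (hsep : IsClosed {x : X × X | π x.1 = π x.2})
    (hloc : ∀ p q, π p = π q → ∃ τ : X → X, ContMDiff (𝓡 m) (𝓡 m) ∞ τ ∧ τ p = q ∧
      ∀ x, π (τ x) = π x)
    {K : Type*} [NormedAddCommGroup K] [NormedSpace ℝ K] [FiniteDimensional ℝ K]
    (hslice : ∀ p₀, ∃ (O : Set X) (N : Set K) (z : K → X) (r : X → K), IsOpen O ∧ IsOpen N ∧
      p₀ ∈ O ∧ ContMDiffOn (𝓡 m) 𝓘(ℝ, K) ∞ r O ∧ ContMDiffOn 𝓘(ℝ, K) (𝓡 m) ∞ z N ∧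
      InjOn (fun k => π (z k)) N ∧ MapsTo z N O ∧ MapsTo r O N ∧ (∀ p ∈ O, π (z (r p)) = π p) ∧
      z (r p₀) = p₀) :
    ∃ S : SmoothStructure B,
      ContMDiff (𝓡 m) (𝓡 S.dim) ∞ (fun x => S.of (π x)) ∧
      HasLocalSections (𝓡 m) (𝓡 S.dim) (fun x => S.of (π x)) := by
  let t : TopologicalSpace B := TopologicalSpace.coinduced π inferInstance
  have hq : Topology.IsQuotientMap π := ⟨⟨rfl⟩, hπ⟩
  -- the saturation of an open set is open, since equivalent points are related by continuous maps
  have hopen : IsOpenMap π := by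
    intro U hU
    rw [← hq.isOpen_preimage, isOpen_iff_mem_nhds]
    rintro x ⟨p, hp, hpx⟩
    obtain ⟨τ, hτ, hτx, hτπ⟩ := hloc x p hpx.symm
    filter_upwards [hτ.continuous.continuousAt.preimage_mem_nhds
      (hU.mem_nhds (show τ x ∈ U by rwa [hτx]))] with y hy
    exact ⟨τ y, hy, hτπ y⟩
  have hoq : IsOpenQuotientMap π := ⟨hπ, hq.continuous, hopen⟩
  have : T2Space B := by
    rw [t2_iff_isClosed_diagonal, ← (hoq.prodMap hoq).isQuotientMap.isClosed_preimage]
    exact hsep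
  have : SecondCountableTopology B := hq.secondCountableTopology hopen
  choose O N z r hO hN hp₀ hr hz hinj hzO hrN hzr hzp using hslice
  -- the projection to the slice is constant along the classes
  have hrπ : ∀ p₀, ∀ p ∈ O p₀, ∀ q ∈ O p₀, π p = π q → r p₀ p = r p₀ q := by
    intro p₀ p hp q hq' hpq
    refine hinj p₀ (hrN p₀ hp) (hrN p₀ hq') ?_
    change π (z p₀ (r p₀ p)) = π (z p₀ (r p₀ q))
    rw [hzr p₀ p hp, hzr p₀ q hq', hpq]
  have hrz : ∀ p₀, ∀ k ∈ N p₀, r p₀ (z p₀ k) = k := by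
    intro p₀ k hk
    refine hinj p₀ (hrN p₀ (hzO p₀ hk)) hk ?_
    exact hzr p₀ _ (hzO p₀ hk)
  -- a choice of representatives; `r p₀ ∘ σ p₀` does not depend on it
  let σ : X → B → X := fun p₀ b => @Function.invFunOn _ _ ⟨p₀⟩ π (O p₀) b
  have hσ : ∀ p₀, ∀ b ∈ π '' O p₀, σ p₀ b ∈ O p₀ ∧ π (σ p₀ b) = b := by
    intro p₀ b hb
    have : Nonempty X := ⟨p₀⟩
    exact ⟨Function.invFunOn_mem hb, Function.invFunOn_eq hb⟩
  have hrσ : ∀ p₀, ∀ p ∈ O p₀, r p₀ (σ p₀ (π p)) = r p₀ p := by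
    intro p₀ p hp
    obtain ⟨h1, h2⟩ := hσ p₀ (π p) ⟨p, hp, rfl⟩
    exact hrπ p₀ _ h1 _ hp h2
  let c : X → OpenPartialHomeomorph B K := fun p₀ =>
    { toFun := fun b => r p₀ (σ p₀ b)
      invFun := fun k => π (z p₀ k)
      source := π '' O p₀
      target := N p₀
      map_source' := fun b hb => hrN p₀ (hσ p₀ b hb).1
      map_target' := fun k hk => ⟨z p₀ k, hzO p₀ hk, rfl⟩
      left_inv' := by
        rintro _ ⟨p, hp, rfl⟩
        rw [hrσ p₀ p hp, hzr p₀ p hp]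
      right_inv' := by
        intro k hk
        rw [hrσ p₀ _ (hzO p₀ hk), hrz p₀ k hk]
      open_source := hopen _ (hO p₀)
      open_target := hN p₀
      continuousOn_toFun := by
        rintro _ ⟨p, hp, rfl⟩
        refine ContinuousAt.continuousWithinAt ?_
        rw [← hoq.continuousAt_comp_iff]
        refine ((hr p₀).continuousOn.continuousAt ((hO p₀).mem_nhds hp)).congr ?_
        filter_upwards [(hO p₀).mem_nhds hp] with x hx
        exact (hrσ p₀ x hx).symm
      continuousOn_invFun := hq.continuous.comp_continuousOn (hz p₀).continuousOn }
  obtain ⟨S, hStop, -, hS⟩ := exists_smoothStructure c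
    (fun b => by
      obtain ⟨p, rfl⟩ := hπ b
      exact ⟨p, p, hp₀ p, rfl⟩) (by
      rintro p₀ p₁ k ⟨hk, p, hp, hpk⟩
      -- the transition map is locally `r p₁ ∘ τ ∘ z p₀`, with `τ` moving a point of the first slice
      -- to the domain of the second projection
      obtain ⟨τ, hτ, hτk, hτπ⟩ := hloc (z p₀ k) p hpk.symm
      refine ContDiffAt.contDiffWithinAt ?_
      rw [← contMDiffAt_iff_contDiffAt]
      have hzk : ContMDiffAt 𝓘(ℝ, K) (𝓡 m) ∞ (fun k' => τ (z p₀ k')) k :=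
        (hτ.contMDiffAt).comp k ((hz p₀).contMDiffAt ((hN p₀).mem_nhds hk))
      have hkO : τ (z p₀ k) ∈ O p₁ := by rwa [hτk]
      refine (((hr p₁).contMDiffAt ((hO p₁).mem_nhds hkO)).comp k hzk).congr_of_eventuallyEq ?_
      filter_upwards [hzk.continuousAt.preimage_mem_nhds ((hO p₁).mem_nhds hkO)] with k' hk'
      change r p₁ (σ p₁ (π (z p₀ k'))) = r p₁ (τ (z p₀ k'))
      rw [← hτπ]
      exact hrσ p₁ _ hk')
  choose Φ hΦ using hS
  have hΦs : ∀ p₀, (Φ p₀).source = π '' O p₀ := fun p₀ => by rw [hΦ]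
  have hsm : ContMDiff (𝓡 m) (𝓡 S.dim) ∞ (fun x => S.of (π x)) := by
    intro p₀
    refine ContMDiffOn.contMDiffAt (s := O p₀) ?_ ((hO p₀).mem_nhds (hp₀ p₀))
    refine (Φ p₀).contMDiffOn_of_comp (fun x hx => ?_) ((hr p₀).congr fun x hx => ?_)
    · rw [hΦs]
      exact ⟨x, hx, rfl⟩
    · change (Φ p₀).toPartialEquiv (π x) = _
      rw [hΦ]
      exact hrσ p₀ x hx
  refine ⟨S, hsm, fun p₀ => ⟨(Φ p₀).source, fun b => z p₀ ((Φ p₀) b), (Φ p₀).open_source, ?_, ?_,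
    ?_, ?_⟩⟩
  · rw [hΦs]; exact ⟨p₀, hp₀ p₀, rfl⟩
  · refine (hz p₀).comp (Φ p₀).contMDiffOn_toFun fun b hb => ?_
    have : (Φ p₀) b ∈ (Φ p₀).target := (Φ p₀).map_source hb
    have ht : (Φ p₀).target = N p₀ := by rw [hΦ]
    rwa [ht] at this
  · change z p₀ ((Φ p₀).toPartialEquiv (π p₀)) = p₀
    rw [hΦ]
    change z p₀ (r p₀ (σ p₀ (π p₀))) = p₀
    rw [hrσ p₀ _ (hp₀ p₀), hzp]
  · intro b hb
    have : (Φ p₀).toPartialEquiv.symm ((Φ p₀) b) = b := (Φ p₀).left_inv hb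
    have hinv : ∀ k, (Φ p₀).toPartialEquiv.symm k = π (z p₀ k) := fun k => by rw [hΦ]; rfl
    rwa [hinv] at this

/-! ### The quotient by the automorphisms of a Weil algebra -/

/-- The surjective morphisms from an algebra `Q` to `A`. -/
abbrev SurjHom (Q : Type w) (A : Type u) [CommRing Q] [Algebra ℝ Q] [CommRing A] [Algebra ℝ A] :
    Type (max u w) :=
  {p : Q →ₐ[ℝ] A // Function.Surjective p}

/-- The automorphisms of `A` act on the surjective morphisms to `A` by composition. -/
def SurjHom.act {Q : Type w} {A : Type u} [CommRing Q] [Algebra ℝ Q] [CommRing A] [Algebra ℝ A]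
    (g : A ≃ₐ[ℝ] A) (p : SurjHom Q A) : SurjHom Q A :=
  ⟨(g : A →ₐ[ℝ] A).comp p.1, g.surjective.comp p.2⟩

/-- A linear map that transforms a surjective morphism into another one is an automorphism. -/
theorem SurjHom.exists_algEquiv {Q : Type w} {A : Type u} [CommRing Q] [Algebra ℝ Q] [CommRing A]
    [Algebra ℝ A] [Module.Finite ℝ A] (p q : SurjHom Q A) (T : A →ₗ[ℝ] A)
    (hT : ∀ f, T (p.1 f) = q.1 f) : ∃ g : A ≃ₐ[ℝ] A, ∀ a, g a = T a := by
  have hone : T 1 = 1 := by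
    have h := hT 1
    rwa [map_one p.1, map_one q.1] at h
  have hmul : ∀ a b, T (a * b) = T a * T b := by
    intro a b
    obtain ⟨f, rfl⟩ := p.2 a
    obtain ⟨h, rfl⟩ := p.2 b
    rw [← map_mul, hT, hT, hT, map_mul]
  have hsurj : Function.Surjective T := by
    intro a
    obtain ⟨f, rfl⟩ := q.2 a
    exact ⟨p.1 f, hT f⟩
  have hinj : Function.Injective T := LinearMap.injective_iff_surjective.mpr hsurj
  exact ⟨AlgEquiv.ofBijective (AlgHom.ofLinearMap T hone hmul) ⟨hinj, hsurj⟩, fun _ => rfl⟩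

section

variable {A : Type u} [NormedCommRing A] [NormedAlgebra ℝ A] [IsWeilAlgebra A]
  {Q : Type w} [CommRing Q] [Algebra ℝ Q]

/-- The operator on `A` obtained by composing a linear map `A → Q` with a morphism `Q → A`. -/
noncomputable def compSection (s : A →ₗ[ℝ] Q) (p : Q →ₐ[ℝ] A) : A →L[ℝ] A :=
  LinearMap.toContinuousLinearMap (p.toLinearMap ∘ₗ s)

theorem contMDiffOn_compSection {E H Z : Type*} [NormedAddCommGroup E] [NormedSpace ℝ E]
    [TopologicalSpace H] {I : ModelWithCorners ℝ E H} [TopologicalSpace Z] [ChartedSpace H Z]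
    {s : Set Z} {f : Z → Q →ₐ[ℝ] A} (hf : ∀ x, ContMDiffOn I 𝓘(ℝ, A) ∞ (fun z => f z x) s)
    (t : A →ₗ[ℝ] Q) : ContMDiffOn I 𝓘(ℝ, A →L[ℝ] A) ∞ (fun z => compSection t (f z)) s := by
  let b := Module.finBasis ℝ A
  let C : (Fin (Module.finrank ℝ A) → A) ≃L[ℝ] (A →L[ℝ] A) :=
    ((b.constr ℝ).trans LinearMap.toContinuousLinearMap).toContinuousLinearEquiv
  have h : ContMDiffOn I 𝓘(ℝ, Fin (Module.finrank ℝ A) → A) ∞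
      (fun z i => f z (t (b i))) s := contMDiffOn_pi_space.mpr fun i => hf _
  refine (C.contDiff.contMDiff.comp_contMDiffOn h).congr fun z _ => ?_
  ext1 a
  change _ = (b.constr ℝ fun i => f z (t (b i))) a
  have : (b.constr ℝ fun i => f z (t (b i))) = (f z).toLinearMap ∘ₗ t :=
    b.ext fun i => by rw [b.constr_basis]; rfl
  rw [this]
  rfl

/-- The slice through `b₀` of a local action near the identity: if `F (D, u)` is `u` for `D = 0` and
`D ↦ F (D, b₀)` is an immersion at `0`, then the displacements by `F` of an affine subspace through
`b₀`, complementary to the orbit, are coordinates near `b₀`. That `D ↦ F (D, b₀)` is an immersion is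
read after composing it with `ϑ`. -/
theorem exists_slice_chart {𝔥 E K W : Type*} [NormedAddCommGroup 𝔥] [NormedSpace ℝ 𝔥]
    [FiniteDimensional ℝ 𝔥] [NormedAddCommGroup E] [NormedSpace ℝ E] [FiniteDimensional ℝ E]
    [NormedAddCommGroup K] [NormedSpace ℝ K] [FiniteDimensional ℝ K] [NormedAddCommGroup W]
    [NormedSpace ℝ W] (hK : Module.finrank ℝ K = Module.finrank ℝ E - Module.finrank ℝ 𝔥)
    {F : 𝔥 × E → E} {D : Set (𝔥 × E)} (hD : IsOpen D) (hF : ContDiffOn ℝ ∞ F D) {b : E}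
    (hb : (0, b) ∈ D) (hF0 : ∀ᶠ u in 𝓝 b, F (0, u) = u) {ϑ : E → W}
    (hϑ : DifferentiableAt ℝ ϑ b) {g : 𝔥 →L[ℝ] W}
    (hg : HasFDerivAt (fun X => ϑ (F (X, b))) g 0) (hginj : Function.Injective g) :
    ∃ (j : K →L[ℝ] E) (e : OpenPartialHomeomorph (𝔥 × K) E), 0 ∈ e.source ∧
      (∀ w ∈ e.source, (w.1, b + j w.2) ∈ D ∧ e w = F (w.1, b + j w.2)) ∧
      ContDiffOn ℝ ∞ e.symm e.target := by
  have : CompleteSpace 𝔥 := FiniteDimensional.complete ℝ 𝔥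
  have : CompleteSpace K := FiniteDimensional.complete ℝ K
  have : CompleteSpace E := FiniteDimensional.complete ℝ E
  obtain ⟨T, hT⟩ : ∃ T, HasFDerivAt F T (0, b) :=
    ⟨_, ((hF.contDiffAt (hD.mem_nhds hb)).differentiableAt (by simp)).hasFDerivAt⟩
  -- the derivative at `(0, b)` is the one of the orbit map `o` plus the identity
  have hTsnd : ∀ u, T (0, u) = u := by
    have h1 : HasFDerivAt (fun u => F (0, u)) (T.comp (ContinuousLinearMap.inr ℝ 𝔥 E)) b :=
      HasFDerivAt.comp (f := fun u : E => ((0 : 𝔥), u)) b hT (hasFDerivAt_prodMk_right 0 b)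
    have h3 := h1.unique ((hasFDerivAt_id b).congr_of_eventuallyEq hF0)
    intro u
    exact congrArg (fun R : E →L[ℝ] E => R u) h3
  obtain ⟨o, ho⟩ : ∃ o : 𝔥 →L[ℝ] E, o = T.comp (ContinuousLinearMap.inl ℝ 𝔥 E) := ⟨_, rfl⟩
  have hTo : ∀ w, T w = o w.1 + w.2 := by
    intro w
    conv_rhs => rw [← hTsnd w.2]
    rw [ho]
    change T w = T (w.1, 0) + T (0, w.2)
    rw [← map_add]
    simp
  have hoinj : Function.Injective o := by
    have hFb : F (0, b) = b := hF0.self_of_nhds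
    have h2 : HasFDerivAt (fun X : 𝔥 => F (X, b)) o 0 := by
      rw [ho]
      exact HasFDerivAt.comp (f := fun X : 𝔥 => (X, b)) 0 hT (hasFDerivAt_prodMk_left 0 b)
    have h1 : HasFDerivAt (fun X : 𝔥 => ϑ (F (X, b))) ((fderiv ℝ ϑ b).comp o) 0 :=
      HasFDerivAt.comp (g := ϑ) (f := fun X : 𝔥 => F (X, b)) 0
        (by rw [hFb]; exact hϑ.hasFDerivAt) h2
    rw [hg.unique h1] at hginj
    exact Function.Injective.of_comp (f := fderiv ℝ ϑ b) hginj
  -- the slice is directed by a complement of the tangent space to the orbit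
  obtain ⟨C, hC⟩ := Submodule.exists_isCompl o.range
  have hrank : Module.finrank ℝ K = Module.finrank ℝ C := by
    have h1 := Submodule.finrank_add_eq_of_isCompl hC
    have h2 : Module.finrank ℝ o.range = Module.finrank ℝ 𝔥 :=
      LinearMap.finrank_range_of_inj hoinj
    omega
  let κ : K ≃L[ℝ] C := ContinuousLinearEquiv.ofFinrankEq hrank
  obtain ⟨j, hj⟩ : ∃ j : K →L[ℝ] E, ∀ k, j k = κ k :=
    ⟨C.subtypeL.comp (κ : K →L[ℝ] C), fun _ => rfl⟩
  have hR : Function.Bijective (o.coprod j) := by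
    constructor
    · rw [injective_iff_map_eq_zero]
      rintro ⟨X, k⟩ h
      have h' : o X + (κ k : E) = 0 := by rw [← hj]; simpa using h
      have h1 : o X = 0 := by
        have hm1 : o X ∈ o.range := ⟨X, rfl⟩
        have hm2 : o X ∈ C := by
          rw [eq_neg_of_add_eq_zero_left h']
          exact C.neg_mem (κ k).2
        exact (Submodule.disjoint_def.mp hC.disjoint) _ hm1 hm2
      have h2 : κ k = 0 := by
        rw [h1, zero_add] at h'
        exact Subtype.ext h'
      have h3 : X = 0 := hoinj (by rw [h1, map_zero])
      have h4 : k = 0 := κ.injective (by rw [h2, map_zero])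
      rw [h3, h4]; rfl
    · intro u
      have hu : u ∈ o.range ⊔ C := by rw [hC.sup_eq_top]; trivial
      obtain ⟨_, ⟨X, rfl⟩, c, hc, rfl⟩ := Submodule.mem_sup.mp hu
      refine ⟨(X, κ.symm ⟨c, hc⟩), ?_⟩
      simp [hj]
  let R' : (𝔥 × K) ≃L[ℝ] E :=
    (LinearEquiv.ofBijective (o.coprod j).toLinearMap hR).toContinuousLinearEquiv
  have hR' : (R' : (𝔥 × K) →L[ℝ] E) = o.coprod j := ContinuousLinearMap.ext fun _ => rfl
  let ι : 𝔥 × K → 𝔥 × E := fun w => (w.1, b + j w.2)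
  have hι : ContDiff ℝ ∞ ι :=
    contDiff_fst.prodMk (contDiff_const.add (j.contDiff.comp contDiff_snd))
  have hι0 : ι 0 = (0, b) := by simp [ι]
  have hΨd : HasFDerivAt (fun w => F (ι w)) (R' : (𝔥 × K) →L[ℝ] E) 0 := by
    have h1 : HasFDerivAt ι ((ContinuousLinearMap.fst ℝ 𝔥 K).prod
        (j.comp (ContinuousLinearMap.snd ℝ 𝔥 K))) 0 :=
      hasFDerivAt_fst.prodMk ((HasFDerivAt.comp (g := j) (f := Prod.snd) (0 : 𝔥 × K)
        j.hasFDerivAt hasFDerivAt_snd).const_add b)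
    have h2 : HasFDerivAt F T (ι 0) := by rw [hι0]; exact hT
    have h3 := HasFDerivAt.comp (g := F) (f := ι) (0 : 𝔥 × K) h2 h1
    refine h3.congr_fderiv ?_
    rw [hR']
    refine ContinuousLinearMap.ext fun w => ?_
    rw [ContinuousLinearMap.comp_apply, hTo]
    simp
  obtain ⟨e, he0, heD, hecoe, hesymm⟩ := exists_openPartialHomeomorph_contDiffOn
    (f := fun w => F (ι w)) (hD.preimage hι.continuous) (hF.comp hι.contDiffOn fun w hw => hw)
    (a := 0) (by change ι 0 ∈ D; rw [hι0]; exact hb) R' hΨd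
  exact ⟨j, e, he0, fun w hw => ⟨heD hw, by rw [hecoe]⟩, hesymm⟩

theorem contDiff_exp_coe {𝔸 : Type*} [NormedRing 𝔸] [NormedAlgebra ℝ 𝔸] [CompleteSpace 𝔸]
    (𝔥 : Submodule ℝ 𝔸) : ContDiff ℝ ∞ fun D : 𝔥 => NormedSpace.exp (D : 𝔸) :=
  contDiff_exp_algebra.comp 𝔥.subtypeL.contDiff

theorem hasFDerivAt_exp_coe {𝔸 : Type*} [NormedRing 𝔸] [NormedAlgebra ℝ 𝔸] [CompleteSpace 𝔸]
    (𝔥 : Submodule ℝ 𝔸) : HasFDerivAt (fun D : 𝔥 => NormedSpace.exp (D : 𝔸)) 𝔥.subtypeL 0 := by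
  have h : HasFDerivAt (NormedSpace.exp : 𝔸 → 𝔸) (1 : 𝔸 →L[ℝ] 𝔸) (𝔥.subtypeL 0) := by
    rw [map_zero]; exact hasFDerivAt_exp_zero
  exact HasFDerivAt.comp (0 : 𝔥) h 𝔥.subtypeL.hasFDerivAt

theorem Submodule.exists_continuous_retraction {E : Type*} [NormedAddCommGroup E]
    [NormedSpace ℝ E] [FiniteDimensional ℝ E] (𝔥 : Submodule ℝ E) :
    ∃ r : E → 𝔥, Continuous r ∧ ∀ x : 𝔥, r x = x := by
  obtain ⟨r, hr⟩ := Submodule.ClosedComplemented.of_finiteDimensional 𝔥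
  exact ⟨r, r.continuous, hr⟩

/-- The exponential of the derivations parametrizes smoothly the automorphisms near the identity. -/
theorem IsMatrixLieGroup.exists_exp {L : SmoothStructure (A ≃ₐ[ℝ] A)}
    (hL : IsMatrixLieGroup (MonoidHom.id (A ≃ₐ[ℝ] A)) L) :
    ∃ (𝔥 : Submodule ℝ (A →L[ℝ] A)) (ex : 𝔥 → (A ≃ₐ[ℝ] A)),
      (∀ D, autCLM A (ex D) = NormedSpace.exp (D : A →L[ℝ] A)) ∧ ex 0 = 1 ∧
      ContMDiff 𝓘(ℝ, 𝔥) (𝓡 L.dim) ∞ (fun D : 𝔥 => L.of (ex D)) ∧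
      HasFDerivAt (fun D : 𝔥 => NormedSpace.exp (D : A →L[ℝ] A)) 𝔥.subtypeL 0 ∧
      ∀ᶠ D in 𝓝 (0 : A →L[ℝ] A), (∃ g, autCLM A g = NormedSpace.exp D) → D ∈ 𝔥 := by
  have : CompleteSpace A := FiniteDimensional.complete ℝ A
  choose ex hex using fun D : derivationSubmodule A => exists_autCLM_eq_exp (A := A) D.2
  refine ⟨derivationSubmodule A, ex, hex, autCLM_injective ?_, ?_, ?_,
    eventually_mem_derivationSubmodule⟩
  · rw [hex, ZeroMemClass.coe_zero, NormedSpace.exp_zero, map_one]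
  · rw [← contMDiffOn_univ]
    refine hL.contMDiffOn_of_autCLM isOpen_univ ?_
    rw [contMDiffOn_univ]
    exact (contDiff_exp_coe (derivationSubmodule A)).contMDiff.congr hex
  · exact hasFDerivAt_exp_coe _

theorem SurjHom.exists_compSection_eq_one (p : SurjHom Q A) :
    ∃ s : A →ₗ[ℝ] Q, compSection s p.1 = 1 := by
  obtain ⟨s, hs⟩ := p.1.toLinearMap.exists_rightInverse_of_surjective
    (LinearMap.range_eq_top.mpr p.2)
  exact ⟨s, ContinuousLinearMap.ext fun a => congrArg (fun T : A →ₗ[ℝ] A => T a) hs⟩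

theorem compSection_act (s : A →ₗ[ℝ] Q) (g : A ≃ₐ[ℝ] A) (p : SurjHom Q A) :
    compSection s (SurjHom.act g p).1 = autCLM A g * compSection s p.1 := rfl

theorem contMDiff_compSection {P : SmoothStructure (SurjHom Q A)}
    (hev : ∀ f : Q, ContMDiff (𝓡 P.dim) 𝓘(ℝ, A) ∞ (fun p : P => (P.get p).1 f)) (s : A →ₗ[ℝ] Q) :
    ContMDiff (𝓡 P.dim) 𝓘(ℝ, A →L[ℝ] A) ∞ (fun p : P => compSection s (P.get p).1) := by
  rw [← contMDiffOn_univ]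
  exact contMDiffOn_compSection (fun x => (hev x).contMDiffOn) s

/-- Two morphisms `p` and `q` are related by an automorphism when `q` factors through the linear map
`(q ∘ s) ∘ (p ∘ s)⁻¹`, a closed condition. -/
theorem isClosed_setOf_act_eq {P : SmoothStructure (SurjHom Q A)}
    (hev : ∀ f : Q, ContMDiff (𝓡 P.dim) 𝓘(ℝ, A) ∞ (fun p : P => (P.get p).1 f)) :
    IsClosed {z : P × P | ∃ g : A ≃ₐ[ℝ] A, SurjHom.act g (P.get z.1) = P.get z.2} := by
  have : CompleteSpace A := FiniteDimensional.complete ℝ A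
  rw [← isOpen_compl_iff, isOpen_iff_mem_nhds]
  rintro ⟨p₀, q₀⟩ hpq
  obtain ⟨s, hs⟩ := (P.get p₀).exists_compSection_eq_one
  -- as `p₀ ∘ s = 1`, some `f` shows that `q₀` does not factor through `p₀`, and it does so nearby
  have hne : ∃ f, compSection s (P.get q₀).1 ((P.get p₀).1 f) ≠ (P.get q₀).1 f := by
    by_contra! hall
    obtain ⟨g, hg⟩ := SurjHom.exists_algEquiv (P.get p₀) (P.get q₀)
      (compSection s (P.get q₀).1).toLinearMap hall
    refine hpq (⟨g, Subtype.ext (AlgHom.ext fun f => ?_)⟩)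
    exact (hg _).trans (hall f)
  obtain ⟨f, hf⟩ := hne
  have hc : ContinuousAt (fun z : P × P => compSection s (P.get z.2).1
      (Ring.inverse (compSection s (P.get z.1).1) ((P.get z.1).1 f)) - (P.get z.2).1 f)
      (p₀, q₀) := by
    have h1 : ContinuousAt (fun z : P × P => Ring.inverse (compSection s (P.get z.1).1))
        (p₀, q₀) := by
      refine ContinuousAt.comp (g := Ring.inverse) ?_
        (((contMDiff_compSection hev s).continuous.comp continuous_fst).continuousAt)
      simp only [hs]
      exact NormedRing.inverse_continuousAt 1
    exact ((((contMDiff_compSection hev s).continuous.comp continuous_snd).continuousAt).clm_apply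
      (h1.clm_apply (((hev f).continuous.comp continuous_fst).continuousAt))).sub
      (((hev f).continuous.comp continuous_snd).continuousAt)
  have hc0 : compSection s (P.get q₀).1
      (Ring.inverse (compSection s (P.get p₀).1) ((P.get p₀).1 f)) - (P.get q₀).1 f ≠ 0 := by
    rw [hs, Ring.inverse_one]
    exact sub_ne_zero.mpr hf
  have hu : ∀ᶠ z : P × P in 𝓝 (p₀, q₀), IsUnit (compSection s (P.get z.1).1) := by
    have := ((contMDiff_compSection hev s).continuous.comp continuous_fst).continuousAt
      (x := ((p₀, q₀) : P × P))
    refine this.eventually ?_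
    simp only [Function.comp_apply, hs]
    exact Units.nhds 1
  filter_upwards [hc.eventually_ne hc0, hu] with z hz hzu hzπ
  obtain ⟨g, hg⟩ := hzπ
  apply hz
  rw [← hg, compSection_act, mul_apply_eq_comp, ← mul_apply_eq_comp (compSection s _),
    Ring.mul_inverse_cancel _ hzu]
  exact sub_self _

/-- If the displacements of a slice `z` by the exponentials of small derivations are distinct, the
slice meets at most once the orbits of `Aut A` near `z 0`: an automorphism that relates two of its
points there is close to the identity, hence it is the exponential of a small derivation. -/
theorem eventually_eq_of_act_eq {P : SmoothStructure (SurjHom Q A)}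
    (hev : ∀ f : Q, ContMDiff (𝓡 P.dim) 𝓘(ℝ, A) ∞ (fun p : P => (P.get p).1 f))
    {𝔥 : Submodule ℝ (A →L[ℝ] A)} {ex : 𝔥 → (A ≃ₐ[ℝ] A)}
    (hex : ∀ D, autCLM A (ex D) = NormedSpace.exp (D : A →L[ℝ] A))
    (hexm : ∀ᶠ D in 𝓝 (0 : A →L[ℝ] A), (∃ g, autCLM A g = NormedSpace.exp D) → D ∈ 𝔥)
    {K : Type*} [NormedAddCommGroup K] [NormedSpace ℝ K] {z : K → P} (hz : ContinuousAt z 0)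
    {s : A →ₗ[ℝ] Q} (hs : compSection s (P.get (z 0)).1 = 1) {O : Set (𝔥 × K)} (hO : O ∈ 𝓝 0)
    (hinj : ∀ (X : 𝔥) (k k' : K), (X, k) ∈ O → (0, k') ∈ O →
      SurjHom.act (ex X) (P.get (z k)) = P.get (z k') → k = k') :
    ∃ N : Set K, IsOpen N ∧ 0 ∈ N ∧ ∀ k ∈ N, ∀ k' ∈ N, ∀ g : A ≃ₐ[ℝ] A,
      SurjHom.act g (P.get (z k)) = P.get (z k') → k = k' := by
  have : CompleteSpace A := FiniteDimensional.complete ℝ A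
  have hev2 : ∀ᶠ w : K × K in 𝓝 (0, 0), ∀ g : A ≃ₐ[ℝ] A,
      SurjHom.act g (P.get (z w.1)) = P.get (z w.2) → w.1 = w.2 := by
    obtain ⟨el, hel0, helU, helcoe, helsymm⟩ := exists_local_log hexm
    obtain ⟨pr, hprc, hpr⟩ := 𝔥.exists_continuous_retraction
    have hpr0 : pr 0 = 0 := hpr 0
    have hθz : ContinuousAt (fun k => compSection s (P.get (z k)).1) 0 :=
      ContinuousAt.comp (g := fun p : P => compSection s (P.get p).1)
        (contMDiff_compSection hev s).continuous.continuousAt hz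
    have hθ1 : ContinuousAt (fun w : K × K => compSection s (P.get (z w.1)).1) (0, 0) :=
      ContinuousAt.comp (f := Prod.fst) (g := fun k => compSection s (P.get (z k)).1) hθz
        continuous_fst.continuousAt
    have hθ2 : ContinuousAt (fun w : K × K => compSection s (P.get (z w.2)).1) (0, 0) :=
      ContinuousAt.comp (f := Prod.snd) (g := fun k => compSection s (P.get (z k)).1) hθz
        continuous_snd.continuousAt
    -- an automorphism that relates `z k` to `z k'` coincides, as an operator, with `γ (k, k')`
    let γ : K × K → (A →L[ℝ] A) := fun w =>
      compSection s (P.get (z w.2)).1 * Ring.inverse (compSection s (P.get (z w.1)).1)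
    have hγ0 : γ (0, 0) = 1 := by simp [γ, hs]
    have hγ : ContinuousAt γ (0, 0) := by
      refine hθ2.mul (ContinuousAt.comp (g := Ring.inverse) ?_ hθ1)
      simp only [hs]
      exact NormedRing.inverse_continuousAt 1
    have hel1 : el 0 = 1 := by rw [helcoe, NormedSpace.exp_zero]
    have h1t : (1 : A →L[ℝ] A) ∈ el.target := by rw [← hel1]; exact el.map_source hel0
    have hel1' : el.symm 1 = 0 := by rw [← hel1, el.left_inv hel0]
    have hlog : ContinuousAt (fun w => el.symm (γ w)) (0, 0) := by
      refine ContinuousAt.comp (g := el.symm) ?_ hγ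
      rw [hγ0]
      exact helsymm.continuousOn.continuousAt (el.open_target.mem_nhds h1t)
    have hsrc : ContinuousAt (fun w : K × K => (pr (el.symm (γ w)), w.1)) (0, 0) :=
      (ContinuousAt.comp (g := pr) hprc.continuousAt hlog).prodMk
        continuous_fst.continuousAt
    have hsrc2 : Continuous fun w : K × K => ((0 : 𝔥), w.2) := by fun_prop
    have hu1 : ∀ᶠ w in 𝓝 ((0, 0) : K × K), IsUnit (compSection s (P.get (z w.1)).1) :=
      hθ1.eventually (by simp only [hs]; exact Units.nhds 1)
    have hγt1 : ∀ᶠ w in 𝓝 ((0, 0) : K × K), γ w ∈ el.target :=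
      hγ.eventually (el.open_target.mem_nhds (by rw [hγ0]; exact h1t))
    have hs11 : ∀ᶠ w in 𝓝 ((0, 0) : K × K), (pr (el.symm (γ w)), w.1) ∈ O :=
      hsrc.eventually_mem (by
        simp only [hγ0, hel1', hpr0]; exact hO)
    filter_upwards [hu1, hγt1, hs11, hsrc2.continuousAt.eventually_mem hO] with w hu hγt hs1 hs2 g
      hg
    have hgγ : autCLM A g = γ w := by
      change _ = compSection s (P.get (z w.2)).1 * _
      rw [← hg, compSection_act, mul_assoc, Ring.mul_inverse_cancel _ hu, mul_one]
    have hexp : NormedSpace.exp (el.symm (γ w)) = autCLM A g := by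
      rw [← helcoe, el.right_inv hγt, hgγ]
    have hmem : el.symm (γ w) ∈ 𝔥 := helU (el.map_target hγt) ⟨g, hexp.symm⟩
    rw [hpr ⟨_, hmem⟩] at hs1
    have hexg : ex ⟨el.symm (γ w), hmem⟩ = g := autCLM_injective (by rw [hex, hexp])
    exact hinj _ _ _ hs1 hs2 (by rw [hexg, hg])
  obtain ⟨t, ht, hinj⟩ := Filter.eventually_iff_exists_mem.mp hev2
  obtain ⟨u, v, hu, hu0, hv, hv0, huv⟩ := mem_nhds_prod_iff'.mp ht
  exact ⟨u ∩ v, hu.inter hv, ⟨hu0, hv0⟩, fun k hk k' hk' g hg => hinj (k, k')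
    (huv ⟨hk.1, hk'.2⟩) g hg⟩

set_option maxHeartbeats 1000000 in
/-- If `A` and a space of surjective morphisms `Q → A` are such that the evaluations and the action
of `Aut A` are smooth, then the quotient by `Aut A` is a manifold and the projection onto it is a
submersion.

Given a morphism `p₀` with a linear section `s`, the operator `p ∘ s` is invertible for `p` near
`p₀`, and an automorphism `g` is determined by `p` and `q = g ∘ p`, as
`g = (q ∘ s) ∘ (p ∘ s)⁻¹`. Hence the equivalence relation is closed, and a submanifold through `p₀`
complementary to the orbit of `p₀` meets the orbits once near `p₀`: an automorphism that relates two
of its points is close to the identity, so it is the exponential of a small derivation. -/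
theorem exists_quotient_by_aut {L : SmoothStructure (A ≃ₐ[ℝ] A)}
    (hL : IsMatrixLieGroup (MonoidHom.id (A ≃ₐ[ℝ] A)) L) {P : SmoothStructure (SurjHom Q A)}
    (hev : ∀ f : Q, ContMDiff (𝓡 P.dim) 𝓘(ℝ, A) ∞ (fun p : P => (P.get p).1 f))
    (hact : ContMDiff ((𝓡 L.dim).prod (𝓡 P.dim)) (𝓡 P.dim) ∞
      (fun q : L × P => P.of (SurjHom.act (L.get q.1) (P.get q.2))))
    {B : Type v} {π : SurjHom Q A → B} (hπ : Function.Surjective π)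
    (hfib : ∀ p q, π p = π q ↔ ∃ g : A ≃ₐ[ℝ] A, SurjHom.act g p = q) :
    ∃ S : SmoothStructure B, P.IsSmooth S π ∧
      HasLocalSections (𝓡 P.dim) (𝓡 S.dim) (fun p : P => S.of (π (P.get p))) := by
  have : CompleteSpace A := FiniteDimensional.complete ℝ A
  obtain ⟨𝔥, ex, hex, hex0, hexs, hexd, hexm⟩ := hL.exists_exp
  obtain ⟨d, hd⟩ : ∃ d, d = P.dim - Module.finrank ℝ 𝔥 := ⟨_, rfl⟩
  refine exists_quotient_of_slices (X := P) (π := fun p => π (P.get p))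
    (K := EuclideanSpace ℝ (Fin d)) hπ ?_ ?_ ?_
  · simp only [hfib]
    exact isClosed_setOf_act_eq hev
  · intro p q hpq
    obtain ⟨g, hg⟩ := (hfib _ _).mp hpq
    exact ⟨_, hact.comp ((contMDiff_const (c := L.of g)).prodMk contMDiff_id), hg,
      fun x => ((hfib _ _).mpr ⟨g, rfl⟩).symm⟩
  · intro p₀
    obtain ⟨s, hs⟩ := (P.get p₀).exists_compSection_eq_one
    have hθs := contMDiff_compSection hev s
    obtain ⟨φ, hφ, hp₀⟩ : ∃ φ ∈ IsManifold.maximalAtlas (𝓡 P.dim) ∞ P, p₀ ∈ φ.source :=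
      ⟨_, IsManifold.chart_mem_maximalAtlas p₀, mem_chart_source _ p₀⟩
    -- the action of the automorphisms near the identity, in exponential coordinates
    let G : 𝔥 × EuclideanSpace ℝ (Fin P.dim) → P :=
      fun w => P.of (SurjHom.act (ex w.1) (P.get (φ.symm w.2)))
    let V : Set (𝔥 × EuclideanSpace ℝ (Fin P.dim)) := univ ×ˢ φ.target
    have hV : IsOpen V := isOpen_univ.prod φ.open_target
    have hG : ContMDiffOn 𝓘(ℝ, 𝔥 × EuclideanSpace ℝ (Fin P.dim)) (𝓡 P.dim) ∞ G V := by
      refine hact.comp_contMDiffOn (ContMDiffOn.prodMk ?_ ?_)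
      · exact (hexs.comp contDiff_fst.contMDiff).contMDiffOn
      · exact (contMDiffOn_symm_of_mem_maximalAtlas hφ).comp contDiff_snd.contMDiff.contMDiffOn
          fun w hw => hw.2
    let D : Set (𝔥 × EuclideanSpace ℝ (Fin P.dim)) := V ∩ G ⁻¹' φ.source
    have hD : IsOpen D := hG.continuousOn.isOpen_inter_preimage hV φ.open_source
    have hF : ContDiffOn ℝ ∞ (fun w => φ (G w)) D := by
      rw [← contMDiffOn_iff_contDiffOn]
      exact (contMDiffOn_of_mem_maximalAtlas hφ).comp (hG.mono inter_subset_left) fun w hw => hw.2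
    have hG0 : ∀ u, G (0, u) = φ.symm u := fun u => by
      change P.of (SurjHom.act (ex 0) (P.get (φ.symm u))) = _
      rw [hex0]; rfl
    have hb : φ.symm (φ p₀) = p₀ := φ.left_inv hp₀
    have hbt : φ p₀ ∈ φ.target := φ.map_source hp₀
    have hbD : ((0, φ p₀) : 𝔥 × EuclideanSpace ℝ (Fin P.dim)) ∈ D := by
      refine ⟨⟨mem_univ _, hbt⟩, ?_⟩
      change G (0, φ p₀) ∈ φ.source
      rw [hG0, hb]; exact hp₀
    have hϑ : DifferentiableAt ℝ (fun u => compSection s (P.get (φ.symm u)).1) (φ p₀) := by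
      have h : ContDiffOn ℝ ∞ (fun u => compSection s (P.get (φ.symm u)).1) φ.target := by
        rw [← contMDiffOn_iff_contDiffOn]
        exact hθs.comp_contMDiffOn (contMDiffOn_symm_of_mem_maximalAtlas hφ)
      exact (h.contDiffAt (φ.open_target.mem_nhds hbt)).differentiableAt (by simp)
    have hDb : ∀ᶠ X in 𝓝 (0 : 𝔥), ((X, φ p₀) : 𝔥 × EuclideanSpace ℝ (Fin P.dim)) ∈ D := by
      have hcont : Continuous fun X : 𝔥 => ((X, φ p₀) : 𝔥 × EuclideanSpace ℝ (Fin P.dim)) := by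
        fun_prop
      exact hcont.continuousAt.preimage_mem_nhds (hD.mem_nhds hbD)
    obtain ⟨j, e, he0, heD, hesymm⟩ := exists_slice_chart (K := EuclideanSpace ℝ (Fin d))
      (by rw [finrank_euclideanSpace_fin, finrank_euclideanSpace_fin, hd]) hD hF hbD
      (by
        filter_upwards [φ.open_target.mem_nhds hbt] with u hu
        rw [hG0, φ.right_inv hu])
      hϑ (hexd.congr_of_eventuallyEq (by
        filter_upwards [hDb] with X hX
        rw [φ.left_inv hX.2]
        change compSection s (SurjHom.act (ex X) (P.get (φ.symm (φ p₀)))).1 = _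
        rw [compSection_act, hb, hs, mul_one, hex])) Subtype.val_injective
    -- the slice and the projection to it
    let z : EuclideanSpace ℝ (Fin d) → P := fun k => φ.symm (φ p₀ + j k)
    let r : P → EuclideanSpace ℝ (Fin d) := fun p => (e.symm (φ p)).2
    have hz0 : z 0 = p₀ := by simp [z, hb]
    have hzφ : ∀ k, ((0, k) : 𝔥 × _) ∈ e.source → e (0, k) = φ (z k) := by
      intro k hk
      rw [(heD _ hk).2, hG0]
    let N₀ : Set (EuclideanSpace ℝ (Fin d)) := {k | ((0, k) : 𝔥 × _) ∈ e.source}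
    have hN₀ : IsOpen N₀ := e.open_source.preimage (by fun_prop)
    have h0N₀ : 0 ∈ N₀ := he0
    have hzs : ContMDiffOn (𝓡 d) (𝓡 P.dim) ∞ z N₀ :=
      (contMDiffOn_symm_of_mem_maximalAtlas hφ).comp
        ((contDiff_const.add j.contDiff).contMDiff.contMDiffOn) fun k hk => (heD _ hk).1.1.2
    obtain ⟨N₁, hN₁, h0N₁, hinj⟩ := eventually_eq_of_act_eq hev hex hexm
      (hzs.continuousOn.continuousAt (hN₀.mem_nhds h0N₀)) (s := s) (by rw [hz0, hs])
      (e.open_source.mem_nhds he0) (by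
        intro X k k' hk hk' hkk
        refine congrArg Prod.snd (e.injOn hk hk' ?_)
        rw [hzφ _ hk', (heD _ hk).2]
        exact congrArg φ hkk)
    let N := N₀ ∩ N₁
    have hN : IsOpen N := hN₀.inter hN₁
    let O₁ : Set (EuclideanSpace ℝ (Fin P.dim)) := e.target ∩ e.symm ⁻¹' (Prod.snd ⁻¹' N)
    have hO₁ : IsOpen O₁ := e.isOpen_inter_preimage_symm (hN.preimage continuous_snd)
    let O : Set P := φ.source ∩ φ ⁻¹' O₁
    have hO : IsOpen O := φ.isOpen_inter_preimage hO₁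
    have hzO : MapsTo z N O := by
      intro k hk
      have h1 := (heD _ hk.1).1.1.2
      have h2 := hzφ k hk.1
      refine ⟨φ.map_target h1, ?_, ?_⟩
      · rw [← h2]; exact e.map_source hk.1
      · change (e.symm (φ (z k))).2 ∈ N
        rw [← h2, e.left_inv hk.1]
        exact hk
    have hrz : r (z 0) = 0 := by
      change (e.symm (φ (z 0))).2 = 0
      rw [← hzφ 0 h0N₀, e.left_inv h0N₀]
    refine ⟨O, N, z, r, hO, hN, ?_, ?_, hzs.mono inter_subset_left, ?_, hzO, ?_, ?_, ?_⟩
    · rw [← hz0]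
      exact hzO ⟨h0N₀, h0N₁⟩
    · exact contDiff_snd.contMDiff.comp_contMDiffOn (ContMDiffOn.comp (t := e.target)
        (contMDiffOn_iff_contDiffOn.mpr hesymm)
        ((contMDiffOn_of_mem_maximalAtlas hφ).mono inter_subset_left) fun p hp => hp.2.1)
    · intro k hk k' hk' hkk
      obtain ⟨g, hg⟩ := (hfib _ _).mp hkk
      exact hinj k hk.2 k' hk'.2 g hg
    · intro p hp
      exact hp.2.2
    · intro p hp
      have h1 : e (e.symm (φ p)) = φ p := e.right_inv hp.2.1
      have h2 := heD _ (e.map_target hp.2.1)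
      rw [h2.2] at h1
      exact (hfib _ _).mpr ⟨ex (e.symm (φ p)).1, φ.injOn h2.1.2 hp.1 h1⟩
    · rw [← hz0, hrz]

end

/-! ### Weil algebras: real part, order, morphisms from truncated polynomials -/

section

variable (A : Type u) [CommRing A] [Algebra ℝ A] [IsWeilAlgebra A]

/-- The morphism `A → A / 𝔪 = ℝ`. -/
noncomputable def weilRe : A →ₐ[ℝ] ℝ :=
  ((AlgEquiv.ofBijective (Algebra.ofId ℝ (IsLocalRing.ResidueField A))
    IsWeilAlgebra.rational).symm : IsLocalRing.ResidueField A →ₐ[ℝ] ℝ).comp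
    (IsScalarTower.toAlgHom ℝ A (IsLocalRing.ResidueField A))

variable {A}

theorem residue_eq_algebraMap_iff {a : A} {r : ℝ} :
    IsLocalRing.residue A a = algebraMap ℝ (IsLocalRing.ResidueField A) r ↔ weilRe A a = r := by
  have h : weilRe A a = (AlgEquiv.ofBijective (Algebra.ofId ℝ (IsLocalRing.ResidueField A))
    IsWeilAlgebra.rational).symm (IsLocalRing.residue A a) := rfl
  rw [h, AlgEquiv.symm_apply_eq]
  rfl

theorem weilRe_algebraMap (r : ℝ) : weilRe A (algebraMap ℝ A r) = r :=
  (weilRe A).commutes r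

theorem mem_maximalIdeal_iff_weilRe {a : A} :
    a ∈ IsLocalRing.maximalIdeal A ↔ weilRe A a = 0 := by
  rw [← residue_eq_algebraMap_iff, map_zero, IsLocalRing.residue_eq_zero_iff]

theorem sub_algebraMap_weilRe_mem (a : A) :
    a - algebraMap ℝ A (weilRe A a) ∈ IsLocalRing.maximalIdeal A := by
  rw [mem_maximalIdeal_iff_weilRe, map_sub, weilRe_algebraMap, sub_self]

variable (A) in
theorem exists_maximalIdeal_pow_eq_bot : ∃ l, IsLocalRing.maximalIdeal A ^ (l + 1) = ⊥ := by
  have : IsArtinianRing A := IsArtinianRing.of_finite ℝ A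
  obtain ⟨k, hk⟩ := IsArtinianRing.isNilpotent_jacobson_bot (R := A)
  rw [IsLocalRing.jacobson_eq_maximalIdeal ⊥ bot_ne_top] at hk
  exact ⟨k, by rw [pow_succ, hk]; exact zero_mul _⟩

variable (A) in
theorem maximalIdeal_pow_weilOrder : IsLocalRing.maximalIdeal A ^ (weilOrder A + 1) = ⊥ :=
  Nat.sInf_mem (s := {l : ℕ | IsLocalRing.maximalIdeal A ^ (l + 1) = ⊥})
    (exists_maximalIdeal_pow_eq_bot A)

theorem isNilpotent_of_mem_maximalIdeal {a : A} (ha : a ∈ IsLocalRing.maximalIdeal A) :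
    IsNilpotent a :=
  ⟨weilOrder A + 1, by
    have h := Ideal.pow_mem_pow ha (weilOrder A + 1)
    rwa [maximalIdeal_pow_weilOrder, Ideal.mem_bot] at h⟩

variable {B : Type v} [CommRing B] [Algebra ℝ B] [IsWeilAlgebra B]

/-- A morphism preserves the real parts, as it sends nilpotent elements to nilpotent elements. -/
theorem weilRe_map (f : A →ₐ[ℝ] B) (a : A) : weilRe B (f a) = weilRe A a := by
  have h := (((isNilpotent_of_mem_maximalIdeal (sub_algebraMap_weilRe_mem a)).map f).map
    (weilRe B)).eq_zero
  rwa [map_sub, map_sub, AlgHom.commutes, weilRe_algebraMap, sub_eq_zero] at h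

theorem map_mem_maximalIdeal (f : A →ₐ[ℝ] B) {a : A} (ha : a ∈ IsLocalRing.maximalIdeal A) :
    f a ∈ IsLocalRing.maximalIdeal B := by
  rw [mem_maximalIdeal_iff_weilRe] at ha ⊢
  rw [weilRe_map, ha]

theorem map_maximalIdeal_of_surjective (f : A →ₐ[ℝ] B) (hf : Function.Surjective f) :
    (IsLocalRing.maximalIdeal A).map f = IsLocalRing.maximalIdeal B := by
  refine le_antisymm (Ideal.map_le_iff_le_comap.mpr fun a ha => map_mem_maximalIdeal f ha)
    fun b hb => ?_
  obtain ⟨a, rfl⟩ := hf b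
  refine Ideal.mem_map_of_mem f ?_
  rw [mem_maximalIdeal_iff_weilRe] at hb ⊢
  rwa [weilRe_map] at hb

/-- A subalgebra that covers `𝔪` modulo `𝔪 ^ 2` is the whole algebra, by successive approximations
modulo the powers of `𝔪`, which is nilpotent. -/
theorem Subalgebra.eq_top_of_maximalIdeal_le (S : Subalgebra ℝ A)
    (hS : ∀ a ∈ IsLocalRing.maximalIdeal A,
      ∃ s ∈ S, a - s ∈ IsLocalRing.maximalIdeal A ^ 2) : S = ⊤ := by
  -- the products of `k + 1` elements of `S` approximate those of elements of `𝔪`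
  have key : ∀ k, ∀ a ∈ IsLocalRing.maximalIdeal A ^ (k + 1),
      ∃ s ∈ S, s ∈ IsLocalRing.maximalIdeal A ^ (k + 1) ∧
        a - s ∈ IsLocalRing.maximalIdeal A ^ (k + 2) := by
    intro k
    induction k with
    | zero =>
      intro a ha
      rw [zero_add, pow_one] at ha ⊢
      obtain ⟨s, hs, h⟩ := hS a ha
      refine ⟨s, hs, ?_, h⟩
      have := Ideal.sub_mem _ ha (Ideal.pow_le_self two_ne_zero h)
      rwa [sub_sub_cancel] at this
    | succ k ih =>
      intro a ha
      rw [pow_succ] at ha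
      induction ha using Submodule.mul_induction_on' with
      | mem_mul_mem x hx y hy =>
        obtain ⟨s, hs, hsm, h⟩ := ih x hx
        obtain ⟨t, ht, h'⟩ := hS y hy
        have htm : t ∈ IsLocalRing.maximalIdeal A := by
          have := Ideal.sub_mem _ hy (Ideal.pow_le_self two_ne_zero h')
          rwa [sub_sub_cancel] at this
        refine ⟨s * t, S.mul_mem hs ht, ?_, ?_⟩
        · rw [pow_succ]; exact Ideal.mul_mem_mul hsm htm
        · have e : x * y - s * t = (x - s) * y + s * (y - t) := by ring
          rw [e]
          refine Ideal.add_mem _ ?_ ?_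
          · rw [pow_succ]; exact Ideal.mul_mem_mul h hy
          · have := Ideal.mul_mem_mul hsm h'
            rwa [← pow_add] at this
      | add x hx y hy hx' hy' =>
        obtain ⟨s, hs, hsm, h⟩ := hx'
        obtain ⟨t, ht, htm, h'⟩ := hy'
        refine ⟨s + t, S.add_mem hs ht, Ideal.add_mem _ hsm htm, ?_⟩
        rw [add_sub_add_comm]
        exact Ideal.add_mem _ h h'
  have key2 : ∀ k, ∀ a ∈ IsLocalRing.maximalIdeal A, ∃ s ∈ S,
      a - s ∈ IsLocalRing.maximalIdeal A ^ (k + 1) := by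
    intro k
    induction k with
    | zero => exact fun a ha => ⟨0, S.zero_mem, by simpa using ha⟩
    | succ k ih =>
      intro a ha
      obtain ⟨s, hs, h⟩ := ih a ha
      obtain ⟨t, ht, -, h'⟩ := key k _ h
      exact ⟨s + t, S.add_mem hs ht, by rwa [← sub_sub]⟩
  rw [eq_top_iff]
  rintro a -
  obtain ⟨s, hs, h⟩ := key2 (weilOrder A) _ (sub_algebraMap_weilRe_mem a)
  rw [maximalIdeal_pow_weilOrder, Ideal.mem_bot, sub_eq_zero, sub_eq_iff_eq_add] at h
  rw [h]
  exact S.add_mem hs (S.algebraMap_mem _)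

end

namespace TruncPoly

variable {n l : ℕ} {A : Type u} [CommRing A] [Algebra ℝ A]

theorem weilRe_mk (p : MvPolynomial (Fin n) ℝ) :
    weilRe (TruncPoly n l) (Ideal.Quotient.mk _ p) = MvPolynomial.constantCoeff p := by
  have h := ((isNilpotent_sub (l := l) p).map (weilRe (TruncPoly n l))).eq_zero
  rwa [map_sub, weilRe_algebraMap, sub_eq_zero] at h

theorem var_mem (i : Fin n) : var n l i ∈ IsLocalRing.maximalIdeal (TruncPoly n l) := by
  rw [mem_maximalIdeal_iff_weilRe, var, weilRe_mk, MvPolynomial.constantCoeff_X]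

/-- The morphism from the truncated polynomials with given values at the variables. -/
noncomputable def lift [IsWeilAlgebra A] (hl : IsLocalRing.maximalIdeal A ^ (l + 1) = ⊥)
    (a : Fin n → A) (ha : ∀ i, a i ∈ IsLocalRing.maximalIdeal A) : TruncPoly n l →ₐ[ℝ] A :=
  Ideal.Quotient.liftₐ _ (MvPolynomial.aeval a) fun p hp => by
    have h1 : (MvPolynomial.idealOfVars (Fin n) ℝ).map (MvPolynomial.aeval a) ≤
        IsLocalRing.maximalIdeal A := by
      rw [MvPolynomial.idealOfVars, Ideal.map_span, Ideal.span_le]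
      rintro _ ⟨_, ⟨i, rfl⟩, rfl⟩
      rw [MvPolynomial.aeval_X]
      exact ha i
    have h2 := Ideal.mem_map_of_mem (MvPolynomial.aeval a) hp
    rw [Ideal.map_pow] at h2
    have h3 := Ideal.pow_right_mono h1 (l + 1) h2
    rwa [hl, Ideal.mem_bot] at h3

theorem lift_mk [IsWeilAlgebra A] (hl : IsLocalRing.maximalIdeal A ^ (l + 1) = ⊥)
    (a : Fin n → A) (ha : ∀ i, a i ∈ IsLocalRing.maximalIdeal A) (p : MvPolynomial (Fin n) ℝ) :
    lift hl a ha (Ideal.Quotient.mk _ p) = MvPolynomial.aeval a p := rfl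

@[simp]
theorem lift_var [IsWeilAlgebra A] (hl : IsLocalRing.maximalIdeal A ^ (l + 1) = ⊥)
    (a : Fin n → A) (ha : ∀ i, a i ∈ IsLocalRing.maximalIdeal A) (i : Fin n) :
    lift hl a ha (var n l i) = a i := by
  rw [var, lift_mk, MvPolynomial.aeval_X]

theorem apply_mk (f : TruncPoly n l →ₐ[ℝ] A) (p : MvPolynomial (Fin n) ℝ) :
    f (Ideal.Quotient.mk _ p) = MvPolynomial.aeval (fun i => f (var n l i)) p := by
  have h : f.comp (Ideal.Quotient.mkₐ ℝ _) = MvPolynomial.aeval (fun i => f (var n l i)) := by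
    ext i
    rw [MvPolynomial.aeval_X]
    rfl
  exact congrArg (fun F : MvPolynomial (Fin n) ℝ →ₐ[ℝ] A => F p) h

theorem algHom_ext {f g : TruncPoly n l →ₐ[ℝ] A} (h : ∀ i, f (var n l i) = g (var n l i)) :
    f = g := by
  ext r
  obtain ⟨p, rfl⟩ := Ideal.Quotient.mk_surjective r
  rw [apply_mk, apply_mk]
  simp only [h]

theorem map_idealOfVars : (MvPolynomial.idealOfVars (Fin n) ℝ).map
    (Ideal.Quotient.mk ((MvPolynomial.idealOfVars (Fin n) ℝ) ^ (l + 1))) =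
    Ideal.span (range (var n l)) :=
  (Ideal.map_span _ _).trans (by rw [← range_comp]; rfl)

theorem maximalIdeal_eq : IsLocalRing.maximalIdeal (TruncPoly n l) =
    Ideal.span (range (var n l)) := by
  refine le_antisymm ?_ (Ideal.span_le.mpr ?_)
  · intro r hr
    obtain ⟨p, rfl⟩ := Ideal.Quotient.mk_surjective r
    rw [mem_maximalIdeal_iff_weilRe, weilRe_mk] at hr
    have h1 : p ∈ MvPolynomial.idealOfVars (Fin n) ℝ := by
      have := (MvPolynomial.mem_pow_idealOfVars_iff' 1 p).mpr (by
        intro x hx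
        have hx0 : x = 0 := by
          rw [← Finsupp.degree_eq_zero_iff]
          omega
        rw [hx0, ← MvPolynomial.constantCoeff_eq, hr])
      simpa using this
    rw [← map_idealOfVars]
    exact Ideal.mem_map_of_mem _ h1
  · rintro _ ⟨i, rfl⟩
    exact var_mem i

theorem maximalIdeal_pow : IsLocalRing.maximalIdeal (TruncPoly n l) ^ (l + 1) = ⊥ := by
  rw [maximalIdeal_eq, ← map_idealOfVars, ← Ideal.map_pow, Ideal.map_quotient_self]

theorem exists_sub_sum_var_mem {r : TruncPoly n l}
    (hr : r ∈ IsLocalRing.maximalIdeal (TruncPoly n l)) :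
    ∃ c : Fin n → ℝ, r - ∑ i, algebraMap ℝ _ (c i) * var n l i ∈
      IsLocalRing.maximalIdeal (TruncPoly n l) ^ 2 := by
  rw [maximalIdeal_eq] at hr
  obtain ⟨a, rfl⟩ := (Ideal.mem_span_range_iff_exists_fun).mp hr
  refine ⟨fun i => weilRe _ (a i), ?_⟩
  rw [← Finset.sum_sub_distrib]
  refine Ideal.sum_mem _ fun i _ => ?_
  rw [← sub_mul, pow_two]
  exact Ideal.mul_mem_mul (sub_algebraMap_weilRe_mem _) (var_mem i)

theorem sum_single (i : Fin n) :
    ∑ j, algebraMap ℝ (TruncPoly n l) ((Pi.single i 1 : Fin n → ℝ) j) * var n l j =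
      var n l i := by
  rw [Finset.sum_eq_single i]
  · rw [Pi.single_eq_same, map_one, one_mul]
  · intro j _ hj
    rw [Pi.single_eq_of_ne hj, map_zero, zero_mul]
  · exact fun h => (h (Finset.mem_univ i)).elim

end TruncPoly

/-- Two surjective linear maps between the same finite dimensional spaces differ by an
automorphism of the source. -/
theorem LinearMap.exists_equiv_comp_eq_of_surjective {k V W : Type*} [Field k] [AddCommGroup V]
    [Module k V] [FiniteDimensional k V] [AddCommGroup W] [Module k W] (f g : V →ₗ[k] W)
    (hf : Function.Surjective f) (hg : Function.Surjective g) :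
    ∃ T : V ≃ₗ[k] V, ∀ v, f (T v) = g v := by
  obtain ⟨s, hs⟩ := f.exists_rightInverse_of_surjective (LinearMap.range_eq_top.mpr hf)
  obtain ⟨t, ht⟩ := g.exists_rightInverse_of_surjective (LinearMap.range_eq_top.mpr hg)
  have hs' : ∀ w, f (s w) = w := fun w => congrArg (fun F : W →ₗ[k] W => F w) hs
  have ht' : ∀ w, g (t w) = w := fun w => congrArg (fun F : W →ₗ[k] W => F w) ht
  have hrank : Module.finrank k g.ker = Module.finrank k f.ker := by
    have h1 := f.finrank_range_add_finrank_ker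
    have h2 := g.finrank_range_add_finrank_ker
    rw [LinearMap.range_eq_top.mpr hf] at h1
    rw [LinearMap.range_eq_top.mpr hg] at h2
    omega
  let κ : g.ker ≃ₗ[k] f.ker := LinearEquiv.ofFinrankEq _ _ hrank
  let d : V →ₗ[k] g.ker := (LinearMap.id - t ∘ₗ g).codRestrict _ fun v => by
    simp [ht']
  let T : V →ₗ[k] V := f.ker.subtype ∘ₗ κ.toLinearMap ∘ₗ d + s ∘ₗ g
  have hfT : ∀ v, f (T v) = g v := by
    intro v
    change f ((κ (d v) : V) + s (g v)) = g v
    rw [map_add, hs', (κ (d v)).2, zero_add]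
  have hT : Function.Injective T := by
    rw [injective_iff_map_eq_zero]
    intro v hv
    have h1 : g v = 0 := by rw [← hfT, hv, map_zero]
    have h2 : (κ (d v) : V) + s (g v) = 0 := hv
    rw [h1, map_zero, add_zero] at h2
    have h3 : d v = 0 := κ.injective (by rw [map_zero]; exact Subtype.ext h2)
    have h4 : v - t (g v) = 0 := congrArg Subtype.val h3
    rwa [h1, map_zero, sub_zero] at h4
  exact ⟨LinearEquiv.ofInjectiveEndo T hT, hfT⟩

section

variable {n l : ℕ} {A : Type u} [CommRing A] [Algebra ℝ A] [IsWeilAlgebra A]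

/-- The classes in `𝔪 / 𝔪 ^ 2` of the images of the linear forms by a morphism. -/
noncomputable def TruncPoly.linearPart (f : TruncPoly n l →ₐ[ℝ] A) :
    (Fin n → ℝ) →ₗ[ℝ] (IsLocalRing.maximalIdeal A).Cotangent :=
  Fintype.linearCombination ℝ fun i =>
    (IsLocalRing.maximalIdeal A).toCotangent ⟨f (var n l i), map_mem_maximalIdeal f (var_mem i)⟩

theorem TruncPoly.linearPart_apply (f : TruncPoly n l →ₐ[ℝ] A) (c : Fin n → ℝ) :
    linearPart f c = (IsLocalRing.maximalIdeal A).toCotangent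
      ⟨f (∑ i, algebraMap ℝ _ (c i) * var n l i), map_mem_maximalIdeal f (Ideal.sum_mem _ fun i _ =>
        Ideal.mul_mem_left _ _ (var_mem i))⟩ := by
  rw [linearPart, Fintype.linearCombination_apply]
  have h : (⟨f (∑ i, algebraMap ℝ _ (c i) * var n l i),
      map_mem_maximalIdeal f (Ideal.sum_mem _ fun i _ =>
        Ideal.mul_mem_left _ _ (var_mem i))⟩ : IsLocalRing.maximalIdeal A) =
      ∑ i, algebraMap ℝ A (c i) • ⟨f (var n l i), map_mem_maximalIdeal f (var_mem i)⟩ := by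
    ext
    simp [Algebra.smul_def]
  rw [h, map_sum]
  refine Finset.sum_congr rfl fun i _ => ?_
  rw [map_smul, algebraMap_smul]

theorem TruncPoly.linearPart_surjective (f : TruncPoly n l →ₐ[ℝ] A)
    (hf : Function.Surjective f) : Function.Surjective (linearPart f) := by
  intro w
  obtain ⟨⟨a, ha⟩, rfl⟩ := (IsLocalRing.maximalIdeal A).toCotangent_surjective w
  obtain ⟨r, rfl⟩ := hf a
  have hr : r ∈ IsLocalRing.maximalIdeal (TruncPoly n l) := by
    rw [mem_maximalIdeal_iff_weilRe] at ha ⊢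
    rwa [weilRe_map] at ha
  obtain ⟨c, hc⟩ := exists_sub_sum_var_mem hr
  refine ⟨c, ?_⟩
  rw [linearPart_apply, eq_comm, Ideal.toCotangent_eq]
  have h := Ideal.mem_map_of_mem f hc
  rw [Ideal.map_pow] at h
  rw [map_maximalIdeal_of_surjective f hf, map_sub] at h
  exact h

/-- A morphism that is onto modulo the square of the maximal ideal is onto. -/
theorem TruncPoly.surjective_of_linearPart (f : TruncPoly n l →ₐ[ℝ] A)
    (hf : Function.Surjective (linearPart f)) : Function.Surjective f := by
  rw [← AlgHom.range_eq_top]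
  refine Subalgebra.eq_top_of_maximalIdeal_le _ fun a ha => ?_
  obtain ⟨c, hc⟩ := hf ((IsLocalRing.maximalIdeal A).toCotangent ⟨a, ha⟩)
  rw [linearPart_apply, eq_comm, Ideal.toCotangent_eq] at hc
  exact ⟨_, ⟨_, rfl⟩, hc⟩

/-- The truncated polynomials of the same order as `A`, in at least as many variables as its width,
have `A` as a quotient. -/
theorem TruncPoly.exists_surjective (hn : weilWidth A ≤ n) :
    ∃ α : TruncPoly n (weilOrder A) →ₐ[ℝ] A, Function.Surjective α := by
  obtain ⟨f, hf⟩ : ∃ f : (Fin n → ℝ) →ₗ[ℝ] (IsLocalRing.maximalIdeal A).Cotangent,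
      Function.Surjective f := by
    have : Module.Finite ℝ (IsLocalRing.maximalIdeal A).Cotangent := by
      have : IsNoetherianRing A := IsNoetherianRing.of_finite ℝ A
      have : Module.Finite A (IsLocalRing.maximalIdeal A).Cotangent :=
        Module.Finite.of_surjective _ (IsLocalRing.maximalIdeal A).toCotangent_surjective
      exact Module.Finite.trans A _
    let b := Module.finBasis ℝ (IsLocalRing.maximalIdeal A).Cotangent
    -- the basis of `𝔪 / 𝔪 ^ 2`, completed by zeros up to `n` vectors
    refine ⟨Fintype.linearCombination ℝ fun i : Fin n =>
      if h : (i : ℕ) < Module.finrank ℝ (IsLocalRing.maximalIdeal A).Cotangent then b ⟨i, h⟩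
      else 0, ?_⟩
    rw [← LinearMap.range_eq_top, Fintype.range_linearCombination, eq_top_iff, ← b.span_eq]
    refine Submodule.span_mono ?_
    rintro _ ⟨i, rfl⟩
    exact ⟨⟨i, i.2.trans_le hn⟩, dif_pos i.2⟩
  choose ν hν using fun i =>
    (IsLocalRing.maximalIdeal A).toCotangent_surjective (f (Pi.single i 1))
  refine ⟨lift (maximalIdeal_pow_weilOrder A) (fun i => ν i) fun i => (ν i).2,
    surjective_of_linearPart _ ?_⟩
  convert hf
  refine LinearMap.pi_ext' fun i => LinearMap.ext_ring ?_
  simp [linearPart, hν]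

/-- Two surjective morphisms from the truncated polynomials to the same Weil algebra differ by an
automorphism: the second one is lifted to an endomorphism with a bijective linear part. -/
theorem TruncPoly.exists_aut_comp_eq (α β : TruncPoly n l →ₐ[ℝ] A) (hα : Function.Surjective α)
    (hβ : Function.Surjective β) : ∃ g : TruncPoly n l ≃ₐ[ℝ] TruncPoly n l, ∀ r, α (g r) = β r := by
  obtain ⟨T, hT⟩ := LinearMap.exists_equiv_comp_eq_of_surjective (linearPart α) (linearPart β)
    (linearPart_surjective α hα) (linearPart_surjective β hβ)
  have hq : ∀ i, ∃ q ∈ IsLocalRing.maximalIdeal (TruncPoly n l) ^ 2,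
      α q = α (∑ j, algebraMap ℝ _ (T (Pi.single i 1) j) * var n l j) - β (var n l i) := by
    intro i
    have h := hT (Pi.single i 1)
    rw [linearPart_apply, linearPart_apply, Ideal.toCotangent_eq] at h
    change α _ - β _ ∈ _ at h
    rw [sum_single] at h
    rw [← map_maximalIdeal_of_surjective α hα, ← Ideal.map_pow] at h
    exact (Ideal.mem_map_iff_of_surjective α hα).mp h
  choose q hq hαq using hq
  -- `t i` has linear part `T (e i)`, and the correction `q i` in the square of the maximal ideal
  -- makes it a lifting of `β (X i)`
  let t : Fin n → TruncPoly n l := fun i =>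
    ∑ j, algebraMap ℝ _ (T (Pi.single i 1) j) * var n l j - q i
  have ht : ∀ i, t i ∈ IsLocalRing.maximalIdeal (TruncPoly n l) := fun i =>
    Ideal.sub_mem _ (Ideal.sum_mem _ fun j _ => Ideal.mul_mem_left _ _ (var_mem j))
      (Ideal.pow_le_self two_ne_zero (hq i))
  let g := lift (maximalIdeal_pow (n := n) (l := l)) t ht
  have hlin : ∀ c, linearPart g c = linearPart (AlgHom.id ℝ (TruncPoly n l)) (T c) := by
    have h : linearPart g = linearPart (AlgHom.id ℝ (TruncPoly n l)) ∘ₗ T.toLinearMap := by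
      refine LinearMap.pi_ext' fun i => LinearMap.ext_ring ?_
      change linearPart g (Pi.single i 1) =
        linearPart (AlgHom.id ℝ (TruncPoly n l)) (T (Pi.single i 1))
      rw [linearPart_apply, linearPart_apply, Ideal.toCotangent_eq]
      change g _ - _ ∈ _
      rw [sum_single, lift_var]
      change ∑ j, algebraMap ℝ _ (T (Pi.single i 1) j) * var n l j - q i -
        ∑ j, algebraMap ℝ _ (T (Pi.single i 1) j) * var n l j ∈ _
      rw [sub_sub_cancel_left]
      exact neg_mem (hq i)
    exact fun c => congrArg (fun F : _ →ₗ[ℝ] _ => F c) h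
  have hg : Function.Surjective g := by
    refine surjective_of_linearPart g fun w => ?_
    obtain ⟨c, rfl⟩ := linearPart_surjective (AlgHom.id ℝ (TruncPoly n l)) (fun r => ⟨r, rfl⟩) w
    exact ⟨T.symm c, by rw [hlin, T.apply_symm_apply]⟩
  have hgi : Function.Injective g :=
    (LinearMap.injective_iff_surjective (f := g.toLinearMap)).mpr hg
  refine ⟨AlgEquiv.ofBijective g ⟨hgi, hg⟩, fun r => ?_⟩
  change (α.comp g) r = β r
  congr 1
  refine algHom_ext fun i => ?_
  change α (g (var n l i)) = _
  rw [lift_var, map_sub, hαq, sub_sub_cancel]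

end

/-! ### The groups `G_α` and `G_I` -/

section

variable {R : Type v} [CommRing R] [Algebra ℝ R] {A : Type u} [CommRing A] [Algebra ℝ A]

theorem mem_autStab_iff {I : Ideal R} {g : R ≃ₐ[ℝ] R} :
    g ∈ autStab I ↔ ∀ r, g r ∈ I ↔ r ∈ I := by
  change g '' (I : Set R) = I ↔ _
  constructor
  · intro h r
    rw [← SetLike.mem_coe, ← h, g.injective.mem_set_image, SetLike.mem_coe]
  · intro h
    ext r
    constructor
    · rintro ⟨s, hs, rfl⟩
      exact (h s).mpr hs
    · intro hr
      refine ⟨g.symm r, (h _).mp ?_, g.apply_symm_apply r⟩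
      rw [g.apply_symm_apply]
      exact hr

theorem autOver_le_autStab (α : R →ₐ[ℝ] A) : autOver α ≤ autStab (RingHom.ker α) := by
  intro g hg
  rw [mem_autStab_iff]
  intro r
  rw [RingHom.mem_ker, RingHom.mem_ker, hg r]

theorem mem_autStab_ker_of_comp_eq {α : R →ₐ[ℝ] A} {g : R ≃ₐ[ℝ] R} {h : A ≃ₐ[ℝ] A}
    (hgh : ∀ r, α (g r) = h (α r)) : g ∈ autStab (RingHom.ker α) := by
  rw [mem_autStab_iff]
  intro r
  rw [RingHom.mem_ker, RingHom.mem_ker, hgh, map_eq_zero_iff h h.injective]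

theorem exists_aut_of_mem_autStab {α : R →ₐ[ℝ] A} (hα : Function.Surjective α) {g : R ≃ₐ[ℝ] R}
    (hg : g ∈ autStab (RingHom.ker α)) : ∃ h : A ≃ₐ[ℝ] A, ∀ r, h (α r) = α (g r) := by
  have hg' := mem_autStab_iff.mp hg
  have hmap : ∀ r ∈ RingHom.ker α, (α.comp (g : R →ₐ[ℝ] R)) r = 0 := fun r hr => (hg' r).mpr hr
  let q := Ideal.quotientKerAlgEquivOfSurjective hα
  let f : A →ₐ[ℝ] A := (Ideal.Quotient.liftₐ _ _ hmap).comp (q.symm : A →ₐ[ℝ] _)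
  have hf : ∀ r, f (α r) = α (g r) := by
    intro r
    have h : q.symm (α r) = Ideal.Quotient.mk _ r := by
      rw [AlgEquiv.symm_apply_eq]
      rfl
    change Ideal.Quotient.liftₐ _ _ hmap (q.symm (α r)) = _
    rw [h]
    rfl
  refine ⟨AlgEquiv.ofBijective f ⟨?_, ?_⟩, hf⟩
  · rw [injective_iff_map_eq_zero]
    intro a ha
    obtain ⟨r, rfl⟩ := hα a
    rw [hf] at ha
    exact (hg' r).mp ha
  · intro a
    obtain ⟨r, rfl⟩ := hα a
    exact ⟨α (g.symm r), by rw [hf, g.apply_symm_apply]⟩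

/-- The morphism `g ↦ g̃` from `G_I` to `Aut A`, where `I` is the kernel of `α : R → A` and
`g̃ ∘ α = α ∘ g`. -/
noncomputable def autStabHom (α : R →ₐ[ℝ] A) (hα : Function.Surjective α) :
    autStab (RingHom.ker α) →* (A ≃ₐ[ℝ] A) where
  toFun g := (exists_aut_of_mem_autStab hα g.2).choose
  map_one' := by
    ext a
    obtain ⟨r, rfl⟩ := hα a
    rw [(exists_aut_of_mem_autStab hα (1 : autStab (RingHom.ker α)).2).choose_spec r]
    rfl
  map_mul' g g' := by
    ext a
    obtain ⟨r, rfl⟩ := hα a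
    rw [(exists_aut_of_mem_autStab hα (g * g').2).choose_spec r, AlgEquiv.mul_apply,
      (exists_aut_of_mem_autStab hα g'.2).choose_spec r,
      (exists_aut_of_mem_autStab hα g.2).choose_spec]
    rfl

theorem autStabHom_apply (α : R →ₐ[ℝ] A) (hα : Function.Surjective α)
    (g : autStab (RingHom.ker α)) (r : R) : autStabHom α hα g (α r) = α (g.1 r) :=
  (exists_aut_of_mem_autStab hα g.2).choose_spec r

theorem autStabHom_eq_iff (α : R →ₐ[ℝ] A) (hα : Function.Surjective α)
    (g : autStab (RingHom.ker α)) (h : A ≃ₐ[ℝ] A) :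
    autStabHom α hα g = h ↔ ∀ r, α (g.1 r) = h (α r) := by
  constructor
  · rintro rfl r
    rw [autStabHom_apply]
  · intro hr
    ext a
    obtain ⟨r, rfl⟩ := hα a
    rw [autStabHom_apply, hr]

theorem ker_autStabHom (α : R →ₐ[ℝ] A) (hα : Function.Surjective α) :
    (autStabHom α hα).ker = (autOver α).subgroupOf (autStab (RingHom.ker α)) := by
  ext g
  rw [MonoidHom.mem_ker, autStabHom_eq_iff, Subgroup.mem_subgroupOf]
  rfl

theorem TruncPoly.autStabHom_surjective {n l : ℕ} [IsWeilAlgebra A] (α : TruncPoly n l →ₐ[ℝ] A)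
    (hα : Function.Surjective α) : Function.Surjective (autStabHom α hα) := by
  intro h
  obtain ⟨g, hg⟩ := exists_aut_comp_eq α ((h : A →ₐ[ℝ] A).comp α) hα (h.surjective.comp hα)
  exact ⟨⟨g, mem_autStab_ker_of_comp_eq (h := h) hg⟩, (autStabHom_eq_iff α hα _ _).mpr hg⟩

end

/-! ### Hadamard's lemma -/

/-- The integral of a smooth function is smooth in the parameters. -/
theorem contDiff_intervalIntegral {E : Type w} [NormedAddCommGroup E] [NormedSpace ℝ E]
    [FiniteDimensional ℝ E] (m : ℕ) : ∀ {V : Type w} [NormedAddCommGroup V] [NormedSpace ℝ V]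
    [CompleteSpace V] {G : E × ℝ → V}, ContDiff ℝ m G →
    ContDiff ℝ m fun x => ∫ t in (0 : ℝ)..1, G (x, t) := by
  induction m with
  | zero =>
    intro V _ _ _ G hG
    rw [Nat.cast_zero, contDiff_zero] at hG ⊢
    exact intervalIntegral.continuous_parametric_intervalIntegral_of_continuous'
      (f := fun x t => G (x, t)) hG 0 1
  | succ m ih =>
    intro V _ _ _ G hG
    have : ProperSpace E := FiniteDimensional.proper_real E
    rw [Nat.cast_add, Nat.cast_one] at hG ⊢
    obtain ⟨G', hG', hd⟩ := contDiff_succ_iff_hasFDerivAt.mp hG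
    let G₁ : E × ℝ → (E →L[ℝ] V) := fun z => (G' z).comp (ContinuousLinearMap.inl ℝ E ℝ)
    have hG₁ : ContDiff ℝ m G₁ := hG'.clm_comp contDiff_const
    refine contDiff_succ_iff_hasFDerivAt.mpr ⟨_, ih hG₁, fun x => ?_⟩
    -- the derivative is bounded for the parameters in a compact neighbourhood of `x`
    obtain ⟨C, hC⟩ := ((isCompact_closedBall x 1).prod
      (isCompact_Icc (a := (0 : ℝ)) (b := 1))).bddAbove_image hG₁.continuous.norm.continuousOn
    refine intervalIntegral.hasFDerivAt_integral_of_dominated_of_fderiv_le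
      (F := fun x t => G (x, t)) (F' := fun x t => G₁ (x, t)) (bound := fun _ => C)
      (Metric.closedBall_mem_nhds x one_pos) ?_ ?_ ?_ ?_ ?_ ?_
    · exact Filter.Eventually.of_forall fun y =>
        (hG.continuous.comp (by fun_prop : Continuous fun t : ℝ => (y, t))).aestronglyMeasurable
    · exact (hG.continuous.comp
        (by fun_prop : Continuous fun t : ℝ => (x, t))).intervalIntegrable _ _
    · exact (hG₁.continuous.comp
        (by fun_prop : Continuous fun t : ℝ => (x, t))).aestronglyMeasurable
    · refine Filter.Eventually.of_forall fun t ht y hy => hC ⟨(y, t), ⟨hy, ?_⟩, rfl⟩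
      rw [uIoc_of_le zero_le_one] at ht
      exact ⟨ht.1.le, ht.2⟩
    · exact intervalIntegrable_const
    · exact Filter.Eventually.of_forall fun t _ y _ =>
        (hd (y, t)).comp y (hasFDerivAt_prodMk_left y t)

/-- Hadamard's lemma in the Euclidean space: the increment of `F` is the integral of its derivative
along a segment. -/
theorem exists_contDiff_sub_eq_sum {n : ℕ} {F : EuclideanSpace ℝ (Fin n) → ℝ} (hF : ContDiff ℝ ∞ F)
    (u : EuclideanSpace ℝ (Fin n)) : ∃ g : Fin n → EuclideanSpace ℝ (Fin n) → ℝ,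
      (∀ i, ContDiff ℝ ∞ (g i)) ∧ ∀ x, F x - F u = ∑ i, (x i - u i) * g i x := by
  let e : Fin n → EuclideanSpace ℝ (Fin n) := fun i => EuclideanSpace.single i 1
  let G : Fin n → EuclideanSpace ℝ (Fin n) × ℝ → ℝ :=
    fun i z => fderiv ℝ F (u + z.2 • (z.1 - u)) (e i)
  have hG : ∀ i, ContDiff ℝ ∞ (G i) := fun i =>
    ((hF.fderiv_right (m := ∞) (by simp)).comp (by fun_prop)).clm_apply contDiff_const
  refine ⟨fun i x => ∫ t in (0 : ℝ)..1, G i (x, t), fun i => ?_, fun x => ?_⟩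
  · rw [contDiff_infty]
    exact fun m => contDiff_intervalIntegral m ((contDiff_infty.mp (hG i)) m)
  · have hline : ∀ t : ℝ, HasDerivAt (fun t : ℝ => F (u + t • (x - u)))
        (fderiv ℝ F (u + t • (x - u)) (x - u)) t := by
      intro t
      have h1 : HasDerivAt (fun t : ℝ => u + t • (x - u)) (x - u) t := by
        simpa using ((hasDerivAt_id t).smul_const (x - u)).const_add u
      exact ((hF.differentiable (by simp)) _).hasFDerivAt.comp_hasDerivAt t h1
    have hcont : Continuous fun t : ℝ => fderiv ℝ F (u + t • (x - u)) (x - u) :=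
      ((hF.continuous_fderiv (by simp)).comp (by fun_prop)).clm_apply continuous_const
    have h := intervalIntegral.integral_eq_sub_of_hasDerivAt (fun t _ => hline t)
      (hcont.intervalIntegrable 0 1)
    have hsum : x - u = ∑ i, (x i - u i) • e i := by
      ext j
      simp [e, Finset.sum_apply, Pi.single_apply]
    simp only [one_smul, zero_smul, add_zero, add_sub_cancel] at h
    rw [← h]
    have h2 : ∀ t : ℝ, fderiv ℝ F (u + t • (x - u)) (x - u) = ∑ i, (x i - u i) * G i (x, t) := by
      intro t
      conv_lhs => rw [hsum, map_sum]
      refine Finset.sum_congr rfl fun i _ => ?_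
      rw [map_smul, smul_eq_mul, ← hsum]
    simp only [h2]
    rw [intervalIntegral.integral_finsetSum]
    · simp only [intervalIntegral.integral_const_mul]
    · intro i _
      exact (continuous_const.mul ((hG i).continuous.comp
        (by fun_prop : Continuous fun t : ℝ => (x, t)))).intervalIntegrable _ _

/-! ### Smooth functions on a manifold and their morphisms to a Weil algebra -/

section

variable {n : ℕ} {M : Type v} [TopologicalSpace M] [ChartedSpace (EuclideanSpace ℝ (Fin n)) M]

/-- The evaluation of smooth functions at a point. -/
noncomputable def SmoothRing.eval (x : M) : SmoothRing n M →ₐ[ℝ] ℝ :=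
  (Pi.evalAlgHom ℝ (fun _ : M => ℝ) x).comp ContMDiffMap.coeFnAlgHom

theorem SmoothRing.eval_apply (x : M) (f : SmoothRing n M) : SmoothRing.eval x f = f x := rfl

/-- A smooth function without zeros is invertible. -/
theorem SmoothRing.isUnit_of_ne_zero (f : SmoothRing n M) (hf : ∀ x, f x ≠ 0) : IsUnit f := by
  have h : ContMDiff (𝓡 n) 𝓘(ℝ, ℝ) ∞ fun z => (f z)⁻¹ := f.contMDiff.inv₀ hf
  refine IsUnit.of_mul_eq_one ⟨_, h⟩ ?_
  ext x
  exact mul_inv_cancel₀ (hf x)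

variable [IsManifold (𝓡 n) ∞ M] [T2Space M]

theorem SmoothRing.exists_bump {O : Set M} (hO : IsOpen O) {y : M} (hy : y ∈ O) :
    ∃ χ : SmoothRing n M, (∀ᶠ z in 𝓝 y, χ z = 1) ∧ tsupport χ ⊆ O := by
  obtain ⟨χ, -, hχ⟩ := (SmoothBumpFunction.nhds_basis_tsupport (I := 𝓡 n) y).mem_iff.mp
    (hO.mem_nhds hy)
  exact ⟨⟨χ, χ.contMDiff⟩, χ.eventuallyEq_one, hχ⟩

/-- A function that is smooth near a point coincides near it with a global smooth function. -/
theorem SmoothRing.exists_eventuallyEq {O : Set M} (hO : IsOpen O) {y : M} (hy : y ∈ O)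
    {f : M → ℝ} (hf : ContMDiffOn (𝓡 n) 𝓘(ℝ, ℝ) ∞ f O) :
    ∃ g : SmoothRing n M, ∀ᶠ z in 𝓝 y, g z = f z := by
  obtain ⟨χ, hχ1, hχ⟩ := SmoothRing.exists_bump (n := n) hO hy
  have h : ContMDiff (𝓡 n) 𝓘(ℝ, ℝ) ∞ fun z => χ z * f z := by
    refine contMDiff_of_tsupport fun z hz => ?_
    have hz' : z ∈ O := hχ (closure_mono (fun w hw => left_ne_zero_of_mul hw) hz)
    exact (χ.contMDiff.contMDiffAt).mul (hf.contMDiffAt (hO.mem_nhds hz'))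
  refine ⟨⟨_, h⟩, ?_⟩
  filter_upwards [hχ1] with z hz
  change χ z * f z = f z
  rw [hz, one_mul]

/-- Hadamard's lemma: near a point, a smooth function is its value at the point plus a combination
of the increments of the coordinates. -/
theorem SmoothRing.exists_eventually_sub_eq_sum
    {φ : OpenPartialHomeomorph M (EuclideanSpace ℝ (Fin n))}
    (hφ : φ ∈ IsManifold.maximalAtlas (𝓡 n) ∞ M) {y : M} (hy : y ∈ φ.source)
    (f : SmoothRing n M) : ∃ g : Fin n → SmoothRing n M,
      ∀ᶠ z in 𝓝 y, f z = f y + ∑ i, (φ z i - φ y i) * g i z := by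
  have hF : ContDiffOn ℝ ∞ (fun u => f (φ.symm u)) φ.target := by
    rw [← contMDiffOn_iff_contDiffOn]
    exact f.contMDiff.comp_contMDiffOn (contMDiffOn_symm_of_mem_maximalAtlas hφ)
  obtain ⟨F, hFf⟩ := SmoothRing.exists_eventuallyEq (M := EuclideanSpace ℝ (Fin n)) φ.open_target
    (φ.map_source hy) (contMDiffOn_iff_contDiffOn.mpr hF)
  obtain ⟨g, hg, hFg⟩ := exists_contDiff_sub_eq_sum F.contMDiff.contDiff (φ y)
  choose g' hg' using fun i => SmoothRing.exists_eventuallyEq φ.open_source hy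
    (f := fun z => g i (φ z)) ((hg i).contMDiff.comp_contMDiffOn
      (contMDiffOn_of_mem_maximalAtlas hφ))
  refine ⟨g', ?_⟩
  have hc : Filter.Tendsto φ (𝓝 y) (𝓝 (φ y)) := φ.continuousAt hy
  filter_upwards [Filter.eventually_all.mpr hg', hc.eventually hFf,
    φ.open_source.mem_nhds hy] with z hz hz2 hz3
  have h0 : F (φ y) = f y := by
    have := hFf.self_of_nhds
    rwa [φ.left_inv hy] at this
  rw [φ.left_inv hz3] at hz2
  rw [← hz2, ← h0, ← sub_eq_iff_eq_add', hFg]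
  simp only [hz]

variable (n M) in
/-- There is a smooth function with compact sublevel sets: one that dominates, up to a partition of
unity, the index in a compact exhaustion. -/
theorem SmoothRing.exists_isCompact_le [SecondCountableTopology M] :
    ∃ f : SmoothRing n M, ∀ c : ℝ, IsCompact {x | f x ≤ c} := by
  have : LocallyCompactSpace M := ChartedSpace.locallyCompactSpace (EuclideanSpace ℝ (Fin n)) M
  have : SigmaCompactSpace M := inferInstance
  let K : CompactExhaustion M := default
  obtain ⟨f, hf⟩ := exists_contMDiffMap_forall_mem_convex_of_local_const (n := ⊤) (𝓡 n)
    (t := fun x : M => Ici (K.find x : ℝ)) (fun x => convex_Ici _) (fun x => by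
      refine ⟨K.find x + 1, ?_⟩
      filter_upwards [mem_interior_iff_mem_nhds.mp
        (K.subset_interior_succ _ (K.mem_find x))] with y hy
      have h := K.mem_iff_find_le.mp hy
      change (K.find y : ℝ) ≤ K.find x + 1
      exact_mod_cast h)
  refine ⟨f, fun c => ?_⟩
  refine (K.isCompact ⌊c⌋₊).of_isClosed_subset
    (isClosed_le f.contMDiff.continuous continuous_const) fun x hx => ?_
  rw [K.mem_iff_find_le]
  exact Nat.le_floor ((hf x).trans hx)

/-- A morphism from the smooth functions to the real numbers is the evaluation at a point:
otherwise a sum of squares in its kernel would have no zeros, thanks to a proper function. -/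
theorem SmoothRing.exists_eq_eval [SecondCountableTopology M] (χ : SmoothRing n M →ₐ[ℝ] ℝ) :
    ∃ x, ∀ f, χ f = f x := by
  by_contra! hne
  choose g hg using hne
  obtain ⟨ψ, hψ⟩ := SmoothRing.exists_isCompact_le n M
  -- the functions `g x - χ (g x)` have no common zero on this compact level set, so that finitely
  -- many of them suffice
  have hK : IsCompact {x | ψ x = χ ψ} :=
    (hψ (χ ψ)).of_isClosed_subset (isClosed_eq ψ.contMDiff.continuous continuous_const)
      fun x hx => le_of_eq hx
  obtain ⟨t, ht, hKt⟩ := hK.elim_nhds_subcover (fun x => {z | g x z ≠ χ (g x)}) fun x _ =>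
    ((g x).contMDiff.continuous.continuousAt.eventually_ne (hg x).symm)
  let h : SmoothRing n M := (ψ - algebraMap ℝ _ (χ ψ)) ^ 2 +
    ∑ x ∈ t, (g x - algebraMap ℝ _ (χ (g x))) ^ 2
  have hval : ∀ z, h z = (ψ z - χ ψ) ^ 2 + ∑ x ∈ t, (g x z - χ (g x)) ^ 2 := by
    intro z
    simp only [h, ← SmoothRing.eval_apply, map_add, map_pow, map_sub, map_sum, AlgHom.commutes,
      Algebra.algebraMap_self, RingHom.id_apply]
  have hunit : IsUnit h := by
    refine SmoothRing.isUnit_of_ne_zero h fun z => ?_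
    rw [hval]
    by_cases hz : ψ z = χ ψ
    · obtain ⟨x, hx, hxz⟩ := mem_iUnion₂.mp (hKt hz)
      have h1 : 0 < (g x z - χ (g x)) ^ 2 := sq_pos_of_ne_zero (sub_ne_zero.mpr hxz)
      have h2 : (g x z - χ (g x)) ^ 2 ≤ ∑ x ∈ t, (g x z - χ (g x)) ^ 2 :=
        Finset.single_le_sum (f := fun x => (g x z - χ (g x)) ^ 2)
          (fun _ _ => sq_nonneg _) hx
      have h3 := sq_nonneg (ψ z - χ ψ)
      linarith
    · have h1 : 0 < (ψ z - χ ψ) ^ 2 := sq_pos_of_ne_zero (sub_ne_zero.mpr hz)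
      have h2 : 0 ≤ ∑ x ∈ t, (g x z - χ (g x)) ^ 2 := Finset.sum_nonneg fun _ _ => sq_nonneg _
      linarith
  have hzero : χ h = 0 := by
    simp only [h, map_add, map_pow, map_sub, map_sum, AlgHom.commutes, Algebra.algebraMap_self,
      RingHom.id_apply, sub_self]
    simp
  exact (hunit.map χ).ne_zero hzero

/-- Smooth functions separate points. -/
theorem SmoothRing.eq_of_forall_apply_eq {x y : M} (h : ∀ f : SmoothRing n M, f x = f y) :
    x = y := by
  by_contra hxy
  obtain ⟨χ, hχ1, hχ⟩ := SmoothRing.exists_bump (n := n) (isOpen_compl_singleton (x := y))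
    (show x ∈ ({y}ᶜ : Set M) from hxy)
  have h1 : χ x = 1 := hχ1.self_of_nhds
  have h2 : χ y = 0 := by
    by_contra h2
    exact hχ (subset_closure h2) rfl
  rw [h, h2] at h1
  exact zero_ne_one h1

end

section

variable {n : ℕ} {M : Type v} [TopologicalSpace M] [ChartedSpace (EuclideanSpace ℝ (Fin n)) M]
  {A : Type u} [CommRing A] [Algebra ℝ A] [IsWeilAlgebra A]

theorem APoint.isNear_iff {p : APoint n M A} {x : M} :
    p.IsNear x ↔ ∀ f, weilRe A (p f) = f x :=
  forall_congr' fun _ => residue_eq_algebraMap_iff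

theorem APoint.IsNear.map {B : Type w} [CommRing B] [Algebra ℝ B] [IsWeilAlgebra B]
    {p : APoint n M A} {x : M} (hp : p.IsNear x) (β : A →ₐ[ℝ] B) :
    APoint.IsNear (A := B) (β.comp p) x := by
  rw [APoint.isNear_iff] at hp ⊢
  intro f
  rw [AlgHom.comp_apply, weilRe_map, hp]

/-- A point near `x` sends the functions that do not vanish at `x` to units. -/
theorem APoint.isUnit_of_isNear {p : APoint n M A} {x : M} (hp : p.IsNear x) {f : SmoothRing n M}
    (hf : f x ≠ 0) : IsUnit (p f) := by
  rw [← IsLocalRing.notMem_maximalIdeal, mem_maximalIdeal_iff_weilRe, APoint.isNear_iff.mp hp]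
  exact hf

variable [IsManifold (𝓡 n) ∞ M] [T2Space M]

theorem APoint.exists_isNear [SecondCountableTopology M] (p : APoint n M A) : ∃ x, p.IsNear x := by
  obtain ⟨x, hx⟩ := SmoothRing.exists_eq_eval ((weilRe A).comp p)
  exact ⟨x, APoint.isNear_iff.mpr hx⟩

theorem APoint.IsNear.eq {p : APoint n M A} {x y : M} (hx : p.IsNear x) (hy : p.IsNear y) :
    x = y := by
  rw [APoint.isNear_iff] at hx hy
  exact SmoothRing.eq_of_forall_apply_eq (n := n) fun f => by rw [← hx, ← hy]

/-- The value of a point near `x` depends only on the germ of the function at `x`. -/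
theorem APoint.apply_eq_of_eventuallyEq {p : APoint n M A} {x : M} (hp : p.IsNear x)
    {f g : SmoothRing n M} (h : ∀ᶠ z in 𝓝 x, f z = g z) : p f = p g := by
  obtain ⟨O, hO, hOo, hxO⟩ := eventually_nhds_iff.mp h
  obtain ⟨χ, hχ1, hχ⟩ := SmoothRing.exists_bump (n := n) hOo hxO
  have h0 : χ * (f - g) = 0 := by
    ext z
    change χ z * (f z - g z) = 0
    by_cases hz : χ z = 0
    · rw [hz, zero_mul]
    · rw [hO z (hχ (subset_closure hz)), sub_self, mul_zero]
  have h1 := congrArg p h0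
  rw [map_mul, map_zero, (APoint.isUnit_of_isNear hp (f := χ) (by
    rw [hχ1.self_of_nhds]; exact one_ne_zero)).mul_right_eq_zero, map_sub, sub_eq_zero] at h1
  exact h1

/-- A point near `y` is determined by the values of the coordinates: by Hadamard's lemma, two such
points agree modulo each power of `𝔪`. -/
theorem APoint.eq_of_coordinates {p q : APoint n M A} {y : M} (hp : p.IsNear y) (hq : q.IsNear y)
    {φ : OpenPartialHomeomorph M (EuclideanSpace ℝ (Fin n))}
    (hφ : φ ∈ IsManifold.maximalAtlas (𝓡 n) ∞ M) (hy : y ∈ φ.source) {x : Fin n → SmoothRing n M}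
    (hx : ∀ i, ∀ᶠ z in 𝓝 y, x i z = φ z i) (hpq : ∀ i, p (x i) = q (x i)) : p = q := by
  have key : ∀ k, ∀ f, p f - q f ∈ IsLocalRing.maximalIdeal A ^ k := by
    intro k
    induction k with
    | zero => intro f; simp
    | succ k ih =>
      intro f
      obtain ⟨g, hg⟩ := SmoothRing.exists_eventually_sub_eq_sum hφ hy f
      have hf : ∀ᶠ z in 𝓝 y, f z = (algebraMap ℝ (SmoothRing n M) (f y) +
          ∑ i, (x i - algebraMap ℝ _ (φ y i)) * g i) z := by
        filter_upwards [hg, Filter.eventually_all.mpr hx] with z hz hxz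
        rw [hz]
        simp only [← SmoothRing.eval_apply, map_add, map_mul, map_sub, map_sum, AlgHom.commutes,
          Algebra.algebraMap_self, RingHom.id_apply]
        simp only [SmoothRing.eval_apply, hxz]
      rw [APoint.apply_eq_of_eventuallyEq hp hf, APoint.apply_eq_of_eventuallyEq hq hf]
      simp only [map_add, map_mul, map_sub, map_sum, AlgHom.commutes, hpq]
      rw [add_sub_add_left_eq_sub, ← Finset.sum_sub_distrib]
      refine Ideal.sum_mem _ fun i _ => ?_
      rw [← mul_sub, mul_comm, pow_succ]
      refine Ideal.mul_mem_mul (ih _) ?_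
      rw [mem_maximalIdeal_iff_weilRe, map_sub, weilRe_algebraMap, APoint.isNear_iff.mp hq,
        (hx i).self_of_nhds, sub_self]
  ext f
  have h := key (weilOrder A + 1) f
  rwa [maximalIdeal_pow_weilOrder, Ideal.mem_bot, sub_eq_zero] at h

end

/-! ### Taylor expansions -/

/-- The exponential of a nilpotent derivation `D` is a morphism of algebras, and it sends `x` to
`x + D x` up to terms in any subspace that is stable by `D` and contains `D (D x)`. -/
theorem exists_algHom_exp_of_derivation {R C : Type*} [CommRing R] [CommRing C] [Algebra R C]
    [Algebra ℝ C] (D : C →ₗ[R] C) (hD : ∀ x y, D (x * y) = x * D y + D x * y) {k : ℕ}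
    (hk : D ^ k = 0) : ∃ T : C →ₐ[R] C, ∀ S : Submodule ℝ C, (∀ x ∈ S, D x ∈ S) →
      ∀ x, D (D x) ∈ S → T x - x - D x ∈ S := by
  let : Module ℚ C := Module.compHom C (algebraMap ℚ ℝ)
  have hsum : ∀ x, IsNilpotent.exp D x =
      ∑ i ∈ Finset.range (k + 2), ((i.factorial : ℚ)⁻¹ : ℚ) • (D ^ i) x := by
    intro x
    rw [IsNilpotent.exp_eq_sum (a := D) (k := k + 2) (by rw [pow_add, hk, zero_mul]),
      LinearMap.sum_apply]
    rfl
  have hone : D 1 = 0 := by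
    have h := hD 1 1
    rwa [mul_one, one_mul, mul_one, left_eq_add] at h
  have hpow : ∀ i x, (D ^ (i + 2)) x = (D ^ i) (D (D x)) := by
    intro i x
    rw [pow_add, pow_two]
    rfl
  refine ⟨AlgHom.ofLinearMap (IsNilpotent.exp D) ?_ ?_, ?_⟩
  · rw [hsum, Finset.sum_range_succ', Finset.sum_eq_zero]
    · simp
    · intro i _
      rw [pow_succ, Module.End.mul_apply, hone, map_zero, smul_zero]
  · exact Module.End.exp_mul_of_derivation R C D hD ⟨k, hk⟩
  · intro S hS x hx
    have hpS : ∀ i, ∀ y ∈ S, (D ^ i) y ∈ S := by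
      intro i
      induction i with
      | zero => exact fun y hy => hy
      | succ i ih =>
        intro y hy
        rw [pow_succ, Module.End.mul_apply]
        exact ih _ (hS y hy)
    have h : IsNilpotent.exp D x - x - D x =
        ∑ i ∈ Finset.range k, (((i + 2).factorial : ℚ)⁻¹ : ℚ) • (D ^ i) (D (D x)) := by
      rw [hsum, Finset.sum_range_succ', Finset.sum_range_succ']
      simp [hpow]
    change IsNilpotent.exp D x - x - D x ∈ S
    rw [h]
    exact S.sum_mem fun i _ => S.smul_mem _ (hpS i _ hx)

section

variable {n : ℕ} {A : Type u} [NormedCommRing A] [NormedAlgebra ℝ A]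

/-- The algebra of the functions with values in `A` that are smooth on `Ω`. -/
def smoothFunctions (A : Type u) [NormedCommRing A] [NormedAlgebra ℝ A]
    (Ω : Set (EuclideanSpace ℝ (Fin n))) : Subalgebra A (EuclideanSpace ℝ (Fin n) → A) where
  carrier := {f | ContDiffOn ℝ ∞ f Ω}
  mul_mem' hf hg := hf.mul hg
  add_mem' hf hg := hf.add hg
  algebraMap_mem' _ := contDiffOn_const

theorem smoothFunctions.differentiableAt {Ω : Set (EuclideanSpace ℝ (Fin n))} (hΩ : IsOpen Ω)
    (f : smoothFunctions A Ω) {u : EuclideanSpace ℝ (Fin n)} (hu : u ∈ Ω) :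
    DifferentiableAt ℝ f.1 u :=
  (f.2.contDiffAt (hΩ.mem_nhds hu)).differentiableAt (by simp)

open Classical in
/-- The partial derivative of a function on `Ω`, extended by zero outside `Ω`. As a function that is
smooth on `Ω` is arbitrary outside `Ω`, this makes the partial derivative additive, and a
derivation, everywhere. -/
noncomputable def partialDeriv (Ω : Set (EuclideanSpace ℝ (Fin n))) (i : Fin n)
    (f : EuclideanSpace ℝ (Fin n) → A) (u : EuclideanSpace ℝ (Fin n)) : A :=
  if u ∈ Ω then fderiv ℝ f u (EuclideanSpace.single i 1) else 0

theorem partialDeriv_of_mem {Ω : Set (EuclideanSpace ℝ (Fin n))} (i : Fin n)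
    (f : EuclideanSpace ℝ (Fin n) → A) {u : EuclideanSpace ℝ (Fin n)} (hu : u ∈ Ω) :
    partialDeriv Ω i f u = fderiv ℝ f u (EuclideanSpace.single i 1) := if_pos hu

theorem partialDeriv_of_notMem {Ω : Set (EuclideanSpace ℝ (Fin n))} (i : Fin n)
    (f : EuclideanSpace ℝ (Fin n) → A) {u : EuclideanSpace ℝ (Fin n)} (hu : u ∉ Ω) :
    partialDeriv Ω i f u = 0 := if_neg hu

/-- The partial derivatives as operators on the algebra of the functions that are smooth on `Ω`. -/
noncomputable def partialDerivₗ {Ω : Set (EuclideanSpace ℝ (Fin n))} (hΩ : IsOpen Ω) (i : Fin n) :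
    smoothFunctions A Ω →ₗ[A] smoothFunctions A Ω where
  toFun f := ⟨partialDeriv Ω i f.1, by
    have h : ContDiffOn ℝ ∞ (fun u => fderiv ℝ f.1 u (EuclideanSpace.single i 1)) Ω :=
      (f.2.fderiv_of_isOpen hΩ (m := ∞) (by simp)).clm_apply contDiffOn_const
    exact h.congr fun u hu => partialDeriv_of_mem i _ hu⟩
  map_add' f g := by
    refine Subtype.ext (funext fun u => ?_)
    change partialDeriv Ω i (f.1 + g.1) u = partialDeriv Ω i f.1 u + partialDeriv Ω i g.1 u
    by_cases hu : u ∈ Ω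
    · simp only [partialDeriv_of_mem i _ hu]
      rw [fderiv_add (smoothFunctions.differentiableAt hΩ f hu)
        (smoothFunctions.differentiableAt hΩ g hu), add_apply]
    · simp only [partialDeriv_of_notMem i _ hu, add_zero]
  map_smul' a f := by
    refine Subtype.ext (funext fun u => ?_)
    change partialDeriv Ω i (fun w => a * f.1 w) u = a * partialDeriv Ω i f.1 u
    by_cases hu : u ∈ Ω
    · simp only [partialDeriv_of_mem i _ hu]
      rw [fderiv_const_mul (smoothFunctions.differentiableAt hΩ f hu)]
      rfl
    · simp only [partialDeriv_of_notMem i _ hu, mul_zero]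

theorem partialDerivₗ_mul {Ω : Set (EuclideanSpace ℝ (Fin n))} (hΩ : IsOpen Ω) (i : Fin n)
    (f g : smoothFunctions A Ω) :
    partialDerivₗ hΩ i (f * g) = f * partialDerivₗ hΩ i g + partialDerivₗ hΩ i f * g := by
  refine Subtype.ext (funext fun u => ?_)
  change partialDeriv Ω i (fun w => f.1 w * g.1 w) u =
    f.1 u * partialDeriv Ω i g.1 u + partialDeriv Ω i f.1 u * g.1 u
  by_cases hu : u ∈ Ω
  · simp only [partialDeriv_of_mem i _ hu]
    rw [fderiv_fun_mul (smoothFunctions.differentiableAt hΩ f hu)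
      (smoothFunctions.differentiableAt hΩ g hu), mul_comm _ (g.1 u)]
    rfl
  · simp only [partialDeriv_of_notMem i _ hu, mul_zero, zero_mul, add_zero]

/-- The derivation `∑ i, νᵢ ∂ᵢ` of the algebra of the functions that are smooth on `Ω`. -/
noncomputable def constantField {Ω : Set (EuclideanSpace ℝ (Fin n))} (hΩ : IsOpen Ω)
    (ν : Fin n → A) : smoothFunctions A Ω →ₗ[A] smoothFunctions A Ω :=
  ∑ i, ν i • partialDerivₗ hΩ i

theorem constantField_eq {Ω : Set (EuclideanSpace ℝ (Fin n))} (hΩ : IsOpen Ω) (ν : Fin n → A)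
    (f : smoothFunctions A Ω) : constantField hΩ ν f = ∑ i, ν i • partialDerivₗ hΩ i f := by
  simp [constantField]

theorem constantField_apply {Ω : Set (EuclideanSpace ℝ (Fin n))} (hΩ : IsOpen Ω) (ν : Fin n → A)
    (f : smoothFunctions A Ω) (u : EuclideanSpace ℝ (Fin n)) :
    (constantField hΩ ν f).1 u = ∑ i, ν i * partialDeriv Ω i f.1 u := by
  rw [constantField_eq, AddSubmonoidClass.coe_finsetSum, Finset.sum_apply]
  rfl

theorem constantField_mul {Ω : Set (EuclideanSpace ℝ (Fin n))} (hΩ : IsOpen Ω) (ν : Fin n → A)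
    (f g : smoothFunctions A Ω) :
    constantField hΩ ν (f * g) = f * constantField hΩ ν g + constantField hΩ ν f * g := by
  simp only [constantField_eq, partialDerivₗ_mul, smul_add, Finset.sum_add_distrib,
    Finset.mul_sum, Finset.sum_mul, mul_smul_comm, smul_mul_assoc]

variable [IsWeilAlgebra A]

/-- Each application of `∑ i, νᵢ ∂ᵢ` gains a power of the maximal ideal. -/
theorem constantField_pow_eq_zero {Ω : Set (EuclideanSpace ℝ (Fin n))} (hΩ : IsOpen Ω)
    {ν : Fin n → A} (hν : ∀ i, ν i ∈ IsLocalRing.maximalIdeal A) :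
    constantField hΩ ν ^ (weilOrder A + 1) = 0 := by
  have hpow : ∀ k f, (constantField hΩ ν ^ k) f ∈
      IsLocalRing.maximalIdeal A ^ k • (⊤ : Submodule A (smoothFunctions A Ω)) := by
    intro k
    induction k with
    | zero =>
      intro f
      rw [pow_zero, Ideal.one_eq_top, Submodule.top_smul]
      trivial
    | succ k ih =>
      intro f
      rw [pow_succ (constantField hΩ ν), Module.End.mul_apply,
        pow_succ' (IsLocalRing.maximalIdeal A), Submodule.mul_smul, constantField_eq hΩ ν f,
        map_sum]
      refine Submodule.sum_mem _ fun i _ => ?_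
      rw [map_smul]
      exact Submodule.smul_mem_smul (hν i) (ih _)
  refine LinearMap.ext fun f => ?_
  have h := hpow (weilOrder A + 1) f
  rwa [maximalIdeal_pow_weilOrder, Submodule.bot_smul, Submodule.mem_bot] at h

/-- Taylor expansion: the translation by the nilpotent vector `ν`, as an endomorphism of the algebra
of the functions with values in `A` that are smooth on `Ω`. It is the exponential of the derivation
`∑ i, νᵢ ∂ᵢ`. -/
theorem exists_taylor {Ω : Set (EuclideanSpace ℝ (Fin n))} (hΩ : IsOpen Ω) {ν : Fin n → A}
    (hν : ∀ i, ν i ∈ IsLocalRing.maximalIdeal A) :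
    ∃ T : smoothFunctions A Ω →ₐ[A] smoothFunctions A Ω,
      (∀ f, ∀ u ∈ Ω, (T f).1 u - f.1 u ∈ IsLocalRing.maximalIdeal A) ∧
      ∀ f, ∀ u ∈ Ω, ∀ i, (∀ᶠ w in 𝓝 u, f.1 w = algebraMap ℝ A (w i)) →
        (T f).1 u = algebraMap ℝ A (u i) + ν i := by
  obtain ⟨T, hT⟩ := exists_algHom_exp_of_derivation (constantField hΩ ν) (constantField_mul hΩ ν)
    (constantField_pow_eq_zero hΩ hν)
  have hmem : ∀ f u, (constantField hΩ ν f).1 u ∈ IsLocalRing.maximalIdeal A := fun f u => by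
    rw [constantField_apply]
    exact Ideal.sum_mem _ fun i _ => Ideal.mul_mem_right _ _ (hν i)
  refine ⟨T, fun f u hu => ?_, fun f u hu i hf => ?_⟩
  · -- modulo the functions with values in `𝔪`, the exponential is the identity
    let S : Submodule ℝ (smoothFunctions A Ω) :=
      { carrier := {f | ∀ u, f.1 u ∈ IsLocalRing.maximalIdeal A}
        add_mem' := fun hf hg u => Ideal.add_mem _ (hf u) (hg u)
        zero_mem' := fun u => Ideal.zero_mem _
        smul_mem' := fun c f hf u => Submodule.smul_of_tower_mem _ c (hf u) }
    have h : (T f).1 u - f.1 u - (constantField hΩ ν f).1 u ∈ IsLocalRing.maximalIdeal A :=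
      hT S (fun x _ u => hmem _ u) f (fun u => hmem _ u) u
    simpa using Ideal.add_mem _ h (hmem f u)
  · obtain ⟨W, hWf, hW, huW⟩ := eventually_nhds_iff.mp (hf.and (hΩ.mem_nhds hu))
    -- near `u` the derivation sends `f` to the constant `ν i` and constants to `0`: modulo the
    -- functions that vanish on `W`, the exponential sends `f` to `f + ν i`
    let S : Submodule ℝ (smoothFunctions A Ω) :=
      { carrier := {f | ∀ u ∈ W, f.1 u = 0}
        add_mem' := fun {f g} hf hg u hu => by
          change f.1 u + g.1 u = 0
          rw [hf u hu, hg u hu, add_zero]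
        zero_mem' := fun u _ => rfl
        smul_mem' := fun c f hf u hu => by
          change c • f.1 u = 0
          rw [hf u hu, smul_zero] }
    have hconst : ∀ (g : smoothFunctions A Ω) (a : A), (∀ w ∈ W, g.1 w = a) →
        constantField hΩ ν g ∈ S := by
      intro g a hg w hw
      have h : g.1 =ᶠ[𝓝 w] fun _ => a := by
        filter_upwards [hW.mem_nhds hw] with z hz using hg z hz
      rw [constantField_apply]
      refine Finset.sum_eq_zero fun j _ => ?_
      rw [partialDeriv_of_mem j _ (hWf w hw).2, h.fderiv_eq, fderiv_fun_const]
      exact mul_zero _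
    have hfD : ∀ w ∈ W, (constantField hΩ ν f).1 w = ν i := by
      intro w hw
      have h : f.1 =ᶠ[𝓝 w] fun z => algebraMap ℝ A (z i) := by
        filter_upwards [hW.mem_nhds hw] with z hz using (hWf z hz).1
      have h2 : HasFDerivAt (fun z : EuclideanSpace ℝ (Fin n) => algebraMap ℝ A (z i))
          ((algebraMapCLM ℝ A).comp (EuclideanSpace.proj i)) w :=
        ((algebraMapCLM ℝ A).comp (EuclideanSpace.proj i :
          EuclideanSpace ℝ (Fin n) →L[ℝ] ℝ)).hasFDerivAt
      have h3 : ∀ j, fderiv ℝ f.1 w (EuclideanSpace.single j 1) =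
          if j = i then 1 else 0 := by
        intro j
        rw [h.fderiv_eq, h2.fderiv]
        change algebraMap ℝ A ((EuclideanSpace.single j (1 : ℝ) : EuclideanSpace ℝ (Fin n)) i) = _
        by_cases hj : j = i
        · simp [hj]
        · simp [hj, Ne.symm hj]
      rw [constantField_apply]
      simp only [partialDeriv_of_mem _ _ (hWf w hw).2, h3]
      simp
    have h : (T f).1 u - f.1 u - (constantField hΩ ν f).1 u = 0 :=
      hT S (fun g hg => hconst g 0 hg) f (hconst _ (ν i) hfD) u huW
    rw [hfD u huW, (hWf u huW).1, sub_eq_zero, sub_eq_iff_eq_add] at h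
    rw [h, add_comm]

end

/-! ### Smooth structures determined by evaluations -/

section

variable {A : Type u} [NormedCommRing A] [NormedAlgebra ℝ A] {Q : Type w} [CommRing Q]
  [Algebra ℝ Q]

/-- The smooth structure `S` of a set `X` of morphisms `Q → A` is the one determined by the
evaluations at the elements of `Q`: they are smooth and induce the topology and, locally, a point is
a smooth function of finitely many of its values. -/
structure IsEvalStructure {X : Type v} (ev : X → Q →ₐ[ℝ] A) (S : SmoothStructure X) : Prop where
  smooth_eval : ∀ f : Q, ContMDiff (𝓡 S.dim) 𝓘(ℝ, A) ∞ (fun x : S => ev (S.get x) f)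
  inducing : Topology.IsInducing (fun (x : S) (f : Q) => ev (S.get x) f)
  exists_retraction : ∀ x₀ : S, ∃ (m : ℕ) (h : Fin m → Q) (N : Set (Fin m → A))
    (r : (Fin m → A) → S) (O : Set S), IsOpen N ∧
    ContMDiffOn 𝓘(ℝ, Fin m → A) (𝓡 S.dim) ∞ r N ∧ IsOpen O ∧ x₀ ∈ O ∧
    ∀ x ∈ O, (fun i => ev (S.get x) (h i)) ∈ N ∧ r (fun i => ev (S.get x) (h i)) = x

/-- A map to a manifold of morphisms is smooth when its composites with the evaluations are. -/
theorem IsEvalStructure.contMDiffOn {X : Type v} {ev : X → Q →ₐ[ℝ] A} {S : SmoothStructure X}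
    (hS : IsEvalStructure ev S) {E H Z : Type*} [NormedAddCommGroup E] [NormedSpace ℝ E]
    [TopologicalSpace H] {I : ModelWithCorners ℝ E H} [TopologicalSpace Z] [ChartedSpace H Z]
    {f : Z → S} {s : Set Z} (hs : IsOpen s)
    (h : ∀ q, ContMDiffOn I 𝓘(ℝ, A) ∞ (fun z => ev (S.get (f z)) q) s) :
    ContMDiffOn I (𝓡 S.dim) ∞ f s := by
  have hc : ContinuousOn f s := by
    rw [hS.inducing.continuousOn_iff, continuousOn_pi]
    exact fun q => (h q).continuousOn
  intro z hz
  obtain ⟨m, k, N, r, O, hN, hr, hO, hzO, hrO⟩ := hS.exists_retraction (f z)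
  have hO' : IsOpen (s ∩ f ⁻¹' O) := hc.isOpen_inter_preimage hs hO
  have h1 : ContMDiffOn I 𝓘(ℝ, Fin m → A) ∞ (fun z i => ev (S.get (f z)) (k i)) (s ∩ f ⁻¹' O) :=
    contMDiffOn_pi_space.mpr fun i => (h (k i)).mono inter_subset_left
  have h2 : ContMDiffOn I (𝓡 S.dim) ∞ f (s ∩ f ⁻¹' O) :=
    (hr.comp h1 fun z hz => (hrO _ hz.2).1).congr fun z hz => ((hrO _ hz.2).2).symm
  exact ((h2 z ⟨hz, hzO⟩).contMDiffAt (hO'.mem_nhds ⟨hz, hzO⟩)).contMDiffWithinAt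

theorem IsEvalStructure.contMDiff {X : Type v} {ev : X → Q →ₐ[ℝ] A} {S : SmoothStructure X}
    (hS : IsEvalStructure ev S) {E H Z : Type*} [NormedAddCommGroup E] [NormedSpace ℝ E]
    [TopologicalSpace H] {I : ModelWithCorners ℝ E H} [TopologicalSpace Z] [ChartedSpace H Z]
    {f : Z → S} (h : ∀ q, ContMDiff I 𝓘(ℝ, A) ∞ (fun z => ev (S.get (f z)) q)) :
    ContMDiff I (𝓡 S.dim) ∞ f := by
  rw [← contMDiffOn_univ]
  exact hS.contMDiffOn isOpen_univ fun q => (h q).contMDiffOn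

/-- A set of morphisms is a manifold for the structure determined by the evaluations when it is
covered by charts that are local linear functions of finitely many evaluations, and such that the
evaluations are smooth functions of the coordinates. -/
theorem exists_isEvalStructure {X : Type v} (ev : X → Q →ₐ[ℝ] A) (hinj : Function.Injective ev)
    {F : Type*} [NormedAddCommGroup F] [NormedSpace ℝ F] [FiniteDimensional ℝ F] {ι : Type*}
    (e : ι → PartialEquiv X F) (hopen : ∀ i, IsOpen (e i).target) {c : Set ι} (hc : c.Countable)
    (hcover : ∀ x, ∃ i ∈ c, x ∈ (e i).source)
    (hsymm : ∀ i f, ContDiffOn ℝ ∞ (fun a => ev ((e i).symm a) f) (e i).target)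
    (hloc : ∀ i, ∀ x₀ ∈ (e i).source, ∃ (m : ℕ) (h : Fin m → Q) (ρ : (Fin m → A) →L[ℝ] F)
      (O : Set (Q → A)), IsOpen O ∧ (fun f => ev x₀ f) ∈ O ∧
      ∀ x, (fun f => ev x f) ∈ O → x ∈ (e i).source ∧ e i x = ρ (fun k => ev x (h k))) :
    ∃ S : SmoothStructure X, IsEvalStructure ev S ∧ S.dim = Module.finrank ℝ F ∧
      ∀ i, ∃ Φ : PartialDiffeomorph (𝓡 S.dim) 𝓘(ℝ, F) S F ∞, Φ.toPartialEquiv = e i := by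
  let t : TopologicalSpace X := TopologicalSpace.induced (fun x f => ev x f) inferInstance
  have hind : Topology.IsInducing fun (x : X) (f : Q) => ev x f := ⟨rfl⟩
  have hemb : Topology.IsEmbedding fun (x : X) (f : Q) => ev x f :=
    ⟨hind, fun x y h => hinj (AlgHom.ext fun f => congrFun h f)⟩
  have : T2Space X := hemb.t2Space
  have hevc : ∀ f, Continuous fun x => ev x f := fun f => (continuous_apply f).comp hind.continuous
  have hsource : ∀ i, IsOpen (e i).source := by
    intro i
    rw [isOpen_iff_mem_nhds]
    intro x₀ hx₀
    obtain ⟨m, h, ρ, O, hO, hx₀O, hOe⟩ := hloc i x₀ hx₀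
    filter_upwards [hind.continuous.continuousAt.preimage_mem_nhds (hO.mem_nhds hx₀O)] with x hx
    exact (hOe x hx).1
  let e' : ι → OpenPartialHomeomorph X F := fun i =>
    { e i with
      open_source := hsource i
      open_target := hopen i
      -- near `x₀` the chart is a linear function of finitely many evaluations
      continuousOn_toFun := by
        intro x₀ hx₀
        obtain ⟨m, h, ρ, O, hO, hx₀O, hOe⟩ := hloc i x₀ hx₀
        have h1 : Continuous fun x => ρ (fun k => ev x (h k)) :=
          ρ.continuous.comp (continuous_pi fun k => hevc _)
        refine (h1.continuousAt.congr ?_).continuousWithinAt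
        filter_upwards [hind.continuous.continuousAt.preimage_mem_nhds (hO.mem_nhds hx₀O)] with x hx
        exact ((hOe x hx).2).symm
      continuousOn_invFun := by
        rw [hind.continuousOn_iff, continuousOn_pi]
        exact fun f => (hsymm i f).continuousOn }
  have : SecondCountableTopology X := by
    have : SecondCountableTopology F := inferInstance
    have h1 : ∀ i : c, SecondCountableTopology (e' i).source := fun i =>
      (e' i).toHomeomorphSourceTarget.secondCountableTopology
    have : Countable c := hc.to_subtype
    exact TopologicalSpace.secondCountableTopology_of_countable_cover
      (U := fun i : c => (e' i).source) (fun i => hsource i) (by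
        refine eq_univ_of_forall fun x => ?_
        obtain ⟨i, hi, hx⟩ := hcover x
        exact mem_iUnion.mpr ⟨⟨i, hi⟩, hx⟩)
  obtain ⟨S, hSt, hSd, hS⟩ := exists_smoothStructure e' (fun x => by
    obtain ⟨i, -, hi⟩ := hcover x
    exact ⟨i, hi⟩) (by
    intro i j a ha
    obtain ⟨m, h, ρ, O, hO, hx₀O, hOe⟩ := hloc j _ ha.2
    have hc : ContinuousAt (fun a => (e' i).symm a) a := (e' i).continuousAt_symm ha.1
    have hc2 : ContinuousAt (fun a => fun f => ev ((e' i).symm a) f) a :=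
      ContinuousAt.comp (g := fun x f => ev x f) hind.continuous.continuousAt hc
    have h1 : ContDiffAt ℝ ∞ (fun a => ρ fun k => ev ((e' i).symm a) (h k)) a := by
      refine ρ.contDiff.contDiffAt.comp a (contDiffAt_pi.mpr fun k => ?_)
      exact (hsymm i (h k)).contDiffAt ((hopen i).mem_nhds ha.1)
    refine (h1.congr_of_eventuallyEq ?_).contDiffWithinAt
    filter_upwards [hc2.preimage_mem_nhds (hO.mem_nhds hx₀O)] with a ha
    exact (hOe _ ha).2)
  have hcoe : ∀ i (Φ : PartialDiffeomorph (𝓡 S.dim) 𝓘(ℝ, F) S F ∞),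
      Φ.toPartialEquiv = (e' i).toPartialEquiv → Φ.toPartialEquiv = e i := fun i Φ h => h
  have hindS : Topology.IsInducing (fun (x : S) (f : Q) => ev (S.get x) f) := by
    refine ⟨?_⟩
    change S.top = _
    rw [hSt]
    rfl
  refine ⟨S, ⟨fun f => ?_, hindS, fun x₀ => ?_⟩, hSd, fun i => ?_⟩
  · intro x
    obtain ⟨i, -, hi⟩ := hcover (S.get x)
    obtain ⟨Φ, hΦ⟩ := hS i
    have hΦs : x ∈ Φ.source := by rw [hΦ]; exact hi
    have h1 : ContMDiffOn (𝓡 S.dim) 𝓘(ℝ, A) ∞ (fun x : S => ev ((e i).symm (Φ x)) f) Φ.source := by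
      refine ContMDiffOn.comp (t := (e i).target) (hsymm i f).contMDiffOn Φ.contMDiffOn
        fun x hx => ?_
      have h := Φ.map_source hx
      rw [hΦ] at h
      have h4 : Φ.toFun = e i := by
        rw [hΦ]
      change Φ.toFun x ∈ (e i).target
      rw [h4]
      exact h
    refine ((h1.congr fun x hx => ?_) x hΦs).contMDiffAt (Φ.open_source.mem_nhds hΦs)
    have h2 : (e i).symm (Φ x) = S.get x := by
      have h3 := Φ.left_inv hx
      rw [hΦ] at h3
      have h4 : Φ.toFun = e i := by
        rw [hΦ]
      change (e i).symm (Φ.toFun x) = _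
      rw [h4]
      exact h3
    rw [h2]
  · obtain ⟨i, -, hi⟩ := hcover (S.get x₀)
    obtain ⟨m, h, ρ, O, hO, hx₀O, hOe⟩ := hloc i _ hi
    obtain ⟨Φ, hΦ⟩ := hS i
    refine ⟨m, h, ρ ⁻¹' (e i).target, fun a => (e i).symm (ρ a),
      (fun (x : S) (f : Q) => ev (S.get x) f) ⁻¹' O, (hopen i).preimage ρ.continuous, ?_,
      hO.preimage hindS.continuous, hx₀O, fun x hx => ?_⟩
    · have h1 := Φ.contMDiffOn_invFun
      rw [hΦ] at h1
      exact ContMDiffOn.comp (t := (e i).target) h1 ρ.contDiff.contMDiff.contMDiffOn fun a ha => ha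
    · obtain ⟨h1, h2⟩ := hOe _ hx
      constructor
      · rw [mem_preimage, ← h2]
        exact (e i).map_source h1
      · change (e i).symm (ρ fun k => ev (S.get x) (h k)) = S.get x
        rw [← h2]
        exact (e i).left_inv h1
  · obtain ⟨Φ, hΦ⟩ := hS i
    exact ⟨Φ, hΦ⟩

/-- The structure determined by the evaluations restricts to open subsets. -/
theorem IsEvalStructure.of_isDiffeoOnto {X : Type v} {ev : X → Q →ₐ[ℝ] A} {T : SmoothStructure X}
    (hT : IsEvalStructure ev T) {X' : Type*} {S : SmoothStructure X'} {j : X' → X} {V : Set T}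
    (hj : IsDiffeoOnto (𝓡 S.dim) (𝓡 T.dim) (fun x : S => T.of (j (S.get x))) V) :
    IsEvalStructure (fun x => ev (j x)) S := by
  have hemb : Topology.IsOpenEmbedding (fun x : S => T.of (j (S.get x))) :=
    hj.1.isLocalHomeomorph.isOpenEmbedding_of_injective hj.2.1
  refine ⟨fun f => (hT.smooth_eval f).comp hj.contMDiff,
    hT.inducing.comp hemb.isInducing, fun x₀ => ?_⟩
  obtain ⟨m, h, N, r, O, hN, hr, hO, hx₀, hrO⟩ := hT.exists_retraction (T.of (j (S.get x₀)))
  obtain ⟨W, s, hW, hxW, hs, hsx, hsy⟩ := hj.hasLocalSections x₀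
  refine ⟨m, h, N ∩ r ⁻¹' W, fun a => s (r a), (fun x : S => T.of (j (S.get x))) ⁻¹' (O ∩ W),
    hr.continuousOn.isOpen_inter_preimage hN hW,
    hs.comp (hr.mono inter_subset_left) fun a ha => ha.2,
    (hO.inter hW).preimage hemb.continuous, ⟨hx₀, hxW⟩, fun x hx => ?_⟩
  obtain ⟨h1, h2⟩ := hrO _ hx.1
  refine ⟨⟨h1, ?_⟩, ?_⟩
  · rw [mem_preimage]
    exact (congrArg (· ∈ W) h2).mpr hx.2
  · refine hj.2.1 ?_
    exact (hsy _ ((congrArg (· ∈ W) h2).mpr hx.2)).trans h2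

end

/-- The smooth structure of a manifold. -/
def SmoothStructure.ofManifold (k : ℕ) (X : Type v) [TopologicalSpace X]
    [ChartedSpace (EuclideanSpace ℝ (Fin k)) X] [IsManifold (𝓡 k) ∞ X] [T2Space X]
    [SecondCountableTopology X] : SmoothStructure X where
  dim := k
  top := inferInstance
  charted := inferInstance
  isManifold := inferInstance
  t2 := inferInstance
  secondCountable := inferInstance

theorem isDiffeoOnto_subtype_val {k : ℕ} {X : Type v} [TopologicalSpace X]
    [ChartedSpace (EuclideanSpace ℝ (Fin k)) X] [IsManifold (𝓡 k) ∞ X]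
    (O : TopologicalSpace.Opens X) :
    IsDiffeoOnto (𝓡 k) (𝓡 k) (fun x : O => (x : X)) (O : Set X) := by
  refine isDiffeoOnto_of_hasLocalSections contMDiff_subtype_val Subtype.val_injective
    Subtype.range_val ?_
  intro x
  classical
  refine ⟨O, fun y => if hy : y ∈ O then ⟨y, hy⟩ else x, O.isOpen, x.2, ?_, ?_, ?_⟩
  · intro y hy
    have h3 : ContMDiffAt (𝓡 k) (𝓡 k) ∞
        (fun y : X => if hy : y ∈ O then (⟨y, hy⟩ : O) else x) ((⟨y, hy⟩ : O) : X) := by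
      rw [← contMDiffAt_subtype_iff]
      exact contMDiffAt_id.congr_of_eventuallyEq
        (Filter.Eventually.of_forall fun z => dif_pos z.2)
    exact h3.contMDiffWithinAt
  · exact dif_pos x.2
  · intro y hy
    exact congrArg Subtype.val (dif_pos hy)

/-! ### Families of points with given coordinates -/

section

variable {n : ℕ} {M : Type v} [TopologicalSpace M] [ChartedSpace (EuclideanSpace ℝ (Fin n)) M]

section

variable {A : Type u} [NormedCommRing A] [NormedAlgebra ℝ A]

/-- The expression of the smooth functions in a chart, with values in `A`. -/
noncomputable def SmoothRing.inChart [IsManifold (𝓡 n) ∞ M] (A : Type u) [NormedCommRing A]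
    [NormedAlgebra ℝ A]
    {φ : OpenPartialHomeomorph M (EuclideanSpace ℝ (Fin n))}
    (hφ : φ ∈ IsManifold.maximalAtlas (𝓡 n) ∞ M) :
    SmoothRing n M →ₐ[ℝ] smoothFunctions A φ.target where
  toFun f := ⟨fun u => algebraMap ℝ A (f (φ.symm u)), by
    have h : ContDiffOn ℝ ∞ (fun u => f (φ.symm u)) φ.target := by
      rw [← contMDiffOn_iff_contDiffOn]
      exact f.contMDiff.comp_contMDiffOn (contMDiffOn_symm_of_mem_maximalAtlas hφ)
    exact (algebraMapCLM ℝ A).contDiff.comp_contDiffOn h⟩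
  map_one' := Subtype.ext (funext fun u => map_one (algebraMap ℝ A))
  map_mul' f g := Subtype.ext (funext fun u => map_mul (algebraMap ℝ A) _ _)
  map_zero' := Subtype.ext (funext fun u => map_zero (algebraMap ℝ A))
  map_add' f g := Subtype.ext (funext fun u => map_add (algebraMap ℝ A) _ _)
  commutes' c := rfl

/-- In a chart there is a smooth family of points that send the coordinates `xⁱ` to `xⁱ(y) + νᵢ`,
where the `νᵢ` are given elements of the maximal ideal. -/
theorem exists_coordinate_points [IsManifold (𝓡 n) ∞ M] [IsWeilAlgebra A]
    {φ : OpenPartialHomeomorph M (EuclideanSpace ℝ (Fin n))}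
    (hφ : φ ∈ IsManifold.maximalAtlas (𝓡 n) ∞ M) {ν : Fin n → A}
    (hν : ∀ i, ν i ∈ IsLocalRing.maximalIdeal A) :
    ∃ η : M → APoint n M A, (∀ f, ContMDiffOn (𝓡 n) 𝓘(ℝ, A) ∞ (fun y => η y f) φ.source) ∧
      ∀ y ∈ φ.source, (η y).IsNear y ∧ ∀ (f : SmoothRing n M) (i : Fin n),
        (∀ᶠ z in 𝓝 y, f z = φ z i) → η y f = algebraMap ℝ A (φ y i) + ν i := by
  obtain ⟨T, hT1, hT2⟩ := exists_taylor φ.open_target hν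
  let ev : EuclideanSpace ℝ (Fin n) → smoothFunctions A φ.target →ₐ[ℝ] A := fun u =>
    { toFun := fun f => f.1 u
      map_one' := rfl
      map_mul' := fun _ _ => rfl
      map_zero' := rfl
      map_add' := fun _ _ => rfl
      commutes' := fun _ => rfl }
  refine ⟨fun y => (ev (φ y)).comp ((T.restrictScalars ℝ).comp (SmoothRing.inChart A hφ)),
    fun f => ?_, fun y hy => ⟨?_, fun f i hf => ?_⟩⟩
  · exact (T (SmoothRing.inChart A hφ f)).2.contMDiffOn.comp
      (contMDiffOn_of_mem_maximalAtlas hφ) fun y hy => φ.map_source hy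
  · rw [APoint.isNear_iff]
    intro f
    have h := hT1 (SmoothRing.inChart A hφ f) _ (φ.map_source hy)
    have h2 : (SmoothRing.inChart A hφ f).1 (φ y) = algebraMap ℝ A (f y) :=
      congrArg (fun z => algebraMap ℝ A (f z)) (φ.left_inv hy)
    rw [h2, mem_maximalIdeal_iff_weilRe, map_sub, weilRe_algebraMap, sub_eq_zero] at h
    exact h
  · refine hT2 _ _ (φ.map_source hy) i ?_
    have hc : Filter.Tendsto φ.symm (𝓝 (φ y)) (𝓝 y) := by
      have := φ.continuousAt_symm (φ.map_source hy)
      rwa [ContinuousAt, φ.left_inv hy] at this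
    filter_upwards [hc.eventually hf, φ.open_target.mem_nhds (φ.map_source hy)] with w hw hwt
    change algebraMap ℝ A (f (φ.symm w)) = _
    rw [hw, φ.right_inv hwt]

end

/-! ### Norms on Weil algebras -/

section

variable (A : Type u) [CommRing A] [Algebra ℝ A] [Module.Finite ℝ A]

/-- The action of `A` on itself by multiplication, read in a basis. -/
noncomputable def mulOperator :
    A →ₐ[ℝ] ((Fin (Module.finrank ℝ A) → ℝ) →L[ℝ] (Fin (Module.finrank ℝ A) → ℝ)) :=
  ((Module.End.toContinuousLinearMap (𝕜 := ℝ) (Fin (Module.finrank ℝ A) → ℝ)).toAlgHom.comp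
    (Matrix.toLinAlgEquiv' (R := ℝ) (n := Fin (Module.finrank ℝ A))).toAlgHom).comp
    (Algebra.leftMulMatrix (Module.finBasis ℝ A))

theorem mulOperator_injective : Function.Injective (mulOperator A) :=
  ((Module.End.toContinuousLinearMap (𝕜 := ℝ) (Fin (Module.finrank ℝ A) → ℝ)).injective.comp
    (Matrix.toLinAlgEquiv' (R := ℝ) (n := Fin (Module.finrank ℝ A))).injective).comp
    (Algebra.leftMulMatrix_injective (Module.finBasis ℝ A))

/-- A norm on a finite dimensional commutative algebra: the operator norm of the multiplications. -/
@[reducible]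
noncomputable def finiteNormedCommRing : NormedCommRing A :=
  NormedCommRing.induced A _ (mulOperator A) (mulOperator_injective A)

/-- The norm of `finiteNormedCommRing` is an algebra norm. -/
@[reducible]
noncomputable def finiteNormedAlgebra :
    @NormedAlgebra ℝ A _ (finiteNormedCommRing A).toSeminormedCommRing.toSeminormedRing :=
  NormedAlgebra.induced ℝ A _ (mulOperator A)

end

end

/-! ### The charts of the set of points -/

section

variable {n : ℕ} {M : Type v} [TopologicalSpace M] [ChartedSpace (EuclideanSpace ℝ (Fin n)) M]

/-- The coordinates of a chart coincide near a point with global smooth functions. -/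
theorem SmoothRing.exists_coordinates [IsManifold (𝓡 n) ∞ M] [T2Space M]
    {φ : OpenPartialHomeomorph M (EuclideanSpace ℝ (Fin n))}
    (hφ : φ ∈ IsManifold.maximalAtlas (𝓡 n) ∞ M) {y : M} (hy : y ∈ φ.source) :
    ∃ x : Fin n → SmoothRing n M, ∀ i, ∀ᶠ z in 𝓝 y, x i z = φ z i := by
  choose x hx using fun i : Fin n =>
    SmoothRing.exists_eventuallyEq (n := n) φ.open_source hy (f := fun z => φ z i) (by
      exact ((EuclideanSpace.proj i :
        EuclideanSpace ℝ (Fin n) →L[ℝ] ℝ).contDiff.contMDiff).comp_contMDiffOn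
        (contMDiffOn_of_mem_maximalAtlas hφ))
  exact ⟨x, hx⟩

/-- `exists_coordinate_points` for an algebra without a norm, where smoothness is that of the
components. -/
theorem exists_coordinate_points_of_isWeilAlgebra [IsManifold (𝓡 n) ∞ M] {B : Type u} [CommRing B]
    [Algebra ℝ B] [IsWeilAlgebra B] {φ : OpenPartialHomeomorph M (EuclideanSpace ℝ (Fin n))}
    (hφ : φ ∈ IsManifold.maximalAtlas (𝓡 n) ∞ M) {ν : Fin n → B}
    (hν : ∀ i, ν i ∈ IsLocalRing.maximalIdeal B) :
    ∃ η : M → APoint n M B,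
      (∀ f (L : B →ₗ[ℝ] ℝ), ContMDiffOn (𝓡 n) 𝓘(ℝ, ℝ) ∞ (fun y => L (η y f)) φ.source) ∧
      ∀ y ∈ φ.source, (η y).IsNear y ∧ ∀ (f : SmoothRing n M) (i : Fin n),
        (∀ᶠ z in 𝓝 y, f z = φ z i) → η y f = algebraMap ℝ B (φ y i) + ν i := by
  let : NormedCommRing B := finiteNormedCommRing B
  let : NormedAlgebra ℝ B := finiteNormedAlgebra B
  obtain ⟨η, h1, h2⟩ := exists_coordinate_points hφ hν
  exact ⟨η, fun f L => (LinearMap.toContinuousLinearMap L).contDiff.contMDiff.comp_contMDiffOn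
    (h1 f), h2⟩

theorem TruncPoly.exists_coordinate_points [IsManifold (𝓡 n) ∞ M] (l : ℕ)
    {φ : OpenPartialHomeomorph M (EuclideanSpace ℝ (Fin n))}
    (hφ : φ ∈ IsManifold.maximalAtlas (𝓡 n) ∞ M) :
    ∃ η : M → APoint n M (TruncPoly n l),
      (∀ f (L : TruncPoly n l →ₗ[ℝ] ℝ),
        ContMDiffOn (𝓡 n) 𝓘(ℝ, ℝ) ∞ (fun y => L (η y f)) φ.source) ∧
      ∀ y ∈ φ.source, (η y).IsNear y ∧ ∀ (f : SmoothRing n M) (i : Fin n),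
        (∀ᶠ z in 𝓝 y, f z = φ z i) →
          η y f = algebraMap ℝ (TruncPoly n l) (φ y i) + var n l i :=
  exists_coordinate_points_of_isWeilAlgebra hφ var_mem

section

variable {A : Type u} [NormedCommRing A] [NormedAlgebra ℝ A]

theorem contDiff_aeval {E : Type*} [NormedAddCommGroup E] [NormedSpace ℝ E] {σ : Type*}
    (p : MvPolynomial σ ℝ) {f : E → σ → A} (hf : ∀ i, ContDiff ℝ ∞ fun x => f x i) :
    ContDiff ℝ ∞ fun x => MvPolynomial.aeval (f x) p := by
  induction p using MvPolynomial.induction_on with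
  | C r => simpa using contDiff_const
  | add p q hp hq => simpa using hp.add hq
  | mul_X p i hp => simpa using hp.mul (hf i)

/-- The value of a morphism from the truncated polynomials is a smooth function of the morphism,
that is, of the images of the variables, and of the polynomial. -/
theorem TruncPoly.contMDiffOn_apply {l : ℕ} {E H Z : Type*} [NormedAddCommGroup E]
    [NormedSpace ℝ E] [TopologicalSpace H] {I : ModelWithCorners ℝ E H} [TopologicalSpace Z]
    [ChartedSpace H Z] {s : Set Z} {β : Z → TruncPoly n l →ₐ[ℝ] A} {r : Z → TruncPoly n l}
    (hβ : ∀ i, ContMDiffOn I 𝓘(ℝ, A) ∞ (fun z => β z (var n l i)) s)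
    (hr : ∀ L : TruncPoly n l →ₗ[ℝ] ℝ, ContMDiffOn I 𝓘(ℝ, ℝ) ∞ (fun z => L (r z)) s) :
    ContMDiffOn I 𝓘(ℝ, A) ∞ (fun z => β z (r z)) s := by
  let b := Module.finBasis ℝ (TruncPoly n l)
  have hb : ∀ j, ContMDiffOn I 𝓘(ℝ, A) ∞ (fun z => β z (b j)) s := by
    intro j
    obtain ⟨p, hp⟩ := Ideal.Quotient.mk_surjective (b j)
    have h1 : ContDiff ℝ ∞ fun a : Fin n → A => MvPolynomial.aeval a p :=
      contDiff_aeval p fun i => contDiff_apply ℝ A i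
    have h2 : ContMDiffOn I 𝓘(ℝ, Fin n → A) ∞ (fun z i => β z (var n l i)) s :=
      contMDiffOn_pi_space.mpr hβ
    refine (h1.contMDiff.comp_contMDiffOn h2).congr fun z _ => ?_
    rw [← hp, apply_mk]
    rfl
  have h : ∀ z, β z (r z) = ∑ j, b.coord j (r z) • β z (b j) := by
    intro z
    conv_lhs => rw [← b.sum_repr (r z), map_sum]
    refine Finset.sum_congr rfl fun j _ => ?_
    exact (β z).toLinearMap.map_smul _ _
  simp only [h]
  exact contMDiffOn_finsetSum fun j _ => (hr (b.coord j)).smul (hb j)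

variable [IsWeilAlgebra A]

variable (A) in
/-- The vector of the real parts of the components. -/
noncomputable def reVec (n : ℕ) : (Fin n → A) →L[ℝ] EuclideanSpace ℝ (Fin n) :=
  LinearMap.toContinuousLinearMap ((WithLp.linearEquiv 2 ℝ (Fin n → ℝ)).symm.toLinearMap ∘ₗ
    LinearMap.pi fun i => (weilRe A).toLinearMap ∘ₗ LinearMap.proj i)

@[simp]
theorem reVec_apply (a : Fin n → A) (i : Fin n) : reVec A n a i = weilRe A (a i) := rfl

theorem sub_reVec_mem (a : Fin n → A) (i : Fin n) :
    a i - algebraMap ℝ A (reVec A n a i) ∈ IsLocalRing.maximalIdeal A :=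
  sub_algebraMap_weilRe_mem _

variable [IsManifold (𝓡 n) ∞ M] [T2Space M]

/-- A chart of `M` gives a chart of the set of the `A`-points: the points near the domain of the
chart are coordinated by the tuples of elements of `A` whose real parts are in its image. -/
theorem exists_pointChart [SecondCountableTopology M]
    {φ : OpenPartialHomeomorph M (EuclideanSpace ℝ (Fin n))}
    (hφ : φ ∈ IsManifold.maximalAtlas (𝓡 n) ∞ M) :
    ∃ e : PartialEquiv (APoint n M A) (Fin n → A),
      e.source = {p | ∃ y ∈ φ.source, p.IsNear y} ∧ e.target = reVec A n ⁻¹' φ.target ∧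
      (∀ p, ∀ y ∈ φ.source, p.IsNear y → ∀ (i : Fin n) (f : SmoothRing n M),
        (∀ᶠ z in 𝓝 y, f z = φ z i) → e p i = p f) ∧
      ∀ f, ContDiffOn ℝ ∞ (fun a => e.symm a f) e.target := by
  obtain ⟨η, hηs, hη⟩ := TruncPoly.exists_coordinate_points (weilOrder A) hφ
  choose! x hx using fun y (hy : y ∈ φ.source) => SmoothRing.exists_coordinates hφ hy
  choose pt hpt using fun p : APoint n M A => p.exists_isNear
  -- the point with coordinates `a` is obtained from the real part of `a`, which gives a truncated
  -- Taylor expansion at a point of `M`, by substituting to the variables the nilpotent part of `a`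
  let β : (Fin n → A) → TruncPoly n (weilOrder A) →ₐ[ℝ] A := fun a =>
    TruncPoly.lift (maximalIdeal_pow_weilOrder A) (fun i => a i - algebraMap ℝ A (reVec A n a i))
      (sub_reVec_mem a)
  let inv : (Fin n → A) → APoint n M A := fun a => (β a).comp (η (φ.symm (reVec A n a)))
  have hinv : ∀ a, reVec A n a ∈ φ.target → (inv a).IsNear (φ.symm (reVec A n a)) ∧
      ∀ (f : SmoothRing n M) (i : Fin n), (∀ᶠ z in 𝓝 (φ.symm (reVec A n a)), f z = φ z i) →
        inv a f = a i := by
    intro a ha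
    obtain ⟨h1, h2⟩ := hη _ (φ.map_target ha)
    refine ⟨h1.map (β a), fun f i hf => ?_⟩
    change β a (η _ f) = a i
    rw [h2 f i hf, map_add, AlgHom.commutes, φ.right_inv ha, TruncPoly.lift_var, add_sub_cancel]
  have hval : ∀ p : APoint n M A, ∀ y ∈ φ.source, p.IsNear y → ∀ (i : Fin n) (f : SmoothRing n M),
      (∀ᶠ z in 𝓝 y, f z = φ z i) → p (x (pt p) i) = p f := by
    intro p y hy hp i f hf
    obtain rfl := (hpt p).eq hp
    refine APoint.apply_eq_of_eventuallyEq hp ?_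
    filter_upwards [hx _ hy i, hf] with z hz hz2
    rw [hz, hz2]
  have hre : ∀ p : APoint n M A, ∀ y ∈ φ.source, p.IsNear y →
      reVec A n (fun i => p (x (pt p) i)) = φ y := by
    intro p y hy hp
    ext i
    rw [reVec_apply, hval p y hy hp i (x y i) (hx y hy i), APoint.isNear_iff.mp hp,
      (hx y hy i).self_of_nhds]
  refine ⟨{ toFun := fun p i => p (x (pt p) i)
            invFun := inv
            source := {p | ∃ y ∈ φ.source, p.IsNear y}
            target := reVec A n ⁻¹' φ.target
            map_source' := ?_
            map_target' := ?_
            left_inv' := ?_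
            right_inv' := ?_ }, rfl, rfl, hval, fun f => ?_⟩
  · rintro p ⟨y, hy, hp⟩
    rw [mem_preimage, hre p y hy hp]
    exact φ.map_source hy
  · intro a ha
    exact ⟨_, φ.map_target ha, (hinv a ha).1⟩
  · rintro p ⟨y, hy, hp⟩
    have hr := hre p y hy hp
    have ht : reVec A n (fun i => p (x (pt p) i)) ∈ φ.target := by rw [hr]; exact φ.map_source hy
    obtain ⟨h1, h2⟩ := hinv _ ht
    rw [hr, φ.left_inv hy] at h1 h2
    refine APoint.eq_of_coordinates h1 hp hφ hy (hx y hy) fun i => ?_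
    rw [h2 _ i (hx y hy i)]
    exact hval p y hy hp i _ (hx y hy i)
  · intro a ha
    obtain ⟨h1, h2⟩ := hinv a ha
    funext i
    have hy := φ.map_target ha
    exact (hval _ _ hy h1 i _ (hx _ hy i)).trans (h2 _ i (hx _ hy i))
  · rw [← contMDiffOn_iff_contDiffOn]
    refine TruncPoly.contMDiffOn_apply (β := β) (r := fun a => η (φ.symm (reVec A n a)) f)
      (fun i => ?_) fun L => ?_
    · simp only [β, TruncPoly.lift_var]
      refine ContDiff.contMDiff ?_ |>.contMDiffOn
      have h1 : ContDiff ℝ ∞ fun a : Fin n → A => a i := contDiff_apply ℝ A i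
      have h2 : ContDiff ℝ ∞ fun a : Fin n → A => algebraMap ℝ A (reVec A n a i) :=
        ((algebraMapCLM ℝ A).comp ((EuclideanSpace.proj i :
          EuclideanSpace ℝ (Fin n) →L[ℝ] ℝ).comp (reVec A n))).contDiff
      exact h1.sub h2
    · refine (hηs f L).comp ?_ fun a ha => φ.map_target ha
      exact (contMDiffOn_symm_of_mem_maximalAtlas hφ).comp
        (reVec A n).contDiff.contMDiff.contMDiffOn fun a ha => ha

end

end

/-! ### The manifold of the points of type `A` -/

section

variable {n : ℕ} {M : Type v} [TopologicalSpace M] [ChartedSpace (EuclideanSpace ℝ (Fin n)) M]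
  [IsManifold (𝓡 n) ∞ M] [T2Space M] [SecondCountableTopology M]

/-- The points near an open set are recognized by the value at a bump function. -/
theorem APoint.exists_forall_weilRe_ne_zero {A : Type u} [CommRing A] [Algebra ℝ A]
    [IsWeilAlgebra A] {W : Set M} (hW : IsOpen W) {x : M} (hx : x ∈ W) :
    ∃ χ : SmoothRing n M, χ x = 1 ∧
      ∀ p : APoint n M A, weilRe A (p χ) ≠ 0 → ∃ y ∈ W, p.IsNear y := by
  obtain ⟨χ, hχ1, hχ⟩ := SmoothRing.exists_bump (n := n) hW hx
  refine ⟨χ, hχ1.self_of_nhds, fun p hp => ?_⟩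
  obtain ⟨y, hy⟩ := p.exists_isNear
  rw [APoint.isNear_iff.mp hy] at hp
  exact ⟨y, hχ (subset_tsupport _ hp), hy⟩

variable {A : Type u} [NormedCommRing A] [NormedAlgebra ℝ A] [IsWeilAlgebra A]

variable (A) in
theorem continuous_weilRe : Continuous (weilRe A) :=
  (weilRe A).toLinearMap.continuous_of_finiteDimensional

variable (n M A) in
/-- The set of the `A`-points of `M` is a manifold, for the structure determined by the
evaluations. -/
theorem exists_isWeilStructure :
    ∃ T : SmoothStructure (APoint n M A), IsEvalStructure (fun p => p) T ∧ IsWeilStructure T := by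
  choose e hes het hev hesm using fun φ : IsManifold.maximalAtlas (𝓡 n) ∞ M =>
    exists_pointChart (A := A) φ.2
  -- countably many charts cover `M`, hence the set of its points
  let c : M → IsManifold.maximalAtlas (𝓡 n) ∞ M := fun x =>
    ⟨chartAt (EuclideanSpace ℝ (Fin n)) x, IsManifold.chart_mem_maximalAtlas x⟩
  obtain ⟨s, hs, hsU⟩ := TopologicalSpace.countable_cover_nhds
    (f := fun x : M => (c x).1.source) fun x => chart_source_mem_nhds _ x
  obtain ⟨T, hT, hTd, hTe⟩ := exists_isEvalStructure (fun p : APoint n M A => p)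
    Function.injective_id e
    (fun φ => by rw [het]; exact φ.1.open_target.preimage (reVec A n).continuous)
    (hs.image c) (fun p => by
      obtain ⟨x, hx⟩ := p.exists_isNear
      obtain ⟨y, hy, hxy⟩ := mem_iUnion₂.mp (hsU.symm ▸ mem_univ x : x ∈ ⋃ x ∈ s, (c x).1.source)
      exact ⟨c y, mem_image_of_mem c hy, by rw [hes]; exact ⟨x, hxy, hx⟩⟩)
    hesm (fun φ p₀ hp₀ => by
      rw [hes] at hp₀
      obtain ⟨y₀, hy₀, hp₀⟩ := hp₀
      obtain ⟨x, hx⟩ := SmoothRing.exists_coordinates φ.2 hy₀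
      obtain ⟨V, hV, hVo, hyV⟩ := eventually_nhds_iff.mp
        ((Filter.eventually_all.mpr hx).and (φ.1.open_source.mem_nhds hy₀))
      obtain ⟨χ, hχ, hχV⟩ := APoint.exists_forall_weilRe_ne_zero (A := A) (n := n) hVo hyV
      refine ⟨n, x, ContinuousLinearMap.id ℝ _, {F | weilRe A (F χ) ≠ 0},
        isOpen_ne_fun ((continuous_weilRe A).comp (continuous_apply χ)) continuous_const, ?_,
        fun p hp => ?_⟩
      · change weilRe A (p₀ χ) ≠ 0
        rw [APoint.isNear_iff.mp hp₀, hχ]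
        exact one_ne_zero
      · obtain ⟨y, hy, hpy⟩ := hχV p hp
        refine ⟨by rw [hes]; exact ⟨y, (hV y hy).2, hpy⟩, ?_⟩
        funext i
        exact hev φ p y (hV y hy).2 hpy i (x i)
          (Filter.eventually_of_mem (hVo.mem_nhds hy) fun z hz => (hV z hz).1 i))
  refine ⟨T, hT, ⟨fun f => ?_, fun φ hφ x hx => ?_⟩⟩
  · exact (realComponents A).toContinuousLinearEquiv.contDiff.contMDiff.comp (hT.smooth_eval f)
  · -- global functions that coincide with the coordinates take at `p` the values of the chart `e`
    obtain ⟨Φ, hΦ⟩ := hTe ⟨φ, hφ⟩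
    have hsource : (e ⟨φ, hφ⟩).source = {p | ∃ y ∈ φ.source, p.IsNear y} := hes ⟨φ, hφ⟩
    have hEq : EqOn (e ⟨φ, hφ⟩) (fun p i => p (x i)) (e ⟨φ, hφ⟩).source := by
      intro p hp
      rw [hsource] at hp
      obtain ⟨y, hy, hp⟩ := hp
      funext i
      exact hev ⟨φ, hφ⟩ p y hy hp i (x i)
        (Filter.eventually_of_mem (φ.open_source.mem_nhds hy) fun z hz => hx z hz i)
    have hΦs : Φ.source = {p : T | ∃ y ∈ φ.source, (T.get p).IsNear y} := by
      rw [hΦ]; exact hsource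
    refine ⟨hΦs ▸ Φ.open_source, ?_, ?_⟩
    · have h := (e ⟨φ, hφ⟩).bijOn.congr hEq
      rw [hsource, het] at h
      convert h using 1
      ext a
      simp only [residue_eq_algebraMap_iff]
      constructor
      · rintro ⟨y, hy, ha⟩
        have : reVec A n a = φ y := by
          ext i
          exact ha i
        rw [mem_preimage, this]
        exact φ.map_source hy
      · intro ha
        refine ⟨_, φ.map_target ha, fun i => ?_⟩
        change _ = φ _ i
        rw [φ.right_inv ha]
        rfl
    · rintro ⟨p, hp⟩
      let R : (Fin n → A) ≃L[ℝ] (Fin n → Fin (Module.finrank ℝ A) → ℝ) :=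
        (LinearEquiv.piCongrRight fun _ => realComponents A).toContinuousLinearEquiv
      have hp' : p ∈ Φ.source := by rw [hΦs]; exact hp
      refine ⟨Φ.trans R.toDiffeomorph.toPartialDiffeomorph, ⟨hp', mem_univ _⟩, fun q hq => ?_⟩
      have h1 : Φ.toFun q = fun i => (T.get q) (x i) := by
        rw [hΦ]
        refine hEq ?_
        rw [← hΦ]
        exact hq.1
      change _ = R (Φ.toFun q)
      rw [h1]
      rfl

end

/-! ### The manifold of the surjective morphisms -/

section

variable {A : Type u} [NormedCommRing A] [NormedAlgebra ℝ A] [IsWeilAlgebra A] {Q : Type w}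
  [CommRing Q] [Algebra ℝ Q]

/-- Surjectivity is an open condition: if `s` is a linear section of `p`, then `q ∘ s` is invertible
for `q` near `p`. -/
theorem IsEvalStructure.isOpen_setOf_surjective {T : SmoothStructure (Q →ₐ[ℝ] A)}
    (hT : IsEvalStructure (fun p => p) T) : IsOpen {p : T | Function.Surjective (T.get p)} := by
  have : CompleteSpace A := FiniteDimensional.complete ℝ A
  rw [isOpen_iff_mem_nhds]
  intro p hp
  obtain ⟨s, hs⟩ := SurjHom.exists_compSection_eq_one ⟨T.get p, hp⟩
  have hc : Continuous fun p : T => compSection s (T.get p) := by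
    have h : ContMDiff (𝓡 T.dim) 𝓘(ℝ, A →L[ℝ] A) ∞ fun p : T => compSection s (T.get p) := by
      rw [← contMDiffOn_univ]
      exact contMDiffOn_compSection (fun x => (hT.smooth_eval x).contMDiffOn) s
    exact h.continuous
  have h1 : IsUnit (compSection s (T.get p)) := by
    rw [hs]
    exact isUnit_one
  filter_upwards [hc.continuousAt.preimage_mem_nhds (Units.isOpen.mem_nhds h1)] with q hq a
  obtain ⟨v, hv : ↑v = compSection s (T.get q)⟩ := hq
  have h2 : compSection s (T.get q) * ↑v⁻¹ = 1 := by
    rw [← hv, Units.mul_inv]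
  exact ⟨_, congrArg (fun F : A →L[ℝ] A => F a) h2⟩

/-- The surjective morphisms are an open submanifold of the morphisms. -/
theorem IsEvalStructure.exists_surjHom {T : SmoothStructure (Q →ₐ[ℝ] A)}
    (hT : IsEvalStructure (fun p => p) T) : ∃ S : SmoothStructure (SurjHom Q A),
      IsDiffeoOnto (𝓡 S.dim) (𝓡 T.dim) (fun p : S => T.of (S.get p).1)
        {p : T | Function.Surjective (T.get p)} ∧ IsEvalStructure (fun p => p.1) S := by
  let O : TopologicalSpace.Opens T := ⟨_, hT.isOpen_setOf_surjective⟩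
  let S : SmoothStructure (SurjHom Q A) := SmoothStructure.ofManifold T.dim O
  have h0 := isDiffeoOnto_subtype_val (k := T.dim) O
  have h : IsDiffeoOnto (𝓡 S.dim) (𝓡 T.dim) (fun p : S => T.of (S.get p).1)
      {p : T | Function.Surjective (T.get p)} := h0
  exact ⟨S, h, hT.of_isDiffeoOnto h⟩

/-- The action of `Aut A` by composition is smooth, as its evaluations are. -/
theorem IsEvalStructure.contMDiff_act {L : SmoothStructure (A ≃ₐ[ℝ] A)}
    (hL : IsMatrixLieGroup (MonoidHom.id (A ≃ₐ[ℝ] A)) L) {P : SmoothStructure (SurjHom Q A)}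
    (hP : IsEvalStructure (fun p => p.1) P) :
    ContMDiff ((𝓡 L.dim).prod (𝓡 P.dim)) (𝓡 P.dim) ∞
      (fun q : L × P => P.of (SurjHom.act (L.get q.1) (P.get q.2))) := by
  refine hP.contMDiff fun f => ?_
  exact (hL.contMDiff_autCLM.comp contMDiff_fst).clm_apply ((hP.smooth_eval f).comp contMDiff_snd)

/-- The morphisms from the truncated polynomials are a manifold, whose coordinates are the values at
the variables. -/
theorem TruncPoly.exists_isEvalStructure (n : ℕ) {l : ℕ}
    (hl : IsLocalRing.maximalIdeal A ^ (l + 1) = ⊥) :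
    ∃ T : SmoothStructure (TruncPoly n l →ₐ[ℝ] A), IsEvalStructure (fun p => p) T := by
  let 𝔪 : Submodule ℝ A := (IsLocalRing.maximalIdeal A).restrictScalars ℝ
  obtain ⟨r, hr⟩ := Submodule.ClosedComplemented.of_finiteDimensional 𝔪
  let e : PartialEquiv (TruncPoly n l →ₐ[ℝ] A) (Fin n → 𝔪) :=
    { toFun := fun β i => ⟨β (var n l i), map_mem_maximalIdeal β (var_mem i)⟩
      invFun := fun a => lift hl (fun i => a i) fun i => (a i).2
      source := univ
      target := univ
      map_source' := fun _ _ => mem_univ _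
      map_target' := fun _ _ => mem_univ _
      left_inv' := fun β _ => algHom_ext fun i => lift_var _ _ _ i
      right_inv' := fun a _ => funext fun i => Subtype.ext (lift_var _ _ _ i) }
  obtain ⟨T, hT, -⟩ := _root_.exists_isEvalStructure (fun p : TruncPoly n l →ₐ[ℝ] A => p)
    Function.injective_id (fun _ : Unit => e) (fun _ => isOpen_univ) (countable_singleton ())
    (fun x => ⟨(), rfl, mem_univ _⟩) (fun _ f => by
      rw [← contMDiffOn_iff_contDiffOn]
      refine contMDiffOn_apply (β := fun a => e.symm a) (r := fun _ => f) (fun i => ?_)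
        fun _ => contMDiffOn_const
      have h : ContDiff ℝ ∞ fun a : Fin n → 𝔪 => (a i : A) :=
        𝔪.subtypeL.contDiff.comp (contDiff_apply ℝ 𝔪 i)
      exact h.contMDiff.contMDiffOn.congr fun a _ => lift_var hl (fun i => (a i : A))
        (fun i => (a i).2) i)
    (fun _ β _ => ⟨n, var n l, ContinuousLinearMap.pi fun i => r.comp (ContinuousLinearMap.proj i),
      univ, isOpen_univ, mem_univ _, fun β _ => ⟨mem_univ _, funext fun i =>
        (hr ⟨β (var n l i), map_mem_maximalIdeal β (var_mem i)⟩).symm⟩⟩)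
  exact ⟨T, hT⟩

end

/-! ### Transport of smooth structures -/

section

variable {E E' H H' N N' : Type*} [NormedAddCommGroup E] [NormedSpace ℝ E]
  [NormedAddCommGroup E'] [NormedSpace ℝ E'] [TopologicalSpace H] [TopologicalSpace H']
  {I : ModelWithCorners ℝ E H} {I' : ModelWithCorners ℝ E' H'}
  [TopologicalSpace N] [ChartedSpace H N] [TopologicalSpace N'] [ChartedSpace H' N']

/-- Smoothness of a map can be checked after a diffeomorphism onto an open set. -/
theorem IsDiffeoOnto.contMDiffOn_of_comp {f : N → N'} {V : Set N'} (hf : IsDiffeoOnto I I' f V)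
    {E'' H'' Z : Type*} [NormedAddCommGroup E''] [NormedSpace ℝ E''] [TopologicalSpace H'']
    {J : ModelWithCorners ℝ E'' H''} [TopologicalSpace Z] [ChartedSpace H'' Z] {g : Z → N}
    {s : Set Z} (h : ContMDiffOn J I' ∞ (fun z => f (g z)) s) : ContMDiffOn J I ∞ g s := by
  intro z hz
  obtain ⟨W, σ, hW, hzW, hσ, -, hfσ⟩ := hf.hasLocalSections (g z)
  have h1 : ∀ᶠ z' in 𝓝[s] z, f (g z') ∈ W :=
    (h.continuousOn z hz).eventually_mem (hW.mem_nhds hzW)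
  have h2 : ContMDiffWithinAt J I ∞ (fun z' => σ (f (g z'))) s z :=
    (hσ.contMDiffAt (hW.mem_nhds hzW)).comp_contMDiffWithinAt z (h z hz)
  refine h2.congr_of_eventuallyEq ?_ (hf.2.1 (hfσ _ hzW)).symm
  filter_upwards [h1] with z' hz'
  exact (hf.2.1 (hfσ _ hz')).symm

end

/-- A smooth structure is transported by a bijection. -/
theorem SmoothStructure.exists_equiv {X : Type u} {Y : Type v} (S : SmoothStructure X)
    (ε : Y ≃ X) : ∃ S' : SmoothStructure Y, S'.IsSmooth S ε ∧ S.IsSmooth S' ε.symm := by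
  let t : TopologicalSpace Y := TopologicalSpace.induced (fun y => S.of (ε y)) inferInstance
  let h : Y ≃ₜ S := Equiv.toHomeomorphOfIsInducing (show Y ≃ S from ε) ⟨rfl⟩
  have : T2Space Y := h.symm.t2Space
  have : SecondCountableTopology Y := h.secondCountableTopology
  let e : S → OpenPartialHomeomorph Y (EuclideanSpace ℝ (Fin S.dim)) := fun x =>
    h.transOpenPartialHomeomorph (chartAt _ x)
  obtain ⟨S', -, hd, hS'⟩ := exists_smoothStructure e (fun y => ⟨h y, mem_chart_source _ (h y)⟩) (by
    intro i j
    rw [← contMDiffOn_iff_contDiffOn]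
    have h1 : ContMDiffOn (𝓡 S.dim) (𝓡 S.dim) ∞ (fun z : EuclideanSpace ℝ (Fin S.dim) =>
        chartAt (EuclideanSpace ℝ (Fin S.dim)) j
          ((chartAt (EuclideanSpace ℝ (Fin S.dim)) i).symm z))
        ((chartAt (EuclideanSpace ℝ (Fin S.dim)) i).target ∩
          (chartAt (EuclideanSpace ℝ (Fin S.dim)) i).symm ⁻¹'
            (chartAt (EuclideanSpace ℝ (Fin S.dim)) j).source) :=
      contMDiffOn_chart.comp (contMDiffOn_chart_symm.mono inter_subset_left) fun z hz => hz.2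
    have h2 : ∀ z, h ((e i).symm z) = (chartAt (EuclideanSpace ℝ (Fin S.dim)) i).symm z := fun z =>
      h.apply_symm_apply _
    refine (h1.mono fun z hz => ⟨hz.1, ?_⟩).congr fun z _ => ?_
    · rw [mem_preimage, ← h2 z]
      exact hz.2
    · rw [← h2 z]
      rfl)
  refine ⟨S', fun y => ?_, fun x => ?_⟩
  · obtain ⟨Φ, hΦ⟩ := hS' (h (S'.get y))
    have hy : y ∈ Φ.source := by rw [hΦ]; exact mem_chart_source _ (h (S'.get y))
    have h1 : ContMDiffOn (𝓡 S'.dim) (𝓡 S.dim) ∞ (fun y' : S' =>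
        (chartAt (EuclideanSpace ℝ (Fin S.dim)) (h (S'.get y))).symm (Φ y')) Φ.source := by
      refine (contMDiffOn_chart_symm (I := 𝓡 S.dim) (x := h (S'.get y))).comp Φ.contMDiffOn
        fun y' hy' => ?_
      have := Φ.map_source hy'
      rw [hΦ] at this
      have h4 : Φ.toFun = e (h (S'.get y)) := by rw [hΦ]; rfl
      have h5 : Φ.toFun y' ∈ (chartAt (EuclideanSpace ℝ (Fin S.dim)) (h (S'.get y))).target := by
        rw [h4]
        exact this
      exact h5
    refine ((h1.congr fun y' hy' => ?_) y hy).contMDiffAt (Φ.open_source.mem_nhds hy)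
    have h4 : Φ.toFun = e (h (S'.get y)) := by rw [hΦ]; rfl
    rw [hΦ] at hy'
    change _ = (chartAt (EuclideanSpace ℝ (Fin S.dim)) (h (S'.get y))).symm (Φ.toFun y')
    rw [h4]
    exact ((chartAt (EuclideanSpace ℝ (Fin S.dim)) (h (S'.get y))).left_inv hy').symm
  · obtain ⟨Φ, hΦ⟩ := hS' x
    have hx : x ∈ (chartAt (EuclideanSpace ℝ (Fin S.dim)) x).source := mem_chart_source _ x
    have h4 : Φ.invFun = (e x).symm := by rw [hΦ]; rfl
    have h1 : ContMDiffOn (𝓡 S.dim) (𝓡 S'.dim) ∞ (fun x' : S =>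
        Φ.invFun (chartAt (EuclideanSpace ℝ (Fin S.dim)) x x'))
        (chartAt (EuclideanSpace ℝ (Fin S.dim)) x).source := by
      refine Φ.contMDiffOn_invFun.comp (contMDiffOn_chart (I := 𝓡 S.dim) (x := x)) fun x' hx' => ?_
      rw [hΦ]
      exact (chartAt (EuclideanSpace ℝ (Fin S.dim)) x).map_source hx'
    refine ((h1.congr fun x' hx' => ?_) x hx).contMDiffAt
      ((chartAt (EuclideanSpace ℝ (Fin S.dim)) x).open_source.mem_nhds hx)
    rw [h4]
    change h.symm x' = h.symm ((chartAt (EuclideanSpace ℝ (Fin S.dim)) x).symm _)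
    rw [OpenPartialHomeomorph.left_inv _ hx']

/-! ### The fibres of the map to the jets -/

section

variable {Q : Type w} {A : Type u} [CommRing Q] [Algebra ℝ Q] [CommRing A] [Algebra ℝ A]

/-- Two surjective morphisms with the same kernel `I` differ by the automorphism
`A ≃ Q / I ≃ A`. -/
theorem SurjHom.ker_eq_iff {p q : SurjHom Q A} :
    RingHom.ker p.1 = RingHom.ker q.1 ↔ ∃ g : A ≃ₐ[ℝ] A, SurjHom.act g p = q := by
  constructor
  · intro h
    let a := Ideal.quotientKerAlgEquivOfSurjective p.2
    let b := Ideal.quotientKerAlgEquivOfSurjective q.2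
    refine ⟨(a.symm.trans (Ideal.quotientEquivAlgOfEq ℝ h)).trans b, Subtype.ext ?_⟩
    ext f
    change b (Ideal.quotientEquivAlgOfEq ℝ h (a.symm (p.1 f))) = q.1 f
    have h1 : a.symm (p.1 f) = Ideal.Quotient.mk _ f := by
      rw [AlgEquiv.symm_apply_eq]
      rfl
    rw [h1]
    rfl
  · rintro ⟨g, rfl⟩
    ext f
    rw [RingHom.mem_ker, RingHom.mem_ker]
    exact (map_eq_zero_iff g g.injective).symm

variable {n : ℕ} {M : Type v} [TopologicalSpace M] [ChartedSpace (EuclideanSpace ℝ (Fin n)) M]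

theorem RegularPoint.ker_eq_iff {p q : RegularPoint n M A} :
    p.ker = q.ker ↔ ∃ g : A ≃ₐ[ℝ] A, SurjHom.act g p = q := by
  rw [← SurjHom.ker_eq_iff]
  exact Subtype.ext_iff

theorem RegularPoint.ker_surjective :
    Function.Surjective (RegularPoint.ker : RegularPoint n M A → Jet n M A) := by
  rintro ⟨I, ⟨e⟩⟩
  have he : Function.Surjective
      ((e : (SmoothRing n M ⧸ I) →ₐ[ℝ] A).comp (Ideal.Quotient.mkₐ ℝ I)) :=
    fun a => by
      obtain ⟨f, hf⟩ := Ideal.Quotient.mk_surjective (e.symm a)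
      exact ⟨f, (congrArg e hf).trans (e.apply_symm_apply a)⟩
  refine ⟨⟨_, he⟩, Subtype.ext ?_⟩
  ext f
  change e (Ideal.Quotient.mk I f) = 0 ↔ f ∈ I
  rw [map_eq_zero_iff e e.injective, Ideal.Quotient.eq_zero_iff_mem]

/-- A point and its kernel are near the same `x`. If `p` is near `x'`, its kernel contains a power
of `f - f(x')` for each `f`; if all the functions of the kernel vanish at `x`, then
`f(x) = f(x')`. -/
theorem RegularPoint.isNear_ker_iff [IsWeilAlgebra A] [IsManifold (𝓡 n) ∞ M] [T2Space M]
    [SecondCountableTopology M] {p : RegularPoint n M A} {x : M} :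
    p.ker.IsNear x ↔ p.IsNear x := by
  constructor
  · intro h
    obtain ⟨x', hx'⟩ := APoint.exists_isNear p.1
    have hxx : x = x' := by
      refine SmoothRing.eq_of_forall_apply_eq (n := n) fun f => ?_
      have h1 : (p.1 (f - algebraMap ℝ _ (f x'))) ^ (weilOrder A + 1) = 0 := by
        have h2 : p.1 (f - algebraMap ℝ _ (f x')) ∈ IsLocalRing.maximalIdeal A := by
          rw [mem_maximalIdeal_iff_weilRe, APoint.isNear_iff.mp hx']
          exact sub_self (f x')
        have h3 := Ideal.pow_mem_pow h2 (weilOrder A + 1)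
        rwa [maximalIdeal_pow_weilOrder, Ideal.mem_bot] at h3
      rw [← map_pow] at h1
      have h2 : SmoothRing.eval x ((f - algebraMap ℝ _ (f x')) ^ (weilOrder A + 1)) = 0 := h _ h1
      rw [map_pow] at h2
      have h3 := eq_zero_of_pow_eq_zero h2
      rw [map_sub, AlgHom.commutes, sub_eq_zero] at h3
      exact h3
    rw [hxx]
    exact hx'
  · intro h f hf
    rw [← APoint.isNear_iff.mp h f]
    rw [show p.1 f = 0 from hf, map_zero]

end

/-! ### The principal bundle -/

section

variable {A : Type u} [NormedCommRing A] [NormedAlgebra ℝ A] [IsWeilAlgebra A] {Q : Type w}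
  [CommRing Q] [Algebra ℝ Q]

/-- The automorphism that relates two smooth families of surjective morphisms is smooth: if `t` is a
linear section of one of the morphisms `p`, it is locally `(q ∘ t) ∘ (p ∘ t)⁻¹`. -/
theorem IsMatrixLieGroup.contMDiffOn_of_act {L : SmoothStructure (A ≃ₐ[ℝ] A)}
    (hL : IsMatrixLieGroup (MonoidHom.id (A ≃ₐ[ℝ] A)) L) {E H Z : Type*} [NormedAddCommGroup E]
    [NormedSpace ℝ E] [TopologicalSpace H] {I : ModelWithCorners ℝ E H} [TopologicalSpace Z]
    [ChartedSpace H Z] {s : Set Z} (hs : IsOpen s) {p q : Z → SurjHom Q A} {g : Z → L}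
    (hp : ∀ f, ContMDiffOn I 𝓘(ℝ, A) ∞ (fun z => (p z).1 f) s)
    (hq : ∀ f, ContMDiffOn I 𝓘(ℝ, A) ∞ (fun z => (q z).1 f) s)
    (hg : ∀ z ∈ s, SurjHom.act (L.get (g z)) (p z) = q z) : ContMDiffOn I (𝓡 L.dim) ∞ g s := by
  have : CompleteSpace A := FiniteDimensional.complete ℝ A
  intro z₀ hz₀
  obtain ⟨t, ht⟩ := (p z₀).exists_compSection_eq_one
  have h1 := contMDiffOn_compSection hp t
  have h2 := contMDiffOn_compSection hq t
  let O : Set Z := s ∩ (fun z => compSection t (p z).1) ⁻¹' {u | IsUnit u}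
  have hO : IsOpen O := h1.continuousOn.isOpen_inter_preimage hs Units.isOpen
  have hz₀O : z₀ ∈ O := ⟨hz₀, by
    change IsUnit (compSection t (p z₀).1)
    rw [ht]
    exact isUnit_one⟩
  have h3 : ContMDiffOn I 𝓘(ℝ, A →L[ℝ] A) ∞
      (fun z => compSection t (q z).1 * Ring.inverse (compSection t (p z).1)) O := by
    have h4 : ContMDiffOn I 𝓘(ℝ, A →L[ℝ] A) ∞
        (fun z => Ring.inverse (compSection t (p z).1)) O := by
      intro z hz
      obtain ⟨v, hv : ↑v = compSection t (p z).1⟩ := hz.2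
      have h5 : ContDiffAt ℝ ∞ Ring.inverse (compSection t (p z).1) := by
        rw [← hv]
        exact contDiffAt_ringInverse ℝ v
      exact h5.contMDiffAt.comp_contMDiffWithinAt z ((h1 z hz.1).mono inter_subset_left)
    have h6 : ContDiff ℝ ∞ fun u : (A →L[ℝ] A) × (A →L[ℝ] A) => u.1 * u.2 :=
      contDiff_fst.mul contDiff_snd
    exact h6.contMDiff.comp_contMDiffOn ((h2.mono inter_subset_left).prodMk_space h4)
  have h7 : ContMDiffOn I (𝓡 L.dim) ∞ g O := by
    refine hL.contMDiffOn_of_autCLM hO (h3.congr fun z hz => ?_)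
    obtain ⟨v, hv : ↑v = compSection t (p z).1⟩ := hz.2
    rw [← hg z hz.1, compSection_act, ← hv, Ring.inverse_unit, mul_assoc, Units.mul_inv, mul_one]
    rfl
  exact ((h7 z₀ hz₀O).contMDiffAt (hO.mem_nhds hz₀O)).contMDiffWithinAt

variable {n : ℕ} {M : Type v} [TopologicalSpace M] [ChartedSpace (EuclideanSpace ℝ (Fin n)) M]

/-- A local section `s` of the map to the jets gives the trivialization `(x, g) ↦ g ∘ s x`, whose
inverse is smooth because the automorphism that relates two morphisms depends smoothly on them. -/
theorem isPrincipalBundle_ker {L : SmoothStructure (A ≃ₐ[ℝ] A)}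
    (hL : IsMatrixLieGroup (MonoidHom.id (A ≃ₐ[ℝ] A)) L) {S : SmoothStructure (RegularPoint n M A)}
    (hS : IsEvalStructure (fun p => p.1) S) {J : SmoothStructure (Jet n M A)}
    (hker : S.IsSmooth J RegularPoint.ker)
    (hsec : HasLocalSections (𝓡 S.dim) (𝓡 J.dim) (fun p : S => J.of (S.get p).ker)) :
    IsPrincipalBundle L S J RegularPoint.ker := by
  have hact := IsEvalStructure.contMDiff_act hL hS
  have hsmul : ∀ (g : A ≃ₐ[ℝ] A) (p : RegularPoint n M A), (g • p).ker = p.ker := fun g p =>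
    (RegularPoint.ker_eq_iff.mpr ⟨g, rfl⟩).symm
  refine ⟨hL.lieGroup, hact, hker, hsmul, fun b => ?_⟩
  obtain ⟨p₀, hp₀⟩ := RegularPoint.ker_surjective b
  obtain ⟨W, s, hW, hbW, hs, -, hks⟩ := hsec (S.of p₀)
  let W' : TopologicalSpace.Opens J := ⟨W, hW⟩
  let Ψ : W' × L → S := fun z => S.of (SurjHom.act (L.get z.2) (S.get (s z.1)))
  have hΨk : ∀ z, (S.get (Ψ z)).ker = J.get z.1 := fun z => (hsmul _ _).trans (hks z.1 z.1.2)
  have hsW : ContMDiff (𝓡 J.dim) (𝓡 S.dim) ∞ fun x : W' => s x :=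
    hs.comp_contMDiff contMDiff_subtype_val fun x => x.2
  have hinj : Function.Injective Ψ := by
    rintro ⟨x, g⟩ ⟨x', g'⟩ h
    have h1 : x = x' := by
      refine Subtype.ext ?_
      have := (hΨk (x, g)).symm.trans ((congrArg (fun p => (S.get p).ker) h).trans (hΨk (x', g')))
      exact this
    subst h1
    have h2 : L.get g = L.get g' := by
      ext a
      obtain ⟨f, rfl⟩ := (S.get (s x)).2 a
      exact congrArg (fun p : RegularPoint n M A => p.1 f) h
    exact Prod.ext rfl h2
  have hrange : range Ψ = {p | J.of (S.get p).ker ∈ W'} := by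
    ext p
    constructor
    · rintro ⟨z, rfl⟩
      exact (congrArg (· ∈ W') (hΨk z)).mpr z.1.2
    · intro hp
      obtain ⟨g, hg⟩ := RegularPoint.ker_eq_iff.mp
        (show (S.get (s (J.of (S.get p).ker))).ker = (S.get p).ker from hks _ hp)
      exact ⟨(⟨_, hp⟩, L.of g), hg⟩
  refine ⟨W', Ψ, by rw [← hp₀]; exact hbW, isDiffeoOnto_of_hasLocalSections ?_ hinj hrange ?_,
    fun x g => hΨk (x, L.of g), fun x h g => mul_smul h g (S.get (s x))⟩
  · exact hact.comp (contMDiff_snd.prodMk (hsW.comp contMDiff_fst))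
  · intro z₀
    have : Nonempty (W' × L) := ⟨z₀⟩
    have hV : IsOpen {p : S | J.of (S.get p).ker ∈ W'} := hW.preimage hker.continuous
    have hΨinv : ∀ p : S, J.of (S.get p).ker ∈ W' → Ψ (Function.invFun Ψ p) = p := fun p hp =>
      Function.invFun_eq (by
        have : p ∈ range Ψ := by rw [hrange]; exact hp
        exact this)
    have hfst : ∀ p : S, J.of (S.get p).ker ∈ W' →
        ((Function.invFun Ψ p).1 : J) = J.of (S.get p).ker := fun p hp => by
      have h1 := hΨk (Function.invFun Ψ p)
      rw [hΨinv p hp] at h1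
      exact h1.symm
    refine ⟨{p : S | J.of (S.get p).ker ∈ W'}, Function.invFun Ψ, hV,
      (congrArg (· ∈ W') (hΨk z₀)).mpr z₀.1.2, ?_, Function.leftInverse_invFun hinj z₀, hΨinv⟩
    have h1 : ContMDiffOn (𝓡 S.dim) (𝓡 J.dim) ∞ (fun p => (Function.invFun Ψ p).1)
        {p : S | J.of (S.get p).ker ∈ W'} := by
      refine (isDiffeoOnto_subtype_val W').contMDiffOn_of_comp ?_
      exact hker.contMDiffOn.congr hfst
    refine h1.prodMk (hL.contMDiffOn_of_act hV (p := fun p => S.get (s (Function.invFun Ψ p).1))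
      (q := fun p => S.get p) (fun f => ?_) (fun f => (hS.smooth_eval f).contMDiffOn) hΨinv)
    exact ((hS.smooth_eval f).comp hsW).comp_contMDiffOn h1

end

/-! ### The coordinate sections -/

section

variable {n l : ℕ} {M : Type v} [TopologicalSpace M] [ChartedSpace (EuclideanSpace ℝ (Fin n)) M]

theorem TruncPoly.surjective_of_var_mem_range {Q : Type w} [CommRing Q] [Algebra ℝ Q]
    (p : Q →ₐ[ℝ] TruncPoly n l) (h : ∀ i, ∃ f, p f = var n l i) : Function.Surjective p := by
  choose f hf using h
  intro r
  obtain ⟨P, rfl⟩ := Ideal.Quotient.mk_surjective r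
  refine ⟨MvPolynomial.aeval f P, ?_⟩
  have h1 := apply_mk (AlgHom.id ℝ (TruncPoly n l)) P
  rw [AlgHom.id_apply] at h1
  rw [h1, ← AlgHom.comp_apply, MvPolynomial.comp_aeval]
  simp only [hf, AlgHom.id_apply]

variable [IsManifold (𝓡 n) ∞ M] [T2Space M]

/-- The coordinate section exists and depends smoothly on the point. -/
theorem exists_isCoordinateSection (l : ℕ) {φ : OpenPartialHomeomorph M (EuclideanSpace ℝ (Fin n))}
    (hφ : φ ∈ IsManifold.maximalAtlas (𝓡 n) ∞ M) :
    ∃ ξ : chartDomain φ → RegularPoint n M (TruncPoly n l), IsCoordinateSection φ ξ ∧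
      ∀ f (L : TruncPoly n l →ₗ[ℝ] ℝ), ContMDiff (𝓡 n) 𝓘(ℝ, ℝ) ∞ (fun y => L ((ξ y).1 f)) := by
  obtain ⟨η, hηs, hη⟩ := TruncPoly.exists_coordinate_points l hφ
  have hsurj : ∀ y : chartDomain φ, Function.Surjective (η y) := by
    intro y
    obtain ⟨x, hx⟩ := SmoothRing.exists_coordinates hφ y.2
    refine TruncPoly.surjective_of_var_mem_range _ fun i => ⟨x i - algebraMap ℝ _ (φ y i), ?_⟩
    rw [map_sub, AlgHom.commutes, (hη y y.2).2 _ i (hx i), add_sub_cancel_left]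
  exact ⟨fun y => ⟨η y, hsurj y⟩, ⟨fun y => (hη y y.2).1, fun y i f hf => (hη y y.2).2 f i hf⟩,
    fun f L => (hηs f L).comp_contMDiff contMDiff_subtype_val fun y => y.2⟩

/-- The coordinate section is unique. -/
theorem IsCoordinateSection.eq {φ : OpenPartialHomeomorph M (EuclideanSpace ℝ (Fin n))}
    (hφ : φ ∈ IsManifold.maximalAtlas (𝓡 n) ∞ M)
    {ξ ξ' : chartDomain φ → RegularPoint n M (TruncPoly n l)} (hξ : IsCoordinateSection φ ξ)
    (hξ' : IsCoordinateSection φ ξ') : ξ' = ξ := by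
  funext y
  obtain ⟨x, hx⟩ := SmoothRing.exists_coordinates hφ y.2
  refine Subtype.ext (APoint.eq_of_coordinates (hξ'.near y) (hξ.near y) hφ y.2 hx fun i => ?_)
  rw [hξ.coordinate y i _ (hx i), hξ'.coordinate y i _ (hx i)]

variable [SecondCountableTopology M] {A : Type u} [NormedCommRing A] [NormedAlgebra ℝ A]
  [IsWeilAlgebra A]

/-- Over a coordinate open set the regular points are the images of the points of the coordinate
section by the surjective morphisms from the truncated polynomials. The inverse map reads the point
of `M` in the real parts of the coordinates, and the morphism in their nilpotent parts. -/
theorem IsCoordinateSection.isIsoOver (hl : IsLocalRing.maximalIdeal A ^ (l + 1) = ⊥)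
    {φ : OpenPartialHomeomorph M (EuclideanSpace ℝ (Fin n))}
    (hφ : φ ∈ IsManifold.maximalAtlas (𝓡 n) ∞ M)
    {ξ : chartDomain φ → RegularPoint n M (TruncPoly n l)} (hξ : IsCoordinateSection φ ξ)
    (hξs : ∀ f (L : TruncPoly n l →ₗ[ℝ] ℝ), ContMDiff (𝓡 n) 𝓘(ℝ, ℝ) ∞ (fun y => L ((ξ y).1 f)))
    {E : SmoothStructure (SurjHom (TruncPoly n l) A)} (hE : IsEvalStructure (fun p => p.1) E)
    {S : SmoothStructure (RegularPoint n M A)} (hS : IsEvalStructure (fun p => p.1) S) :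
    IsIsoOver n (chartDomain φ) E S RegularPoint.IsNear (fun y β => (ξ y).map β.1 β.2) := by
  let Ψ : chartDomain φ × E → S := fun z => S.of ((ξ z.1).map (E.get z.2).1 (E.get z.2).2)
  have hnear : ∀ z, (S.get (Ψ z)).IsNear (z.1 : M) := fun z => (hξ.near z.1).map (E.get z.2).1
  refine ⟨?_, fun y c => hnear (y, E.of c)⟩
  have hinj : Function.Injective Ψ := by
    rintro ⟨y, β⟩ ⟨y', β'⟩ h
    have hy : y = y' := Subtype.ext ((hnear (y, β)).eq (h ▸ hnear (y', β')))
    subst hy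
    refine Prod.ext rfl (Subtype.ext (AlgHom.ext fun r => ?_))
    obtain ⟨f, rfl⟩ := (ξ y).2 r
    exact congrArg (fun p : RegularPoint n M A => p.1 f) h
  have hcoord : ∀ (z : chartDomain φ × E) (f : SmoothRing n M) (i : Fin n),
      (∀ᶠ w in 𝓝 (z.1 : M), f w = φ w i) →
        (S.get (Ψ z)).1 f = algebraMap ℝ A (φ z.1 i) + (E.get z.2).1 (TruncPoly.var n l i) := by
    intro z f i hf
    change (E.get z.2).1 ((ξ z.1).1 f) = _
    rw [hξ.coordinate z.1 i f hf, map_add, AlgHom.commutes]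
  have hrange : range Ψ = {p | ∃ y ∈ chartDomain φ, (S.get p).IsNear y} := by
    ext p
    constructor
    · rintro ⟨z, rfl⟩
      exact ⟨z.1, z.1.2, hnear z⟩
    · rintro ⟨y, hy, hp⟩
      obtain ⟨x, hx⟩ := SmoothRing.exists_coordinates hφ hy
      -- the morphism that sends the variables to the nilpotent parts of the coordinates of `p`
      let β := TruncPoly.lift hl (fun i => (S.get p).1 (x i) - algebraMap ℝ A (φ y i)) fun i => by
        rw [mem_maximalIdeal_iff_weilRe, map_sub, weilRe_algebraMap, APoint.isNear_iff.mp hp,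
          (hx i).self_of_nhds, sub_self]
      have h1 : β.comp (ξ ⟨y, hy⟩).1 = (S.get p).1 := by
        refine APoint.eq_of_coordinates ((hξ.near ⟨y, hy⟩).map β) hp hφ hy hx fun i => ?_
        rw [AlgHom.comp_apply, hξ.coordinate ⟨y, hy⟩ i _ (hx i), map_add, AlgHom.commutes,
          TruncPoly.lift_var, add_sub_cancel]
      have h2 : Function.Surjective β := by
        intro a
        obtain ⟨f, hf⟩ := (S.get p).2 a
        exact ⟨(ξ ⟨y, hy⟩).1 f, by rw [← hf, ← h1]; rfl⟩
      exact ⟨(⟨y, hy⟩, E.of ⟨β, h2⟩), Subtype.ext h1⟩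
  refine isDiffeoOnto_of_hasLocalSections ?_ hinj hrange ?_
  · refine hS.contMDiff fun f => ?_
    rw [← contMDiffOn_univ]
    exact TruncPoly.contMDiffOn_apply (β := fun z : chartDomain φ × E => (E.get z.2).1)
      (r := fun z => (ξ z.1).1 f)
      (fun i => ((hE.smooth_eval _).comp contMDiff_snd).contMDiffOn)
      fun L => ((hξs f L).comp contMDiff_fst).contMDiffOn
  · intro z₀
    have : Nonempty (chartDomain φ × E) := ⟨z₀⟩
    obtain ⟨x, hx⟩ := SmoothRing.exists_coordinates hφ z₀.1.2
    obtain ⟨V, hV, hVo, hyV⟩ := eventually_nhds_iff.mp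
      ((Filter.eventually_all.mpr hx).and (φ.open_source.mem_nhds z₀.1.2))
    obtain ⟨χ, hχ, hχV⟩ := APoint.exists_forall_weilRe_ne_zero (A := A) (n := n) hVo hyV
    -- on `W` the points are near `V`, where the global functions `x i` are the coordinates
    let W : Set S := {p | weilRe A ((S.get p).1 χ) ≠ 0}
    have hW : IsOpen W := isOpen_ne_fun
      ((continuous_weilRe A).comp (hS.smooth_eval χ).continuous) continuous_const
    have hz₀W : Ψ z₀ ∈ W := by
      change weilRe A ((S.get (Ψ z₀)).1 χ) ≠ 0
      rw [APoint.isNear_iff.mp (hnear z₀), hχ]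
      exact one_ne_zero
    have hinv : ∀ p ∈ W, Ψ (Function.invFun Ψ p) = p := fun p hp => Function.invFun_eq (by
      obtain ⟨y, hy, hpy⟩ := hχV _ hp
      have : p ∈ range Ψ := by rw [hrange]; exact ⟨y, (hV y hy).2, hpy⟩
      exact this)
    have hWV : ∀ p ∈ W, ((Function.invFun Ψ p).1 : M) ∈ V := by
      intro p hp
      obtain ⟨y, hy, hpy⟩ := hχV _ hp
      have h1 := hnear (Function.invFun Ψ p)
      rw [hinv p hp] at h1
      rwa [h1.eq hpy]
    have hxi : ∀ p ∈ W, ∀ i, (S.get p).1 (x i) = algebraMap ℝ A (φ (Function.invFun Ψ p).1 i) +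
        (E.get (Function.invFun Ψ p).2).1 (TruncPoly.var n l i) := by
      intro p hp i
      have h1 := hcoord (Function.invFun Ψ p) (x i) i
        (Filter.eventually_of_mem (hVo.mem_nhds (hWV p hp)) fun z hz => (hV z hz).1 i)
      rwa [hinv p hp] at h1
    have hxs : ContMDiff (𝓡 S.dim) 𝓘(ℝ, Fin n → A) ∞ fun p : S => fun i => (S.get p).1 (x i) :=
      contMDiff_pi_space.mpr fun i => hS.smooth_eval _
    have hre : ContMDiff (𝓡 S.dim) (𝓡 n) ∞ fun p : S => reVec A n fun i => (S.get p).1 (x i) :=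
      (reVec A n).contDiff.contMDiff.comp hxs
    have hφp : ∀ p ∈ W, reVec A n (fun i => (S.get p).1 (x i)) = φ (Function.invFun Ψ p).1 := by
      intro p hp
      ext i
      rw [reVec_apply, hxi p hp i, map_add, weilRe_algebraMap,
        mem_maximalIdeal_iff_weilRe.mp (map_mem_maximalIdeal _ (TruncPoly.var_mem i)), add_zero]
    refine ⟨W, Function.invFun Ψ, hW, hz₀W, ContMDiffOn.prodMk ?_ ?_,
      Function.leftInverse_invFun hinj z₀, hinv⟩
    · refine (isDiffeoOnto_subtype_val (chartDomain φ)).contMDiffOn_of_comp ?_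
      refine ((contMDiffOn_symm_of_mem_maximalAtlas hφ).comp hre.contMDiffOn fun p hp => ?_).congr
        fun p hp => ?_
      · rw [mem_preimage, hφp p hp]
        exact φ.map_source (Function.invFun Ψ p).1.2
      · rw [Function.comp_apply, hφp p hp]
        exact (φ.left_inv (Function.invFun Ψ p).1.2).symm
    · refine hE.contMDiffOn hW fun q => ?_
      refine TruncPoly.contMDiffOn_apply (β := fun p => (E.get (Function.invFun Ψ p).2).1)
        (r := fun _ => q) (fun i => ?_) fun L => contMDiffOn_const
      have h1 : ContMDiff (𝓡 S.dim) 𝓘(ℝ, A) ∞ fun p : S => (S.get p).1 (x i) -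
          algebraMap ℝ A (reVec A n (fun i => (S.get p).1 (x i)) i) := by
        have h2 : ContDiff ℝ ∞ fun a : Fin n → A => a i - algebraMap ℝ A (reVec A n a i) :=
          (contDiff_apply ℝ A i).sub ((algebraMapCLM ℝ A).comp ((EuclideanSpace.proj i :
            EuclideanSpace ℝ (Fin n) →L[ℝ] ℝ).comp (reVec A n))).contDiff
        exact h2.contMDiff.comp hxs
      refine h1.contMDiffOn.congr fun p hp => ?_
      rw [hφp p hp, hxi p hp i, add_sub_cancel_left]

end

/-! ### The group of automorphisms of the truncated polynomials and its subgroups -/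

section

variable {A : Type u} [NormedCommRing A] [NormedAlgebra ℝ A] [IsWeilAlgebra A]

variable (A) in
/-- The automorphisms are the surjective endomorphisms. -/
noncomputable def autEquivSurjHom : (A ≃ₐ[ℝ] A) ≃ SurjHom A A where
  toFun g := ⟨(g : A →ₐ[ℝ] A), g.surjective⟩
  invFun p := AlgEquiv.ofBijective p.1
    ⟨LinearMap.injective_iff_surjective (f := p.1.toLinearMap) |>.mpr p.2, p.2⟩
  left_inv _ := AlgEquiv.ext fun _ => rfl
  right_inv _ := Subtype.ext (AlgHom.ext fun _ => rfl)

theorem IsMatrixLieGroup.isSmooth_autEquivSurjHom {G : SmoothStructure (A ≃ₐ[ℝ] A)}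
    (hG : IsMatrixLieGroup (MonoidHom.id (A ≃ₐ[ℝ] A)) G) {E : SmoothStructure (SurjHom A A)}
    (hE : IsEvalStructure (fun p => p.1) E) : G.IsSmooth E (autEquivSurjHom A) :=
  hE.contMDiff fun _ => hG.contMDiff_autCLM.clm_apply contMDiff_const

theorem IsMatrixLieGroup.isSmooth_autEquivSurjHom_symm {G : SmoothStructure (A ≃ₐ[ℝ] A)}
    (hG : IsMatrixLieGroup (MonoidHom.id (A ≃ₐ[ℝ] A)) G) {E : SmoothStructure (SurjHom A A)}
    (hE : IsEvalStructure (fun p => p.1) E) : E.IsSmooth G (autEquivSurjHom A).symm := by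
  have h : ContMDiffOn (𝓡 E.dim) (𝓡 G.dim) ∞
      (fun p : E => G.of ((autEquivSurjHom A).symm (E.get p))) univ := by
    refine hG.contMDiffOn_of_autCLM isOpen_univ ?_
    refine (contMDiffOn_compSection (f := fun p : E => (E.get p).1)
      (fun x => (hE.smooth_eval x).contMDiffOn) LinearMap.id).congr fun p _ => ?_
    exact ContinuousLinearMap.ext fun a => rfl
  exact contMDiffOn_univ.mp h

/-- The composite of a surjective morphism with another one. -/
def SurjHom.comp {Q C A : Type*} [CommRing Q] [Algebra ℝ Q] [CommRing C] [Algebra ℝ C]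
    [CommRing A] [Algebra ℝ A] (α : SurjHom C A) (β : SurjHom Q C) : SurjHom Q A :=
  ⟨α.1.comp β.1, α.2.comp β.2⟩

variable {C : Type w} [NormedCommRing C] [NormedAlgebra ℝ C] [IsWeilAlgebra C] {n l : ℕ}

/-- Morphisms to `A` from the truncated polynomials can be lifted to `C`, near a given lifting of
one of them: the images of the variables are lifted by means of a linear section. -/
theorem TruncPoly.hasLocalSections_comp (hl : IsLocalRing.maximalIdeal C ^ (l + 1) = ⊥)
    (α : SurjHom C A) {E : SmoothStructure (SurjHom (TruncPoly n l) C)}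
    (hE : IsEvalStructure (fun p => p.1) E) {E' : SmoothStructure (SurjHom (TruncPoly n l) A)}
    (hE' : IsEvalStructure (fun p => p.1) E') :
    HasLocalSections (𝓡 E.dim) (𝓡 E'.dim) (fun β : E => E'.of (α.comp (E.get β))) := by
  classical
  intro β₀
  obtain ⟨T, hT⟩ := TruncPoly.exists_isEvalStructure (A := C) n hl
  obtain ⟨s, hs⟩ := α.1.toLinearMap.exists_rightInverse_of_surjective
    (LinearMap.range_eq_top.mpr α.2)
  have hs' : ∀ a, α.1 (s a) = a := fun a => congrArg (fun F : A →ₗ[ℝ] A => F a) hs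
  -- the images of the variables are those given by `β₀`, corrected by the linear section `s`
  let c : SurjHom (TruncPoly n l) A → Fin n → C := fun β i =>
    (E.get β₀).1 (var n l i) + s (β.1 (var n l i) - α.1 ((E.get β₀).1 (var n l i)))
  have hc : ∀ β i, c β i ∈ IsLocalRing.maximalIdeal C := by
    intro β i
    have h1 : ∀ f : TruncPoly n l →ₐ[ℝ] A, weilRe A (f (var n l i)) = 0 := fun f =>
      mem_maximalIdeal_iff_weilRe.mp (map_mem_maximalIdeal f (var_mem i))
    refine Ideal.add_mem _ (map_mem_maximalIdeal _ (var_mem i)) ?_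
    rw [mem_maximalIdeal_iff_weilRe, ← weilRe_map α.1, hs', map_sub, h1, sub_eq_zero]
    exact (h1 (α.1.comp (E.get β₀).1)).symm
  let lam : SurjHom (TruncPoly n l) A → TruncPoly n l →ₐ[ℝ] C := fun β => lift hl (c β) (hc β)
  have hlam : ∀ q, ContMDiff (𝓡 E'.dim) 𝓘(ℝ, C) ∞ fun β : E' => lam (E'.get β) q := by
    intro q
    rw [← contMDiffOn_univ]
    refine contMDiffOn_apply (β := fun β : E' => lam (E'.get β)) (r := fun _ => q) (fun i => ?_)
      fun _ => contMDiffOn_const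
    have h1 : ContDiff ℝ ∞ fun a : A => (E.get β₀).1 (var n l i) +
        LinearMap.toContinuousLinearMap s (a - α.1 ((E.get β₀).1 (var n l i))) :=
      contDiff_const.add ((LinearMap.toContinuousLinearMap s).contDiff.comp
        (contDiff_id.sub contDiff_const))
    refine (h1.contMDiff.comp (hE'.smooth_eval (var n l i))).contMDiffOn.congr fun β _ => ?_
    exact lift_var hl _ (hc _) i
  have hsec : ∀ β, α.1.comp (lam β) = β.1 := by
    intro β
    refine algHom_ext fun i => ?_
    rw [AlgHom.comp_apply, lift_var, map_add, hs', add_sub_cancel]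
  have hself : lam (α.comp (E.get β₀)) = (E.get β₀).1 := by
    refine algHom_ext fun i => ?_
    rw [lift_var]
    change (E.get β₀).1 (var n l i) + s (α.1 ((E.get β₀).1 (var n l i)) -
      α.1 ((E.get β₀).1 (var n l i))) = _
    rw [sub_self, map_zero, add_zero]
  have hlamT : ContMDiff (𝓡 E'.dim) (𝓡 T.dim) ∞ fun β : E' => T.of (lam (E'.get β)) :=
    hT.contMDiff hlam
  -- the lifting is onto near `α ∘ β₀`, as surjectivity is an open condition
  let W : Set E' := {β | Function.Surjective (lam (E'.get β))}
  have hW : IsOpen W := hT.isOpen_setOf_surjective.preimage hlamT.continuous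
  let σ : E' → E := fun β => if h : Function.Surjective (lam (E'.get β)) then E.of ⟨_, h⟩ else β₀
  have hσ : ∀ β ∈ W, (E.get (σ β)).1 = lam (E'.get β) := fun β hβ =>
    congrArg (fun p : E => (E.get p).1) (dif_pos hβ)
  have h₀ : E'.of (α.comp (E.get β₀)) ∈ W := by
    change Function.Surjective (lam (α.comp (E.get β₀)))
    rw [hself]
    exact (E.get β₀).2
  refine ⟨W, σ, hW, h₀, ?_, Subtype.ext ((hσ _ h₀).trans hself), fun β hβ => Subtype.ext ?_⟩
  · refine hE.contMDiffOn hW fun q => (hlam q).contMDiffOn.congr fun β hβ => ?_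
    rw [hσ β hβ]
  · change α.1.comp (E.get (σ β)).1 = _
    rw [hσ β hβ]
    exact hsec _

end

/-! ### Trivializations -/

section

variable {n : ℕ} {M : Type v} [TopologicalSpace M] [ChartedSpace (EuclideanSpace ℝ (Fin n)) M]
  {C : Type u} {U : TopologicalSpace.Opens M}

/-- The fibre of a trivialization can be replaced by a diffeomorphic one. -/
theorem IsIsoOver.comp_equiv {C' : Type*} {Y : Type w} {SC : SmoothStructure C}
    {SC' : SmoothStructure C'} {SY : SmoothStructure Y} {near : Y → M → Prop} {Ψ : U → C → Y}
    (h : IsIsoOver n U SC SY near Ψ) (ε : C' ≃ C) (hε : SC'.IsSmooth SC ε)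
    (hε' : SC.IsSmooth SC' ε.symm) : IsIsoOver n U SC' SY near (fun y c => Ψ y (ε c)) := by
  refine ⟨isDiffeoOnto_of_hasLocalSections ?_ ?_ ?_ ?_, fun y c => h.2 y (ε c)⟩
  · exact h.1.contMDiff.comp (contMDiff_fst.prodMk (hε.comp contMDiff_snd))
  · rintro ⟨y, c⟩ ⟨y', c'⟩ hcc
    have h1 := h.1.2.1 (a₁ := (y, SC.of (ε c))) (a₂ := (y', SC.of (ε c'))) hcc
    have h2 : y = y' := congrArg (fun z : U × SC => z.1) h1
    have h3 : ε c = ε c' := congrArg (fun z : U × SC => SC.get z.2) h1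
    exact Prod.ext h2 (ε.injective h3)
  · rw [← h.1.2.2]
    ext p
    constructor
    · rintro ⟨⟨y, c⟩, rfl⟩
      exact ⟨(y, SC.of (ε c)), rfl⟩
    · rintro ⟨⟨y, c⟩, rfl⟩
      exact ⟨(y, SC'.of (ε.symm c)), congrArg (fun c => SY.of (Ψ y c)) (ε.apply_symm_apply c)⟩
  · rintro ⟨y, c⟩
    obtain ⟨W, s, hW, hxW, hs, hsx, hsy⟩ := h.1.hasLocalSections (y, SC.of (ε c))
    refine ⟨W, fun p => ((s p).1, SC'.of (ε.symm (SC.get (s p).2))), hW, hxW, ?_, ?_,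
      fun p hp => ?_⟩
    · exact (contMDiff_fst.comp_contMDiffOn hs).prodMk
        (hε'.comp_contMDiffOn (contMDiff_snd.comp_contMDiffOn hs))
    · refine Prod.ext (congrArg (fun z : U × SC => z.1) hsx) ?_
      refine (congrArg (fun z : U × SC => ε.symm (SC.get z.2)) hsx).trans ?_
      exact ε.symm_apply_apply c
    · refine Eq.trans ?_ (hsy p hp)
      exact congrArg (fun c => SY.of (Ψ (s p).1 c)) (ε.apply_symm_apply _)

/-- A trivialization induces another one between quotients of the fibre and of the total space. -/
theorem IsIsoOver.of_quotient {D : Type*} {Y : Type*} {Z : Type*} {SC : SmoothStructure C}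
    {SD : SmoothStructure D} {SY : SmoothStructure Y} {SZ : SmoothStructure Z}
    {near : Y → M → Prop} {near' : Z → M → Prop} {Ψ : U → C → Y} {Ψ' : U → D → Z}
    (h : IsIsoOver n U SC SY near Ψ) {π : C → D} (hπ : SC.IsSmooth SD π)
    (hπs : HasLocalSections (𝓡 SC.dim) (𝓡 SD.dim) (fun c : SC => SD.of (π (SC.get c))))
    (hπ' : Function.Surjective π) {κ : Y → Z} (hκ : SY.IsSmooth SZ κ)
    (hκs : HasLocalSections (𝓡 SY.dim) (𝓡 SZ.dim) (fun c : SY => SZ.of (κ (SY.get c))))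
    (hκ' : Function.Surjective κ) (hnear : ∀ p x, near' (κ p) x ↔ near p x)
    (hcomp : ∀ y c, Ψ' y (π c) = κ (Ψ y c))
    (hinj : ∀ y c y' c', κ (Ψ y c) = κ (Ψ y' c') → y = y' ∧ π c = π c') :
    IsIsoOver n U SD SZ near' Ψ' := by
  have hsm : ContMDiff ((𝓡 n).prod (𝓡 SC.dim)) (𝓡 SZ.dim) ∞
      (fun z : U × SC => SZ.of (κ (Ψ z.1 (SC.get z.2)))) := hκ.comp h.1.contMDiff
  refine ⟨isDiffeoOnto_of_hasLocalSections ?_ ?_ ?_ ?_, fun y d => ?_⟩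
  -- the induced map is locally `κ ∘ Ψ` composed with a section of `π`
  · rintro ⟨y, d⟩
    obtain ⟨c, rfl⟩ := hπ' d
    obtain ⟨W, s, hW, hxW, hs, -, hsy⟩ := hπs (SC.of c)
    have h1 : ContMDiffOn ((𝓡 n).prod (𝓡 SD.dim)) (𝓡 SZ.dim) ∞
        (fun z : U × SD => SZ.of (κ (Ψ z.1 (SC.get (s z.2))))) (univ ×ˢ W) :=
      hsm.comp_contMDiffOn (contMDiff_fst.contMDiffOn.prodMk
        (hs.comp contMDiff_snd.contMDiffOn fun z hz => hz.2))
    refine ((h1.congr fun z hz => ?_) (y, _) ⟨mem_univ _, hxW⟩).contMDiffAt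
      ((isOpen_univ.prod hW).mem_nhds ⟨mem_univ _, hxW⟩)
    change Ψ' z.1 (SD.get z.2) = κ (Ψ z.1 (SC.get (s z.2)))
    rw [← hcomp]
    exact congrArg (Ψ' z.1) (hsy z.2 hz.2).symm
  · rintro ⟨y, d⟩ ⟨y', d'⟩ hdd
    obtain ⟨c, rfl⟩ := hπ' d
    obtain ⟨c', rfl⟩ := hπ' d'
    obtain ⟨h1, h2⟩ := hinj y c y' c' ((hcomp y c).symm.trans (Eq.trans hdd (hcomp y' c')))
    exact Prod.ext h1 h2
  · ext p
    constructor
    · rintro ⟨⟨y, d⟩, rfl⟩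
      obtain ⟨c, rfl⟩ := hπ' d
      refine ⟨y, y.2, ?_⟩
      change near' (Ψ' y (π c)) y
      rw [hcomp, hnear]
      exact h.2 y c
    · rintro ⟨y, hy, hp⟩
      obtain ⟨q, rfl⟩ := hκ' p
      have hq : SY.of q ∈ {p : SY | ∃ y ∈ U, near (SY.get p) y} := ⟨y, hy, (hnear q y).mp hp⟩
      rw [← h.1.2.2] at hq
      obtain ⟨⟨y', c⟩, hc⟩ := hq
      refine ⟨(y', SD.of (π c)), (hcomp y' c).trans ?_⟩
      exact congrArg κ hc
  -- its inverse is locally `π ∘ Ψ⁻¹` composed with a section of `κ`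
  · rintro ⟨y, d⟩
    obtain ⟨c, rfl⟩ := hπ' d
    obtain ⟨W, s, hW, hxW, hs, hsx, hsy⟩ := h.1.hasLocalSections (y, SC.of c)
    obtain ⟨W', s', hW', hxW', hs', hsx', hsy'⟩ := hκs (SY.of (Ψ y c))
    refine ⟨W' ∩ s' ⁻¹' W, fun p => ((s (s' p)).1, SD.of (π (SC.get (s (s' p)).2))),
      hs'.continuousOn.isOpen_inter_preimage hW' hW, ?_, ?_, ?_, fun p hp => ?_⟩
    · have h1 : SZ.of (Ψ' y (π c)) = SZ.of (κ (Ψ y c)) := hcomp y c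
      change SZ.of (Ψ' y (π c)) ∈ _
      rw [h1]
      refine ⟨hxW', ?_⟩
      change s' _ ∈ W
      exact (congrArg (· ∈ W) hsx').mpr hxW
    · have h1 : ContMDiffOn (𝓡 SZ.dim) ((𝓡 n).prod (𝓡 SC.dim)) ∞ (fun p => s (s' p))
          (W' ∩ s' ⁻¹' W) := hs.comp (hs'.mono inter_subset_left) fun p hp => hp.2
      exact (contMDiff_fst.comp_contMDiffOn h1).prodMk
        (hπ.comp_contMDiffOn (contMDiff_snd.comp_contMDiffOn h1))
    · have h1 : SZ.of (Ψ' y (π c)) = SZ.of (κ (Ψ y c)) := hcomp y c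
      have h2 : s (s' (SZ.of (Ψ' y (π c)))) = (y, SC.of c) := by
        rw [h1]
        exact (congrArg s hsx').trans hsx
      exact Prod.ext (congrArg (fun z : U × SC => z.1) h2)
        (congrArg (fun z : U × SC => π (SC.get z.2)) h2)
    · refine (hcomp _ _).trans ?_
      refine (congrArg κ (hsy _ hp.2)).trans ?_
      exact hsy' p hp.1
  · obtain ⟨c, rfl⟩ := hπ' d
    rw [hcomp, hnear]
    exact h.2 y c

/-- A trivialization gives smooth sections, one for each element of the fibre. -/
theorem IsIsoOver.contMDiff_section {Y : Type*} {SC : SmoothStructure C} {SY : SmoothStructure Y}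
    {near : Y → M → Prop} {Ψ : U → C → Y} (h : IsIsoOver n U SC SY near Ψ) (c : C) :
    ContMDiff (𝓡 n) (𝓡 SY.dim) ∞ (fun y => SY.of (Ψ y c)) :=
  h.1.contMDiff.comp (contMDiff_id.prodMk (contMDiff_const (c := SC.of c)))

end

/-! ### The homogeneous spaces -/

section

/-- Local sections compose. -/
theorem HasLocalSections.comp {E E' E'' H H' H'' N N' N'' : Type*} [NormedAddCommGroup E]
    [NormedSpace ℝ E] [NormedAddCommGroup E'] [NormedSpace ℝ E'] [NormedAddCommGroup E'']
    [NormedSpace ℝ E''] [TopologicalSpace H] [TopologicalSpace H'] [TopologicalSpace H'']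
    {I : ModelWithCorners ℝ E H} {I' : ModelWithCorners ℝ E' H'} {I'' : ModelWithCorners ℝ E'' H''}
    [TopologicalSpace N] [ChartedSpace H N] [TopologicalSpace N'] [ChartedSpace H' N']
    [TopologicalSpace N''] [ChartedSpace H'' N''] {g : N' → N''} {f : N → N'}
    (hg : HasLocalSections I' I'' g) (hf : HasLocalSections I I' f) :
    HasLocalSections I I'' (fun x => g (f x)) := by
  intro x
  obtain ⟨W, s, hW, hxW, hs, hsx, hsy⟩ := hf x
  obtain ⟨W', s', hW', hxW', hs', hsx', hsy'⟩ := hg (f x)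
  refine ⟨W' ∩ s' ⁻¹' W, fun y => s (s' y), hs'.continuousOn.isOpen_inter_preimage hW' hW,
    ⟨hxW', ?_⟩, hs.comp (hs'.mono inter_subset_left) fun y hy => hy.2, ?_, fun y hy => ?_⟩
  · rw [mem_preimage, hsx']
    exact hxW
  · exact (congrArg s hsx').trans hsx
  · exact (congrArg g (hsy _ hy.2)).trans (hsy' y hy.1)

theorem SmoothStructure.hasLocalSections_equiv {X : Type*} {Y : Type*} {S : SmoothStructure X}
    {S' : SmoothStructure Y} (ε : X ≃ Y) (h : S'.IsSmooth S ε.symm) :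
    HasLocalSections (𝓡 S.dim) (𝓡 S'.dim) (fun x : S => S'.of (ε (S.get x))) := fun x =>
  ⟨univ, fun y => S.of (ε.symm (S'.get y)), isOpen_univ, mem_univ _, h.contMDiffOn,
    ε.symm_apply_apply x, fun y _ => ε.apply_symm_apply y⟩

theorem RightCosets.mk_eq_iff {G : Type*} [Group G] {H : Subgroup G} {a b : G} :
    (Quotient.mk _ a : RightCosets H) = Quotient.mk _ b ↔ b * a⁻¹ ∈ H :=
  Quotient.eq.trans QuotientGroup.rightRel_apply

variable {R : Type v} {A : Type u} [CommRing R] [Algebra ℝ R] [CommRing A] [Algebra ℝ A]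

/-- The image of a surjective morphism by an automorphism of the source. -/
def SurjHom.compAut (α : SurjHom R A) (g : R ≃ₐ[ℝ] R) : SurjHom R A :=
  ⟨α.1.comp (g : R →ₐ[ℝ] R), α.2.comp g.surjective⟩

theorem SurjHom.compAut_eq_iff (α : SurjHom R A) (g g' : R ≃ₐ[ℝ] R) :
    α.compAut g = α.compAut g' ↔ g' * g⁻¹ ∈ autOver α.1 := by
  have h1 : g' * g⁻¹ ∈ autOver α.1 ↔ ∀ r, α.1 ((g' * g⁻¹) r) = α.1 r := Iff.rfl
  rw [h1]
  constructor
  · intro h r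
    have h2 : α.1 (g (g⁻¹ r)) = α.1 (g' (g⁻¹ r)) :=
      congrArg (fun p : SurjHom R A => p.1 (g⁻¹ r)) h
    rw [AlgEquiv.mul_apply, ← h2, ← AlgEquiv.mul_apply, mul_inv_cancel, AlgEquiv.one_apply]
  · intro h
    refine Subtype.ext (AlgHom.ext fun r => ?_)
    have h2 := h (g r)
    rw [← AlgEquiv.mul_apply, inv_mul_cancel_right] at h2
    exact h2.symm

/-- When the automorphisms of `R` act transitively on the surjective morphisms `R → A`, these are
the right cosets of the subgroup that fixes one of them. -/
noncomputable def cosetsEquivSurjHom (α : SurjHom R A)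
    (htr : ∀ β : SurjHom R A, ∃ g, α.compAut g = β) : RightCosets (autOver α.1) ≃ SurjHom R A :=
  Equiv.ofBijective (Quotient.lift α.compAut fun g g' h =>
    (α.compAut_eq_iff g g').mpr (QuotientGroup.rightRel_apply.mp h)) ⟨by
      intro c c'
      induction c using Quotient.inductionOn with | _ g =>
      induction c' using Quotient.inductionOn with | _ g' =>
      intro h
      exact RightCosets.mk_eq_iff.mpr ((α.compAut_eq_iff g g').mp h), fun β => by
      obtain ⟨g, hg⟩ := htr β
      exact ⟨Quotient.mk _ g, hg⟩⟩

/-- The cosets of the stabilizer of the kernel of `α` are the orbits of the automorphisms of `A` in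
the surjective morphisms. -/
theorem exists_surjHom_to_cosets (α : SurjHom R A)
    (htr : ∀ β : SurjHom R A, ∃ g, α.compAut g = β) :
    ∃ π : SurjHom R A → RightCosets (autStab (RingHom.ker α.1)),
      (∀ g, π (α.compAut g) = Quotient.mk _ g) ∧
      ∀ p q, π p = π q ↔ ∃ h : A ≃ₐ[ℝ] A, SurjHom.act h p = q := by
  have key : ∀ g g' : R ≃ₐ[ℝ] R, g' * g⁻¹ ∈ autStab (RingHom.ker α.1) ↔
      ∃ h : A ≃ₐ[ℝ] A, SurjHom.act h (α.compAut g) = α.compAut g' := by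
    intro g g'
    constructor
    · intro h
      obtain ⟨k, hk⟩ := exists_aut_of_mem_autStab α.2 h
      refine ⟨k, Subtype.ext (AlgHom.ext fun r => ?_)⟩
      have h2 := hk (g r)
      rw [← AlgEquiv.mul_apply, inv_mul_cancel_right] at h2
      exact h2
    · rintro ⟨h, hh⟩
      refine mem_autStab_ker_of_comp_eq (h := h) fun r => ?_
      have h2 : h (α.1 (g (g⁻¹ r))) = α.1 (g' (g⁻¹ r)) :=
        congrArg (fun p : SurjHom R A => p.1 (g⁻¹ r)) hh
      rw [AlgEquiv.mul_apply, ← h2, ← AlgEquiv.mul_apply, mul_inv_cancel, AlgEquiv.one_apply]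
  choose γ hγ using htr
  refine ⟨fun β => Quotient.mk _ (γ β), fun g => ?_, fun p q => ?_⟩
  · rw [RightCosets.mk_eq_iff, key]
    exact ⟨1, hγ _⟩
  · rw [RightCosets.mk_eq_iff, key, hγ, hγ]

end

section

variable {R : Type v} {A : Type u} [NormedCommRing R] [NormedAlgebra ℝ R] [IsWeilAlgebra R]
  [NormedCommRing A] [NormedAlgebra ℝ A] [IsWeilAlgebra A]

/-- An automorphism `h` of `A` near a given one is lifted to `R` by lifting the surjective morphism
`h ∘ α` along `g ↦ α ∘ g`; the lifting leaves the kernel of `α` invariant. -/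
theorem isSubmersion_autStabHom (α : SurjHom R A) {G : SmoothStructure (R ≃ₐ[ℝ] R)}
    (hG : IsMatrixLieGroup (MonoidHom.id (R ≃ₐ[ℝ] R)) G) {E : SmoothStructure (SurjHom R A)}
    (hE : IsEvalStructure (fun p => p.1) E)
    (hsec : HasLocalSections (𝓡 G.dim) (𝓡 E.dim) (fun g : G => E.of (α.compAut (G.get g))))
    {L : SmoothStructure (A ≃ₐ[ℝ] A)} (hL : IsMatrixLieGroup (MonoidHom.id (A ≃ₐ[ℝ] A)) L)
    {K : SmoothStructure (autStab (RingHom.ker α.1))}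
    (hK : IsMatrixLieGroup (autStab (RingHom.ker α.1)).subtype K) :
    K.IsSubmersion L (autStabHom α.1 α.2) := by
  classical
  have hsm : ContMDiffOn (𝓡 K.dim) (𝓡 L.dim) ∞
      (fun k : K => L.of (autStabHom α.1 α.2 (K.get k))) univ := by
    obtain ⟨s, hs⟩ := α.1.toLinearMap.exists_rightInverse_of_surjective
      (LinearMap.range_eq_top.mpr α.2)
    have hs' : ∀ a, α.1 (s a) = a := fun a => congrArg (fun F : A →ₗ[ℝ] A => F a) hs
    have h1 : ContDiff ℝ ∞ fun u : R →L[ℝ] R => (LinearMap.toContinuousLinearMap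
        α.1.toLinearMap).comp (u.comp (LinearMap.toContinuousLinearMap s)) :=
      contDiff_const.clm_comp (contDiff_id.clm_comp contDiff_const)
    refine hL.contMDiffOn_of_autCLM isOpen_univ ((h1.contMDiff.comp
      hK.contMDiff_autCLM).contMDiffOn.congr fun k _ => ?_)
    ext a
    change autStabHom α.1 α.2 (K.get k) a = α.1 ((K.get k).1 (s a))
    rw [← autStabHom_apply α.1 α.2, hs']
  refine isSubmersion_of_hasLocalSections (contMDiffOn_univ.mp hsm) fun k₀ => ?_
  obtain ⟨W, σ, hW, hxW, hσ, hσx, hσy⟩ := hsec (G.of (K.get k₀).1)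
  let ρ : L → E := fun h => E.of (SurjHom.act (L.get h) α)
  have hρ : ContMDiff (𝓡 L.dim) (𝓡 E.dim) ∞ ρ :=
    hE.contMDiff fun q => hL.contMDiff_autCLM.clm_apply (contMDiff_const (c := α.1 q))
  have hρσ : ∀ h ∈ ρ ⁻¹' W, ∀ r, α.1 (G.get (σ (ρ h)) r) = L.get h (α.1 r) := fun h hh r =>
    congrArg (fun p : SurjHom R A => p.1 r) (hσy _ hh)
  have hρ₀ : ρ (L.of (autStabHom α.1 α.2 (K.get k₀))) = E.of (α.compAut (K.get k₀).1) :=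
    Subtype.ext (AlgHom.ext fun r => autStabHom_apply α.1 α.2 (K.get k₀) r)
  let τ : L → K := fun h => if hh : h ∈ ρ ⁻¹' W then
    K.of ⟨G.get (σ (ρ h)), mem_autStab_ker_of_comp_eq (hρσ h hh)⟩ else k₀
  have hτ : ∀ h ∈ ρ ⁻¹' W, (K.get (τ h)).1 = G.get (σ (ρ h)) := fun h hh =>
    congrArg (fun k : K => (K.get k).1) (dif_pos hh)
  have h₀ : L.of (autStabHom α.1 α.2 (K.get k₀)) ∈ ρ ⁻¹' W := by
    rw [mem_preimage, hρ₀]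
    exact hxW
  refine ⟨ρ ⁻¹' W, τ, hW.preimage hρ.continuous, h₀, ?_, ?_, fun h hh => ?_⟩
  · refine hK.contMDiffOn_of_autCLM (hW.preimage hρ.continuous)
      (((hG.contMDiff_autCLM.comp_contMDiffOn hσ).comp hρ.contMDiffOn fun h hh => hh).congr
        fun h hh => ?_)
    change autCLM R (K.get (τ h)).1 = _
    rw [hτ h hh]
    rfl
  · refine Subtype.ext ((hτ _ h₀).trans ?_)
    rw [hρ₀]
    exact hσx
  · refine (autStabHom_eq_iff α.1 α.2 _ _).mpr fun r => ?_
    rw [hτ h hh]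
    exact hρσ h hh r

end

/-! ### The manifolds of regular points and of jets -/

section

variable {n : ℕ} {M : Type v} [TopologicalSpace M] [ChartedSpace (EuclideanSpace ℝ (Fin n)) M]
  [IsManifold (𝓡 n) ∞ M] [T2Space M] [SecondCountableTopology M]
  {A : Type u} [NormedCommRing A] [NormedAlgebra ℝ A] [IsWeilAlgebra A]

variable (n M A) in
theorem exists_isRegularWeilStructure : ∃ S : SmoothStructure (RegularPoint n M A),
    IsRegularWeilStructure S ∧ IsEvalStructure (fun p => p.1) S := by
  obtain ⟨T, hT, hTW⟩ := exists_isWeilStructure n M A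
  obtain ⟨S, hS, hSe⟩ := hT.exists_surjHom
  exact ⟨S, ⟨T, hTW, hS⟩, hSe⟩

variable (A) in
theorem TruncPoly.exists_surjHom_structure (n : ℕ) {l : ℕ}
    (hl : IsLocalRing.maximalIdeal A ^ (l + 1) = ⊥) :
    ∃ E : SmoothStructure (SurjHom (TruncPoly n l) A), IsEvalStructure (fun p => p.1) E := by
  obtain ⟨T, hT⟩ := TruncPoly.exists_isEvalStructure (A := A) n hl
  obtain ⟨E, -, hE⟩ := hT.exists_surjHom
  exact ⟨E, hE⟩

end

/-- The quotient of the stabilizer of the kernel of `α` by the automorphisms over `α`. -/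
theorem exists_quotientEquiv_aut {R : Type v} {A : Type u} [CommRing R] [Algebra ℝ R] [CommRing A]
    [Algebra ℝ A] (α : R →ₐ[ℝ] A) (hα : Function.Surjective α)
    (hs : Function.Surjective (autStabHom α hα)) :
    ∃ (_ : ((autOver α).subgroupOf (autStab (RingHom.ker α))).Normal)
      (e : (autStab (RingHom.ker α) ⧸ (autOver α).subgroupOf (autStab (RingHom.ker α))) ≃*
        (A ≃ₐ[ℝ] A)), ∀ g, e (QuotientGroup.mk g) = autStabHom α hα g := by
  have hN : ((autOver α).subgroupOf (autStab (RingHom.ker α))).Normal := by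
    rw [← ker_autStabHom α hα]
    infer_instance
  exact ⟨hN, (QuotientGroup.quotientMulEquivOfEq (ker_autStabHom α hα).symm).trans
    (QuotientGroup.quotientKerEquivOfSurjective _ hs), fun g => rfl⟩

section

variable {R : Type v} {A : Type u} [NormedCommRing R] [NormedAlgebra ℝ R] [IsWeilAlgebra R]
  [NormedCommRing A] [NormedAlgebra ℝ A]

/-- The map `g ↦ α ∘ g` is smooth. -/
theorem contMDiff_compAut (α : SurjHom R A) {G : SmoothStructure (R ≃ₐ[ℝ] R)}
    (hG : IsMatrixLieGroup (MonoidHom.id (R ≃ₐ[ℝ] R)) G) {E : SmoothStructure (SurjHom R A)}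
    (hE : IsEvalStructure (fun p => p.1) E) :
    ContMDiff (𝓡 G.dim) (𝓡 E.dim) ∞ (fun g : G => E.of (α.compAut (G.get g))) :=
  hE.contMDiff fun q => (LinearMap.toContinuousLinearMap α.1.toLinearMap).contDiff.contMDiff.comp
    (hG.contMDiff_autCLM.clm_apply (contMDiff_const (c := q)))

end

/-- The homogeneous spaces of the two subgroups attached to a surjective morphism `α`: the first one
is the manifold of the surjective morphisms, the second one is its quotient by the automorphisms of
`A`. -/
theorem exists_homogeneous_structures {R : Type v} {A : Type u} [CommRing R] [Algebra ℝ R]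
    [NormedCommRing A] [NormedAlgebra ℝ A] [IsWeilAlgebra A] (α : SurjHom R A)
    (htr : ∀ β : SurjHom R A, ∃ g, α.compAut g = β) {G : SmoothStructure (R ≃ₐ[ℝ] R)}
    {E : SmoothStructure (SurjHom R A)} (hE : IsEvalStructure (fun p => p.1) E)
    (hc : ContMDiff (𝓡 G.dim) (𝓡 E.dim) ∞ (fun g : G => E.of (α.compAut (G.get g))))
    (hsec : HasLocalSections (𝓡 G.dim) (𝓡 E.dim) (fun g : G => E.of (α.compAut (G.get g))))
    {L : SmoothStructure (A ≃ₐ[ℝ] A)} (hL : IsMatrixLieGroup (MonoidHom.id (A ≃ₐ[ℝ] A)) L) :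
    ∃ (Qα : SmoothStructure (RightCosets (autOver α.1)))
      (QI : SmoothStructure (RightCosets (autStab (RingHom.ker α.1))))
      (π : SurjHom R A → RightCosets (autStab (RingHom.ker α.1))),
      G.IsSubmersion Qα (Quotient.mk _) ∧ G.IsSubmersion QI (Quotient.mk _) ∧
      Qα.IsSmooth E (cosetsEquivSurjHom α htr) ∧ E.IsSmooth Qα (cosetsEquivSurjHom α htr).symm ∧
      (∀ g, π (α.compAut g) = Quotient.mk _ g) ∧
      (∀ p q, π p = π q ↔ ∃ h : A ≃ₐ[ℝ] A, SurjHom.act h p = q) ∧ E.IsSmooth QI π ∧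
      HasLocalSections (𝓡 E.dim) (𝓡 QI.dim) (fun p : E => QI.of (π (E.get p))) := by
  obtain ⟨Qα, hε, hε'⟩ := E.exists_equiv (cosetsEquivSurjHom α htr)
  obtain ⟨π, hπ, hπf⟩ := exists_surjHom_to_cosets α htr
  have hπ' : Function.Surjective π := fun c => by
    induction c using Quotient.inductionOn with | _ g =>
    exact ⟨_, hπ g⟩
  obtain ⟨QI, hπs, hπl⟩ := exists_quotient_by_aut hL hE.smooth_eval
    (IsEvalStructure.contMDiff_act hL hE) hπ' hπf
  refine ⟨Qα, QI, π, ?_, ?_, hε, hε', hπ, hπf, hπs, hπl⟩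
  · have hmk : (Quotient.mk _ : _ → RightCosets (autOver α.1)) =
        fun g => (cosetsEquivSurjHom α htr).symm (α.compAut g) :=
      funext fun g => ((cosetsEquivSurjHom α htr).symm_apply_eq.mpr rfl).symm
    rw [hmk]
    exact isSubmersion_of_hasLocalSections (hε'.comp hc)
      ((SmoothStructure.hasLocalSections_equiv (cosetsEquivSurjHom α htr).symm hε).comp hsec)
  · rw [← funext hπ]
    exact isSubmersion_of_hasLocalSections (hπs.comp hc) (hπl.comp hsec)

section

variable {n : ℕ} {M : Type v} [TopologicalSpace M] [ChartedSpace (EuclideanSpace ℝ (Fin n)) M]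
  [IsManifold (𝓡 n) ∞ M] [T2Space M]
  {R : Type w} [CommRing R] [Algebra ℝ R] [IsWeilAlgebra R]
  {A : Type u} [CommRing A] [Algebra ℝ A] [IsWeilAlgebra A]

/-- Two images of regular points near `y` and `y'` have the same jet only if `y = y'` and the
morphisms differ by an automorphism. -/
theorem RegularPoint.exists_act_eq_of_ker_map_eq {p p' : RegularPoint n M R} {y y' : M}
    (hp : p.IsNear y) (hp' : p'.IsNear y') {β β' : SurjHom R A}
    (h : (p.map β.1 β.2).ker = (p'.map β'.1 β'.2).ker) :
    y = y' ∧ (p = p' → ∃ g : A ≃ₐ[ℝ] A, SurjHom.act g β = β') := by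
  obtain ⟨g, hg⟩ := RegularPoint.ker_eq_iff.mp h
  have h1 : APoint.IsNear (p'.map β'.1 β'.2).1 y := by
    rw [← hg]
    exact (APoint.IsNear.map hp β.1).map (g : A →ₐ[ℝ] A)
  refine ⟨h1.eq (APoint.IsNear.map hp' β'.1), ?_⟩
  rintro rfl
  refine ⟨g, Subtype.ext (AlgHom.ext fun r => ?_)⟩
  obtain ⟨f, rfl⟩ := p.2 r
  exact congrArg (fun q : RegularPoint n M A => q.1 f) hg

variable [SecondCountableTopology M]

/-- The trivialization of the regular points over an open set induces the one of the jets. -/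
theorem exists_isIsoOver_jet {U : TopologicalSpace.Opens M} {ξ : U → RegularPoint n M R}
    (hξ : ∀ y : U, (ξ y).IsNear (y : M)) {E : SmoothStructure (SurjHom R A)}
    {S : SmoothStructure (RegularPoint n M A)}
    (hE : IsIsoOver n U E S RegularPoint.IsNear (fun y β => (ξ y).map β.1 β.2))
    {J : SmoothStructure (Jet n M A)} (hker : S.IsSmooth J RegularPoint.ker)
    (hkers : HasLocalSections (𝓡 S.dim) (𝓡 J.dim) (fun p : S => J.of (S.get p).ker))
    {B : Type*} {QI : SmoothStructure B} {π : SurjHom R A → B} (hπ' : Function.Surjective π)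
    (hπf : ∀ p q, π p = π q ↔ ∃ h : A ≃ₐ[ℝ] A, SurjHom.act h p = q) (hπs : E.IsSmooth QI π)
    (hπl : HasLocalSections (𝓡 E.dim) (𝓡 QI.dim) (fun p : E => QI.of (π (E.get p)))) :
    ∃ ΨJ : U → B → Jet n M A, (∀ y β, ΨJ y (π β) = ((ξ y).map β.1 β.2).ker) ∧
      IsIsoOver n U QI J Jet.IsNear ΨJ := by
  let ΨJ : U → B → Jet n M A := fun y c =>
    ((ξ y).map (Function.surjInv hπ' c).1 (Function.surjInv hπ' c).2).ker
  have hΨJ : ∀ y β, ΨJ y (π β) = ((ξ y).map β.1 β.2).ker := by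
    intro y β
    obtain ⟨g, hg⟩ := (hπf _ _).mp (Function.surjInv_eq hπ' (π β))
    refine RegularPoint.ker_eq_iff.mpr ⟨g, Subtype.ext (AlgHom.ext fun f => ?_)⟩
    exact congrArg (fun p : SurjHom R A => p.1 ((ξ y).1 f)) hg
  refine ⟨ΨJ, hΨJ, hE.of_quotient hπs hπl hπ' hker hkers RegularPoint.ker_surjective
    (fun p x => RegularPoint.isNear_ker_iff) hΨJ fun y β y' β' h => ?_⟩
  obtain ⟨h3, h4⟩ := RegularPoint.exists_act_eq_of_ker_map_eq (hξ y) (hξ y') h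
  have h5 : y = y' := Subtype.ext h3
  exact ⟨h5, (hπf _ _).mpr (h4 (congrArg ξ h5))⟩

end

/-- The manifold of the regular points with values in the truncated polynomials, their group of
automorphisms, and the maps from this group to the surjective morphisms and to the automorphisms
of `A`. -/
theorem TruncPoly.exists_structures (n l : ℕ) (M : Type v) [TopologicalSpace M]
    [ChartedSpace (EuclideanSpace ℝ (Fin n)) M] [IsManifold (𝓡 n) ∞ M] [T2Space M]
    [SecondCountableTopology M] {A : Type u} [NormedCommRing A] [NormedAlgebra ℝ A]
    [IsWeilAlgebra A] {E : SmoothStructure (SurjHom (TruncPoly n l) A)}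
    (hE : IsEvalStructure (fun p => p.1) E) {L : SmoothStructure (A ≃ₐ[ℝ] A)}
    (hL : IsMatrixLieGroup (MonoidHom.id (A ≃ₐ[ℝ] A)) L) :
    ∃ (F : SmoothStructure (RegularPoint n M (TruncPoly n l)))
      (G : SmoothStructure (TruncPoly n l ≃ₐ[ℝ] TruncPoly n l)),
      IsRegularWeilStructure F ∧ IsMatrixLieGroup (MonoidHom.id _) G ∧
      (∀ φ ∈ IsManifold.maximalAtlas (𝓡 n) ∞ M,
        ∀ ξ : chartDomain φ → RegularPoint n M (TruncPoly n l), IsCoordinateSection φ ξ →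
        (∀ f (ℓ : TruncPoly n l →ₗ[ℝ] ℝ), ContMDiff (𝓡 n) 𝓘(ℝ, ℝ) ∞ (fun y => ℓ ((ξ y).1 f))) →
        IsIsoOver n (chartDomain φ) G F RegularPoint.IsNear (fun y g => g • ξ y)) ∧
      ∀ α : SurjHom (TruncPoly n l) A,
        ContMDiff (𝓡 G.dim) (𝓡 E.dim) ∞ (fun g : G => E.of (α.compAut (G.get g))) ∧
        HasLocalSections (𝓡 G.dim) (𝓡 E.dim) (fun g : G => E.of (α.compAut (G.get g))) ∧
        ∃ K : SmoothStructure (autStab (RingHom.ker α.1)),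
          IsMatrixLieGroup (autStab (RingHom.ker α.1)).subtype K ∧
          K.IsSubmersion L (autStabHom α.1 α.2) := by
  let : NormedCommRing (TruncPoly n l) := finiteNormedCommRing _
  let : NormedAlgebra ℝ (TruncPoly n l) := finiteNormedAlgebra _
  obtain ⟨F, hFW, hF⟩ := exists_isRegularWeilStructure n M (TruncPoly n l)
  obtain ⟨G, hG⟩ := exists_isMatrixLieGroup_aut (A := TruncPoly n l)
  obtain ⟨E', hE'⟩ := TruncPoly.exists_surjHom_structure (TruncPoly n l) n (l := l)
    TruncPoly.maximalIdeal_pow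
  refine ⟨F, G, hFW, hG, fun φ hφ ξ hξ hξs => ?_, fun α => ?_⟩
  · exact (hξ.isIsoOver (A := TruncPoly n l) TruncPoly.maximalIdeal_pow hφ hξs hE' hF).comp_equiv
      (autEquivSurjHom _) (hG.isSmooth_autEquivSurjHom hE') (hG.isSmooth_autEquivSurjHom_symm hE')
  · have hsec := (TruncPoly.hasLocalSections_comp (C := TruncPoly n l)
      TruncPoly.maximalIdeal_pow α hE' hE).comp
      (SmoothStructure.hasLocalSections_equiv (autEquivSurjHom _)
        (hG.isSmooth_autEquivSurjHom_symm hE'))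
    obtain ⟨K, hK⟩ := exists_isMatrixLieGroup_autStab (RingHom.ker α.1)
    exact ⟨contMDiff_compAut α hG hE, hsec, K, hK, isSubmersion_autStabHom α hG hE hsec hL hK⟩

end

theorem mainTheorem1 {A : Type u} [CommRing A] [Algebra ℝ A] [IsWeilAlgebra A]
    {n : ℕ} {M : Type v} [TopologicalSpace M] [ChartedSpace (EuclideanSpace ℝ (Fin n)) M]
    [IsManifold (𝓡 n) ∞ M] [T2Space M] [SecondCountableTopology M]
    (hn : weilWidth A ≤ n) :
    ∃ (S : SmoothStructure (RegularPoint n M A)) (J : SmoothStructure (Jet n M A))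
      (L : SmoothStructure (A ≃ₐ[ℝ] A)),
      IsRegularWeilStructure S ∧
      IsMatrixLieGroup (MonoidHom.id (A ≃ₐ[ℝ] A)) L ∧
      IsPrincipalBundle L S J RegularPoint.ker ∧
      S.IsSubmersion J RegularPoint.ker ∧
      (∀ J' : SmoothStructure (Jet n M A), S.IsSubmersion J' RegularPoint.ker → J'.Same J) ∧
      ∃ (F : SmoothStructure (RegularPoint n M (TruncPoly n (weilOrder A))))
        (G : SmoothStructure (TruncPoly n (weilOrder A) ≃ₐ[ℝ] TruncPoly n (weilOrder A))),
        IsRegularWeilStructure F ∧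
        IsMatrixLieGroup (MonoidHom.id _) G ∧
        (∃ α : TruncPoly n (weilOrder A) →ₐ[ℝ] A, Function.Surjective α) ∧
        ∀ (α : TruncPoly n (weilOrder A) →ₐ[ℝ] A) (hα : Function.Surjective α),
          -- the group `G_I / G_α` is `Aut A`
          autOver α ≤ autStab (RingHom.ker α) ∧
          (∃ (_ : ((autOver α).subgroupOf (autStab (RingHom.ker α))).Normal)
            (e : (autStab (RingHom.ker α) ⧸
              (autOver α).subgroupOf (autStab (RingHom.ker α))) ≃* (A ≃ₐ[ℝ] A))
            (K : SmoothStructure (autStab (RingHom.ker α))),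
            (∀ (g : autStab (RingHom.ker α)) (r : TruncPoly n (weilOrder A)),
              e (QuotientGroup.mk g) (α r) = α (g.1 r)) ∧
            IsMatrixLieGroup (autStab (RingHom.ker α)).subtype K ∧
            K.IsSubmersion L (fun g => e (QuotientGroup.mk g))) ∧
          -- the homogeneous manifolds `G / G_α` and `G / G_I`
          ∃ (Qα : SmoothStructure (RightCosets (autOver α)))
            (QI : SmoothStructure (RightCosets (autStab (RingHom.ker α)))),
            G.IsSubmersion Qα (Quotient.mk _) ∧
            G.IsSubmersion QI (Quotient.mk _) ∧
            -- the sections and the trivializations over each coordinate open set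
            ∀ φ ∈ IsManifold.maximalAtlas (𝓡 n) ∞ M,
              ∃ ξ : chartDomain φ → RegularPoint n M (TruncPoly n (weilOrder A)),
                IsCoordinateSection φ ξ ∧
                (∀ ξ', IsCoordinateSection φ ξ' → ξ' = ξ) ∧
                ContMDiff (𝓡 n) (𝓡 F.dim) ∞ (fun y => F.of (ξ y)) ∧
                ContMDiff (𝓡 n) (𝓡 S.dim) ∞ (fun y => S.of ((ξ y).map α hα)) ∧
                ContMDiff (𝓡 n) (𝓡 J.dim) ∞ (fun y => J.of ((ξ y).map α hα).ker) ∧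
                ∃ (ΨS : chartDomain φ → RightCosets (autOver α) → RegularPoint n M A)
                  (ΨJ : chartDomain φ → RightCosets (autStab (RingHom.ker α)) → Jet n M A),
                  (∀ y g, ΨS y (Quotient.mk _ g) = (g • ξ y).map α hα) ∧
                  (∀ y g, ΨJ y (Quotient.mk _ g) = ((g • ξ y).map α hα).ker) ∧
                  IsIsoOver n (chartDomain φ) G F RegularPoint.IsNear (fun y g => g • ξ y) ∧
                  IsIsoOver n (chartDomain φ) Qα S RegularPoint.IsNear ΨS ∧
                  IsIsoOver n (chartDomain φ) QI J Jet.IsNear ΨJ := by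
  let : NormedCommRing A := finiteNormedCommRing A
  let : NormedAlgebra ℝ A := finiteNormedAlgebra A
  obtain ⟨L, hL⟩ := exists_isMatrixLieGroup_aut (A := A)
  obtain ⟨S, hSW, hS⟩ := exists_isRegularWeilStructure n M A
  obtain ⟨J, hker, hkers⟩ := exists_quotient_by_aut hL hS.smooth_eval
    (IsEvalStructure.contMDiff_act hL hS) RegularPoint.ker_surjective
    fun p q => RegularPoint.ker_eq_iff
  have hsub : S.IsSubmersion J RegularPoint.ker := isSubmersion_of_hasLocalSections hker hkers
  refine ⟨S, J, L, hSW, hL, isPrincipalBundle_ker hL hS hker hkers, hsub, fun J' hJ' => ?_, ?_⟩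
  · have hker' : S.IsSmooth J' RegularPoint.ker := hJ'.contMDiff
    exact ⟨contMDiff_of_comp_surjective (hasLocalSections_of_isSubmersion hJ')
      RegularPoint.ker_surjective hker,
      contMDiff_of_comp_surjective hkers RegularPoint.ker_surjective hker'⟩
  obtain ⟨E, hE⟩ := TruncPoly.exists_surjHom_structure A n (maximalIdeal_pow_weilOrder A)
  obtain ⟨F, G, hFW, hG, hGF, hGE⟩ := TruncPoly.exists_structures n (weilOrder A) M hE hL
  have htr : ∀ α β : SurjHom (TruncPoly n (weilOrder A)) A, ∃ g, α.compAut g = β := fun α β => by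
    obtain ⟨g, hg⟩ := TruncPoly.exists_aut_comp_eq α.1 β.1 α.2 β.2
    exact ⟨g, Subtype.ext (AlgHom.ext hg)⟩
  refine ⟨F, G, hFW, hG, TruncPoly.exists_surjective hn, fun α hα => ⟨autOver_le_autStab α, ?_⟩⟩
  obtain ⟨hc, hsec, K, hK, hKL⟩ := hGE ⟨α, hα⟩
  refine ⟨?_, ?_⟩
  · obtain ⟨hN, e, he⟩ := exists_quotientEquiv_aut α hα (TruncPoly.autStabHom_surjective α hα)
    refine ⟨hN, e, K, fun g r => ?_, hK, ?_⟩
    · rw [he, autStabHom_apply]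
    · rwa [← funext he] at hKL
  · obtain ⟨Qα, QI, π, h1, h2, hε, hε', hπ, hπf, hπs, hπl⟩ :=
      exists_homogeneous_structures ⟨α, hα⟩ (htr ⟨α, hα⟩) hE hc hsec hL
    refine ⟨Qα, QI, h1, h2, fun φ hφ => ?_⟩
    obtain ⟨ξ, hξ, hξs⟩ := exists_isCoordinateSection (weilOrder A) hφ
    have hF' := hGF φ hφ ξ hξ hξs
    have hSE := hξ.isIsoOver (maximalIdeal_pow_weilOrder A) hφ hξs hE hS
    have hSQ := hSE.comp_equiv _ hε hε'
    obtain ⟨ΨJ, hΨJ, hJQ⟩ := exists_isIsoOver_jet hξ.near hSE hker hkers (fun c => by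
      induction c using Quotient.inductionOn with | _ g =>
      exact ⟨_, hπ g⟩) hπf hπs hπl
    have hΨJ' : ∀ y g, ΨJ y (Quotient.mk _ g) = ((g • ξ y).map α hα).ker := fun y g => by
      rw [← hπ g, hΨJ]
      rfl
    refine ⟨ξ, hξ, fun ξ' hξ' => hξ.eq hφ hξ', hF'.contMDiff_section 1,
      hSQ.contMDiff_section (Quotient.mk _ 1), ?_, _, ΨJ, fun y g => rfl, hΨJ', hF', hSQ, hJQ⟩
    refine (hJQ.contMDiff_section (Quotient.mk _ 1)).congr fun y => ?_
    rw [hΨJ', one_smul]
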